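/- Model of computation: a unit-cost real RAM, that is, a fixed program over registers and (indirectly addressed, initially zero) arrays that hold natural numbers or real numbers; the operations, each costing one step, are constants, array access, $+$, truncated $-$ and halving of natural numbers, the operations $+,-,\times,/,\sqrt{\ }$ on reals, and comparisons of two naturals or two reals. A convex $n$-gon ($n\ge 3$) is given by $n$, by the array $p_0,\dots,p_{n-1}\in\mathbb{R}^2$ of its vertices in counterclockwise order (every three vertices, in the order of the array, make a strict left turn), and by $\varepsilon$. Let $P$ be the convex hull of the vertices. A maximum area inscribed rectangle (MAIR) of $P$ is a rectangle $R_{opt}\subseteq P$, of any orientation, whose area $|R_{opt}|$ is the largest among all rectangles contained in $P$. An $\varepsilon$-approximate MAIR is a rectangle $R\subseteq P$ with $|R|\ge(1-\varepsilon)|R_{opt}|$. Theorem. There are two programs, a preprocessing program and a solving program, and an absolute constant $C$, such that the following holds for all $n \ge 3$, every convex $n$-gon $P$ and every $0<\varepsilon<1$. (1) Preprocessing. Started on the input $(n,p_0,\dots,p_{n-1},\varepsilon)$, the preprocessing program halts after at most $C\varepsilon^{-1}n$ steps. The memory then holds, besides the input, a number $K\le C\varepsilon^{-1}$, the unit vectors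 $(\cos\theta_k,\sin\theta_k)$ of $K$ equally spaced directions $\theta_k=\theta+k\alpha$, $0\le k<K$ (with $\theta$ and $\alpha$ chosen by the program), and for each $k$ the coordinates of all $n$ vertices with respect to the axes rotated by $\theta_k$, and nothing else. (2) Solving. Started on this memory, the solving program halts after at most $C\varepsilon^{-1}\log n$ steps and outputs an $\varepsilon$-approximate MAIR of $P$ (a corner and the two side vectors at that corner); in particular, a MAIR of $P$ exists. -/

import Mathlib

/-! ## Real random access machines

Programs of a unit-cost real RAM, written as structured programs.  A state has natural-number
registers, real registers, arrays of natural numbers and arrays of reals (a program is a finite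
text, so it uses finitely many registers and arrays; every array is unbounded).  The primitive
operations are

* on natural numbers: constants, addition, truncated subtraction, halving, indirect array access;
* on reals: integer constants, `+`, `-`, `*`, `/`, square root, indirect array access;
* tests: comparison of two natural numbers or of two reals.

Each primitive operation costs one step.  There is no rounding and no conversion of reals to
natural numbers. -/

namespace RealRAM

/-- The memory of the machine. -/
structure State where
  /-- natural-number registers -/
  nreg : ℕ → ℕ
  /-- arrays of natural numbers: `narr a i` is cell `i` of array `a` -/
  narr : ℕ → ℕ → ℕ
  /-- real registers -/
  rreg : ℕ → ℝ
  /-- arrays of reals: `rarr a i` is cell `i` of array `a` -/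
  rarr : ℕ → ℕ → ℝ

/-- Natural-number expressions. -/
inductive NatExpr where
  | const (c : ℕ)
  | reg (i : ℕ)
  | load (a : ℕ) (i : NatExpr)
  | add (x y : NatExpr)
  | sub (x y : NatExpr)
  | half (x : NatExpr)

/-- Number of steps needed to evaluate an expression. -/
def NatExpr.cost : NatExpr → ℕ
  | const _ => 1
  | reg _ => 1
  | load _ i => i.cost + 1
  | add x y => x.cost + y.cost + 1
  | sub x y => x.cost + y.cost + 1
  | half x => x.cost + 1

/-- Value of an expression. -/
def NatExpr.eval (s : State) : NatExpr → ℕ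
  | const c => c
  | reg i => s.nreg i
  | load a i => s.narr a (i.eval s)
  | add x y => x.eval s + y.eval s
  | sub x y => x.eval s - y.eval s
  | half x => x.eval s / 2

/-- Real expressions. -/
inductive RealExpr where
  | const (c : ℤ)
  | reg (i : ℕ)
  | load (a : ℕ) (i : NatExpr)
  | add (x y : RealExpr)
  | sub (x y : RealExpr)
  | mul (x y : RealExpr)
  | div (x y : RealExpr)
  | sqrt (x : RealExpr)

/-- Number of steps needed to evaluate an expression. -/
def RealExpr.cost : RealExpr → ℕ
  | const _ => 1
  | reg _ => 1
  | load _ i => i.cost + 1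
  | add x y => x.cost + y.cost + 1
  | sub x y => x.cost + y.cost + 1
  | mul x y => x.cost + y.cost + 1
  | div x y => x.cost + y.cost + 1
  | sqrt x => x.cost + 1

/-- Value of an expression.  Division by zero and the square root of a negative number give `0`;
as a program can test for these cases in one step, this convention adds no power. -/
noncomputable def RealExpr.eval (s : State) : RealExpr → ℝ
  | const c => (c : ℝ)
  | reg i => s.rreg i
  | load a i => s.rarr a (i.eval s)
  | add x y => x.eval s + y.eval s
  | sub x y => x.eval s - y.eval s
  | mul x y => x.eval s * y.eval s
  | div x y => x.eval s / y.eval s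
  | sqrt x => Real.sqrt (x.eval s)

/-- Tests. -/
inductive Test where
  | natLE (x y : NatExpr)
  | realLE (x y : RealExpr)
  | not (b : Test)

/-- Number of steps needed to evaluate a test. -/
def Test.cost : Test → ℕ
  | natLE x y => x.cost + y.cost + 1
  | realLE x y => x.cost + y.cost + 1
  | not b => b.cost + 1

/-- The test succeeds. -/
def Test.Holds (s : State) : Test → Prop
  | natLE x y => x.eval s ≤ y.eval s
  | realLE x y => x.eval s ≤ y.eval s
  | not b => ¬ b.Holds s

/-- Programs. -/
inductive Prog where
  | skip
  | setNat (i : ℕ) (e : NatExpr)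
  | storeNat (a : ℕ) (i e : NatExpr)
  | setReal (i : ℕ) (e : RealExpr)
  | storeReal (a : ℕ) (i : NatExpr) (e : RealExpr)
  | seq (c₁ c₂ : Prog)
  | ite (b : Test) (c₁ c₂ : Prog)
  | loop (b : Test) (c : Prog)

/-- `Exec c s t s'`: started in state `s`, the program `c` halts after exactly `t` steps in
state `s'`.  `loop b c` is the loop "while `b` do `c`". -/
inductive Exec : Prog → State → ℕ → State → Prop where
  | skip (s : State) : Exec Prog.skip s 1 s
  | setNat (s : State) (i : ℕ) (e : NatExpr) :
      Exec (Prog.setNat i e) s (e.cost + 1)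
        { s with nreg := Function.update s.nreg i (e.eval s) }
  | storeNat (s : State) (a : ℕ) (i e : NatExpr) :
      Exec (Prog.storeNat a i e) s (i.cost + e.cost + 1)
        { s with narr := Function.update s.narr a <|
            Function.update (s.narr a) (i.eval s) (e.eval s) }
  | setReal (s : State) (i : ℕ) (e : RealExpr) :
      Exec (Prog.setReal i e) s (e.cost + 1)
        { s with rreg := Function.update s.rreg i (e.eval s) }
  | storeReal (s : State) (a : ℕ) (i : NatExpr) (e : RealExpr) :
      Exec (Prog.storeReal a i e) s (i.cost + e.cost + 1)
        { s with rarr := Function.update s.rarr a <|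
            Function.update (s.rarr a) (i.eval s) (e.eval s) }
  | seq {c₁ c₂ : Prog} {s s' s'' : State} {t₁ t₂ : ℕ} :
      Exec c₁ s t₁ s' → Exec c₂ s' t₂ s'' → Exec (Prog.seq c₁ c₂) s (t₁ + t₂) s''
  | iteTrue {b : Test} {c₁ c₂ : Prog} {s s' : State} {t : ℕ} :
      b.Holds s → Exec c₁ s t s' → Exec (Prog.ite b c₁ c₂) s (b.cost + t + 1) s'
  | iteFalse {b : Test} {c₁ c₂ : Prog} {s s' : State} {t : ℕ} :
      ¬ b.Holds s → Exec c₂ s t s' → Exec (Prog.ite b c₁ c₂) s (b.cost + t + 1) s'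
  | loopTrue {b : Test} {c : Prog} {s s' s'' : State} {t₁ t₂ : ℕ} :
      b.Holds s → Exec c s t₁ s' → Exec (Prog.loop b c) s' t₂ s'' →
        Exec (Prog.loop b c) s (b.cost + t₁ + t₂ + 1) s''
  | loopFalse {b : Test} {c : Prog} {s : State} :
      ¬ b.Holds s → Exec (Prog.loop b c) s (b.cost + 1) s

end RealRAM

/-! ## Convex polygons and inscribed rectangles -/

/-- The Euclidean plane. -/
abbrev Plane : Type := EuclideanSpace ℝ (Fin 2)

/-- The points `p 0, …, p (n - 1)` are the vertices of a (nondegenerate) convex `n`-gon, listed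
in counterclockwise order: every three of them, taken in the order of the list, make a strict left
turn. -/
def IsConvexPolygon {n : ℕ} (p : Fin n → Plane) : Prop :=
  3 ≤ n ∧ ∀ i j k : Fin n, i < j → j < k →
    0 < (p j 0 - p i 0) * (p k 1 - p i 1) - (p j 1 - p i 1) * (p k 0 - p i 0)

/-- The closed convex region spanned by the vertices. -/
def polygonRegion {n : ℕ} (p : Fin n → Plane) : Set Plane :=
  convexHull ℝ (Set.range p)

/-- A nondegenerate rectangle in the plane, in arbitrary orientation, given by a corner and the
two perpendicular side vectors that start there. -/
structure Rectangle where
  corner : Plane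
  side₁ : Plane
  side₂ : Plane
  side₁_ne_zero : side₁ ≠ 0
  side₂_ne_zero : side₂ ≠ 0
  orthogonal : inner ℝ side₁ side₂ = 0

/-- The closed region of a rectangle. -/
def Rectangle.region (R : Rectangle) : Set Plane :=
  {x | ∃ a ∈ Set.Icc (0 : ℝ) 1, ∃ b ∈ Set.Icc (0 : ℝ) 1,
    x = R.corner + a • R.side₁ + b • R.side₂}

/-- The area of a rectangle: length times width. -/
noncomputable def Rectangle.area (R : Rectangle) : ℝ := ‖R.side₁‖ * ‖R.side₂‖

/-- `R` is a maximum area inscribed rectangle (MAIR) of `S`. -/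
def IsMAIR (S : Set Plane) (R : Rectangle) : Prop :=
  R.region ⊆ S ∧ ∀ R' : Rectangle, R'.region ⊆ S → R'.area ≤ R.area

/-- `R` is an `ε`-approximation of a MAIR of `S`: it is inscribed in `S` and its area is at least
`1 - ε` times the area of a MAIR of `S` (in particular, `S` has a MAIR). -/
def IsApproxMAIR (ε : ℝ) (S : Set Plane) (R : Rectangle) : Prop :=
  R.region ⊆ S ∧ ∃ Ropt : Rectangle, IsMAIR S Ropt ∧ (1 - ε) * Ropt.area ≤ R.area

/-- The first coordinate of `x` after the axes are rotated by the angle `φ`. -/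
noncomputable def rotatedX (φ : ℝ) (x : Plane) : ℝ := x 0 * Real.cos φ + x 1 * Real.sin φ

/-- The second coordinate of `x` after the axes are rotated by the angle `φ`. -/
noncomputable def rotatedY (φ : ℝ) (x : Plane) : ℝ := x 1 * Real.cos φ - x 0 * Real.sin φ

/-! ## Input, result of the preprocessing, output -/

namespace RealRAM

/-- The contents of an array that starts with the given `m` entries, followed by zeros. -/
def arrayOf {m : ℕ} (f : Fin m → ℝ) (i : ℕ) : ℝ := if h : i < m then f ⟨i, h⟩ else 0

/-- The input: register `0` of the naturals holds `n`, real register `0` holds `ε`, and the real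
arrays `0` and `1` hold the coordinates of the vertices, in order.  Everything else is `0`. -/
def inputState {n : ℕ} (p : Fin n → Plane) (ε : ℝ) : State where
  nreg i := if i = 0 then n else 0
  narr _ _ := 0
  rreg i := if i = 0 then ε else 0
  rarr a := match a with
    | 0 => arrayOf fun i => p i 0
    | 1 => arrayOf fun i => p i 1
    | _ => fun _ => 0

/-- The memory after the preprocessing for `K` equally spaced directions, those with the angles
`θ + k * α`, `k < K`.  In addition to the input it holds `K` (register `1` of the naturals), the
coordinates of the directions (real arrays `2` and `3`), and, for every direction `k`, the new
coordinates of all vertices when the axes are rotated to it; those of vertex `i` stand in cell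
`k * n + i` of the real arrays `4` and `5`.  Everything else is `0`: no other result of the
preprocessing is kept. -/
noncomputable def preparedState {n : ℕ} (p : Fin n → Plane) (ε : ℝ) (K : ℕ) (θ α : ℝ) : State where
  nreg i := if i = 0 then n else if i = 1 then K else 0
  narr _ _ := 0
  rreg i := if i = 0 then ε else 0
  rarr a := match a with
    | 0 => arrayOf fun i => p i 0
    | 1 => arrayOf fun i => p i 1
    | 2 => arrayOf fun k : Fin K => Real.cos (θ + k * α)
    | 3 => arrayOf fun k : Fin K => Real.sin (θ + k * α)
    | 4 => arrayOf fun j : Fin (K * n) => rotatedX (θ + j.divNat * α) (p j.modNat)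
    | 5 => arrayOf fun j : Fin (K * n) => rotatedY (θ + j.divNat * α) (p j.modNat)
    | _ => fun _ => 0

/-- The real registers `0, …, 5` hold the corner and the two side vectors of `R`. -/
def State.Outputs (s : State) (R : Rectangle) : Prop :=
  s.rreg 0 = R.corner 0 ∧ s.rreg 1 = R.corner 1 ∧
  s.rreg 2 = R.side₁ 0 ∧ s.rreg 3 = R.side₁ 1 ∧
  s.rreg 4 = R.side₂ 0 ∧ s.rreg 5 = R.side₂ 1

end RealRAM

/-!
The directions of the preprocessing are a uniform net of a short range of angles, and the solving
program finds a good rectangle by descending the binary tree over this net, with a constant number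
of evaluations of area at each node.

*Directions.*  Let `D` be the largest distance of a vertex from the first one, `θ₀` the direction
to a vertex at this distance, and `w` the extent of the polygon orthogonal to it (`Measured`).  The
polygon contains a rectangle of area `D * w / 16` (`exists_hasArea_of_triangle`), and a rectangle
of at least this area can be seen at an angle to `θ₀` of at most `200 * (w / D)`
(`angle_le_of_hasArea`).  So the angle `ψ₀` of a largest rectangle lies in a range of length
`O(w / D)`, and `K = O(1 / ε)` equally spaced directions, with `sin α = 400 * w / (D * K)`, cover
this range (`arcsin_range`).

*Concavity.*  Write `m` for the square root of the largest area.  For a fixed direction `ψ`, the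
square root of the largest area of a rectangle between the heights `y₁` and `y₂` is a concave
function of `(y₁, y₂)`.  Its superlevel sets are `Lev S o ψ c`.  A rotation by an angle `τ` turns a
point of such a set into a point of a slightly lower level set, after a translation by `O(D * τ)`
(`Lev.rotate`).  If `D * τ` is a small multiple of `δ * w`, the loss of level is only the factor
`1 - δ`; this is linear in `τ`, and it is why `O(1 / ε)` directions suffice.

*Descent.*  A node at depth `i` of the tree stands for a block of `K / 2 ^ i` consecutive
directions.  It has the tolerance `γ = 2 ^ 24 / 2 ^ i`, and keeps a parallelogram that, if the
block contains `ψ₀`, is fat for the level set of `(1 - γ) * m` in the first direction of the block: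
it contains the level set, and a copy of it, scaled by a constant, lies in the level set
(`SBox.Fat`).  For a child with tolerance `γ / 2`, the translated parallelogram of its parent still
contains the level set, and still has a core of constant relative size, even in a higher level set
(`Extremal.transfer`).  Hence a sufficiently fine grid of constant size meets these sets.  The grid
points whose value is at least `1 - γ / 2` times the largest value on the grid determine a new fat
parallelogram, sheared in the direction from the leftmost to the rightmost of these points
(`Sampling.fat`); so the constants do not deteriorate with the depth.  The best point of the grid
gives a rectangle of area at least `(1 - γ / 8) ^ 2 * m ^ 2` (`Sampling.M_ge`).  At the leaf whose
block contains `ψ₀` the tolerance is at most `ε` (`Directions.child`, `solve_runs`).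

*Running time.*  An evaluation intersects the polygon with two horizontal lines.  Highest and
lowest vertices, and the edges that cross a given height, are found by binary search on the rotated
coordinates.  For the binary search in `search_runs` no monotonicity is needed: it finds some
change of a predicate along the cyclic sequence of vertices, and by convexity every such change is
the wanted one (`le_of_local_max`, `isChord_of_edges`).  The tree has `2 * K - 1` nodes, so that
the total time is `O(K * log n)`.

The programs are written down explicitly.  `Runs` is a total-correctness judgement with a time
bound, `Prog.den` computes the effect of programs without loops, and `Frame` says which parts of
the memory a program leaves alone.
-/

namespace RealRAM

/-! ### Reasoning about programs -/

/-- Started in `s`, the program `c` halts within `B` steps in a state that satisfies `Q`. -/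
def Runs (c : Prog) (s : State) (B : ℕ) (Q : State → Prop) : Prop :=
  ∃ t s', Exec c s t s' ∧ t ≤ B ∧ Q s'

theorem Runs.mono {c : Prog} {s : State} {B B' : ℕ} {Q Q' : State → Prop}
    (h : Runs c s B Q) (hB : B ≤ B') (hQ : ∀ s', Q s' → Q' s') : Runs c s B' Q' := by
  obtain ⟨t, s', he, ht, hq⟩ := h
  exact ⟨t, s', he, ht.trans hB, hQ _ hq⟩

theorem Runs.seq {c d : Prog} {s : State} {B B' : ℕ} {Q Q' : State → Prop}
    (h : Runs c s B Q) (h' : ∀ s', Q s' → Runs d s' B' Q') : Runs (.seq c d) s (B + B') Q' := by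
  obtain ⟨t, s', he, ht, hq⟩ := h
  obtain ⟨t', s'', he', ht', hq'⟩ := h' s' hq
  exact ⟨_, s'', .seq he he', by omega, hq'⟩

theorem Runs.ite {b : Test} {c d : Prog} {s : State} {B : ℕ} {Q : State → Prop}
    (h : b.Holds s → Runs c s B Q) (h' : ¬ b.Holds s → Runs d s B Q) :
    Runs (.ite b c d) s (b.cost + B + 1) Q := by
  by_cases hb : b.Holds s
  · obtain ⟨t, s', he, ht, hq⟩ := h hb
    exact ⟨_, s', .iteTrue hb he, by omega, hq⟩
  · obtain ⟨t, s', he, ht, hq⟩ := h' hb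
    exact ⟨_, s', .iteFalse hb he, by omega, hq⟩

/-- A loop with invariant `I` and variant `μ`. -/
theorem Runs.loop {b : Test} {c : Prog} {B : ℕ} (I : State → Prop) (μ : State → ℕ)
    (hstep : ∀ s, I s → b.Holds s → Runs c s B (fun s' => I s' ∧ μ s' < μ s))
    {s : State} (hs : I s) :
    Runs (.loop b c) s (μ s * (b.cost + B + 1) + (b.cost + 1)) (fun s' => I s' ∧ ¬ b.Holds s') := by
  induction hm : μ s using Nat.strong_induction_on generalizing s with
  | _ m ih =>
    by_cases hb : b.Holds s
    · obtain ⟨t, s', he, ht, hI, hμ⟩ := hstep s hs hb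
      obtain ⟨t', s'', he', ht', hq'⟩ := ih (μ s') (hm ▸ hμ) hI rfl
      refine ⟨_, s'', .loopTrue hb he he', ?_, hq'⟩
      obtain ⟨r, hr⟩ : ∃ r, m = μ s' + 1 + r := ⟨m - μ s' - 1, by omega⟩
      rw [hr]
      have : (μ s' + 1 + r) * (b.cost + B + 1)
        = μ s' * (b.cost + B + 1) + (b.cost + B + 1) + r * (b.cost + B + 1) := by ring
      omega
    · exact ⟨_, s, .loopFalse hb, by omega, hs, hb⟩

/-- A loop with exactly `m` passes; `I j` holds after `j` of them. -/
theorem Runs.forLoop {b : Test} {c : Prog} {B : ℕ} (I : ℕ → State → Prop) (m : ℕ)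
    (hb : ∀ j s, j ≤ m → I j s → (b.Holds s ↔ j < m))
    (hstep : ∀ j s, j < m → I j s → Runs c s B (I (j + 1)))
    {s : State} (hs : I 0 s) :
    Runs (.loop b c) s (m * (b.cost + B + 1) + (b.cost + 1)) (I m) := by
  suffices H : ∀ r j s, j + r = m → I j s →
      Runs (.loop b c) s (r * (b.cost + B + 1) + (b.cost + 1)) (I m) by
    exact H m 0 s (by omega) hs
  intro r
  induction r with
  | zero =>
    intro j s hj hI
    obtain rfl : j = m := by omega
    exact ⟨_, s, .loopFalse (by rw [hb j s le_rfl hI]; omega), by omega, hI⟩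
  | succ r ih =>
    intro j s hj hI
    obtain ⟨t, s', he, ht, hq⟩ := hstep j s (by omega) hI
    obtain ⟨t', s'', he', ht', hq'⟩ := ih (j + 1) s' (by omega) hq
    refine ⟨_, s'', .loopTrue ((hb j s (by omega) hI).2 (by omega)) he he', ?_, hq'⟩
    have : (r + 1) * (b.cost + B + 1) = r * (b.cost + B + 1) + (b.cost + B + 1) := by ring
    omega

/-! ### Straight-line programs -/

/-- Programs without loops. -/
def Prog.straight : Prog → Bool
  | skip => true
  | setNat _ _ => true
  | storeNat _ _ _ => true
  | setReal _ _ => true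
  | storeReal _ _ _ => true
  | seq c d => c.straight && d.straight
  | ite _ c d => c.straight && d.straight
  | loop _ _ => false

/-- An upper bound for the running time of a program without loops.  A loop stands for a binary
search; its value is an upper bound for the running time of a pass, in which the term `30` accounts
for the control of the loop. -/
def Prog.bound : Prog → ℕ
  | skip => 1
  | setNat _ e => e.cost + 1
  | storeNat _ i e => i.cost + e.cost + 1
  | setReal _ e => e.cost + 1
  | storeReal _ i e => i.cost + e.cost + 1
  | seq c d => c.bound + d.bound
  | ite b c d => b.cost + (c.bound + d.bound) + 1
  | loop _ c => c.bound + 30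

open Classical in
/-- The state transformation of a program without loops.  The value at a loop is irrelevant. -/
noncomputable def Prog.den : Prog → State → State
  | skip, s => s
  | setNat i e, s => { s with nreg := Function.update s.nreg i (e.eval s) }
  | storeNat a i e, s => { s with
      narr := Function.update s.narr a (Function.update (s.narr a) (i.eval s) (e.eval s)) }
  | setReal i e, s => { s with rreg := Function.update s.rreg i (e.eval s) }
  | storeReal a i e, s => { s with
      rarr := Function.update s.rarr a (Function.update (s.rarr a) (i.eval s) (e.eval s)) }
  | seq c d, s => d.den (c.den s)
  | ite b c d, s => if b.Holds s then c.den s else d.den s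
  | loop _ _, s => s

theorem Runs.of_straight {c : Prog} (hc : c.straight = true) {s : State} {Q : State → Prop}
    (hQ : Q (c.den s)) : Runs c s c.bound Q := by
  suffices H : Runs c s c.bound (fun s' => s' = c.den s) from
    H.mono le_rfl (fun s' h => h ▸ hQ)
  clear hQ
  induction c generalizing s with
  | skip => exact ⟨_, _, .skip s, le_rfl, rfl⟩
  | setNat i e => exact ⟨_, _, .setNat s i e, le_rfl, rfl⟩
  | storeNat a i e => exact ⟨_, _, .storeNat s a i e, le_rfl, rfl⟩
  | setReal i e => exact ⟨_, _, .setReal s i e, le_rfl, rfl⟩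
  | storeReal a i e => exact ⟨_, _, .storeReal s a i e, le_rfl, rfl⟩
  | seq c d ihc ihd =>
    simp only [Prog.straight, Bool.and_eq_true] at hc
    refine (ihc hc.1).seq fun s' hs' => ?_
    subst hs'
    exact ihd hc.2
  | ite b c d ihc ihd =>
    simp only [Prog.straight, Bool.and_eq_true] at hc
    refine (Runs.ite (B := c.bound + d.bound) ?_ ?_)
    · intro hb
      refine (ihc hc.1).mono (by omega) fun s' h => ?_
      simp only [Prog.den, if_pos hb, h]
    · intro hb
      refine (ihd hc.2).mono (by omega) fun s' h => ?_
      simp only [Prog.den, if_neg hb, h]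
  | loop b c => simp [Prog.straight] at hc

/-! ### Frames -/

/-- The program contains an assignment to the natural register `j`. -/
def Prog.wNat (j : ℕ) : Prog → Bool
  | setNat i _ => i == j
  | seq c d => c.wNat j || d.wNat j
  | ite _ c d => c.wNat j || d.wNat j
  | loop _ c => c.wNat j
  | _ => false

/-- The program contains an assignment to a cell of the natural array `j`. -/
def Prog.wNatArr (j : ℕ) : Prog → Bool
  | storeNat i _ _ => i == j
  | seq c d => c.wNatArr j || d.wNatArr j
  | ite _ c d => c.wNatArr j || d.wNatArr j
  | loop _ c => c.wNatArr j
  | _ => false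

/-- The program contains an assignment to the real register `j`. -/
def Prog.wReal (j : ℕ) : Prog → Bool
  | setReal i _ => i == j
  | seq c d => c.wReal j || d.wReal j
  | ite _ c d => c.wReal j || d.wReal j
  | loop _ c => c.wReal j
  | _ => false

/-- The program contains an assignment to a cell of the real array `j`. -/
def Prog.wRealArr (j : ℕ) : Prog → Bool
  | storeReal i _ _ => i == j
  | seq c d => c.wRealArr j || d.wRealArr j
  | ite _ c d => c.wRealArr j || d.wRealArr j
  | loop _ c => c.wRealArr j
  | _ => false

/-- `s` and `s'` agree on everything that the program `c` cannot write. -/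
structure Frame (c : Prog) (s s' : State) : Prop where
  nreg' : ∀ j, c.wNat j = false → s'.nreg j = s.nreg j
  narr' : ∀ j, c.wNatArr j = false → s'.narr j = s.narr j
  rreg' : ∀ j, c.wReal j = false → s'.rreg j = s.rreg j
  rarr' : ∀ j, c.wRealArr j = false → s'.rarr j = s.rarr j

theorem Frame.nreg {c : Prog} {s s' : State} (h : Frame c s s') (j : ℕ)
    (hj : c.wNat j = false := by rfl) : s'.nreg j = s.nreg j := h.nreg' j hj

theorem Frame.narr {c : Prog} {s s' : State} (h : Frame c s s') (j : ℕ)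
    (hj : c.wNatArr j = false := by rfl) : s'.narr j = s.narr j := h.narr' j hj

theorem Frame.rreg {c : Prog} {s s' : State} (h : Frame c s s') (j : ℕ)
    (hj : c.wReal j = false := by rfl) : s'.rreg j = s.rreg j := h.rreg' j hj

theorem Frame.rarr {c : Prog} {s s' : State} (h : Frame c s s') (j : ℕ)
    (hj : c.wRealArr j = false := by rfl) : s'.rarr j = s.rarr j := h.rarr' j hj

theorem Exec.frame {c : Prog} {s s' : State} {t : ℕ} (h : Exec c s t s') : Frame c s s' := by
  induction h with
  | skip s => exact ⟨fun _ _ => rfl, fun _ _ => rfl, fun _ _ => rfl, fun _ _ => rfl⟩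
  | setNat s i e =>
    refine ⟨fun j hj => ?_, fun _ _ => rfl, fun _ _ => rfl, fun _ _ => rfl⟩
    simp only [Prog.wNat, beq_eq_false_iff_ne, ne_eq] at hj
    exact Function.update_of_ne (Ne.symm hj) _ _
  | storeNat s a i e =>
    refine ⟨fun _ _ => rfl, fun j hj => ?_, fun _ _ => rfl, fun _ _ => rfl⟩
    simp only [Prog.wNatArr, beq_eq_false_iff_ne, ne_eq] at hj
    exact Function.update_of_ne (Ne.symm hj) _ _
  | setReal s i e =>
    refine ⟨fun _ _ => rfl, fun _ _ => rfl, fun j hj => ?_, fun _ _ => rfl⟩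
    simp only [Prog.wReal, beq_eq_false_iff_ne, ne_eq] at hj
    exact Function.update_of_ne (Ne.symm hj) _ _
  | storeReal s a i e =>
    refine ⟨fun _ _ => rfl, fun _ _ => rfl, fun _ _ => rfl, fun j hj => ?_⟩
    simp only [Prog.wRealArr, beq_eq_false_iff_ne, ne_eq] at hj
    exact Function.update_of_ne (Ne.symm hj) _ _
  | seq _ _ ih ih' =>
    constructor <;> intro j hj <;>
      simp only [Prog.wNat, Prog.wNatArr, Prog.wReal, Prog.wRealArr, Bool.or_eq_false_iff] at hj
    · rw [ih'.nreg' j hj.2, ih.nreg' j hj.1]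
    · rw [ih'.narr' j hj.2, ih.narr' j hj.1]
    · rw [ih'.rreg' j hj.2, ih.rreg' j hj.1]
    · rw [ih'.rarr' j hj.2, ih.rarr' j hj.1]
  | iteTrue _ _ ih =>
    constructor <;> intro j hj <;>
      simp only [Prog.wNat, Prog.wNatArr, Prog.wReal, Prog.wRealArr, Bool.or_eq_false_iff] at hj
    · exact ih.nreg' j hj.1
    · exact ih.narr' j hj.1
    · exact ih.rreg' j hj.1
    · exact ih.rarr' j hj.1
  | iteFalse _ _ ih =>
    constructor <;> intro j hj <;>
      simp only [Prog.wNat, Prog.wNatArr, Prog.wReal, Prog.wRealArr, Bool.or_eq_false_iff] at hj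
    · exact ih.nreg' j hj.2
    · exact ih.narr' j hj.2
    · exact ih.rreg' j hj.2
    · exact ih.rarr' j hj.2
  | loopTrue _ _ _ ih ih' =>
    constructor <;> intro j hj
    · rw [ih'.nreg' j hj, ih.nreg' j hj]
    · rw [ih'.narr' j hj, ih.narr' j hj]
    · rw [ih'.rreg' j hj, ih.rreg' j hj]
    · rw [ih'.rarr' j hj, ih.rarr' j hj]
  | loopFalse _ => exact ⟨fun _ _ => rfl, fun _ _ => rfl, fun _ _ => rfl, fun _ _ => rfl⟩

theorem Runs.frame {c : Prog} {s : State} {B : ℕ} {Q : State → Prop} (h : Runs c s B Q) :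
    Runs c s B (fun s' => Q s' ∧ Frame c s s') := by
  obtain ⟨t, s', he, ht, hq⟩ := h
  exact ⟨t, s', he, ht, hq, he.frame⟩

/-- Running a program without loops, with the frame condition. -/
theorem Runs.straight_frame {c : Prog} (s : State) (hc : c.straight = true := by rfl) :
    Runs c s c.bound (fun s' => s' = c.den s ∧ Frame c s s') :=
  (Runs.of_straight (Q := fun s' => s' = c.den s) hc rfl).frame

/-! ### Notation for programs -/

/-- Sequential composition. -/
infixr:60 " ;; " => Prog.seq

instance : Add NatExpr := ⟨NatExpr.add⟩
instance : Sub NatExpr := ⟨NatExpr.sub⟩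
instance : Add RealExpr := ⟨RealExpr.add⟩
instance : Sub RealExpr := ⟨RealExpr.sub⟩
instance : Mul RealExpr := ⟨RealExpr.mul⟩
instance : Div RealExpr := ⟨RealExpr.div⟩

@[simp] theorem NatExpr.eval_add' (s : State) (x y : NatExpr) :
    (x + y).eval s = x.eval s + y.eval s := rfl
@[simp] theorem NatExpr.eval_sub' (s : State) (x y : NatExpr) :
    (x - y).eval s = x.eval s - y.eval s := rfl
@[simp] theorem RealExpr.eval_add' (s : State) (x y : RealExpr) :
    (x + y).eval s = x.eval s + y.eval s := rfl
@[simp] theorem RealExpr.eval_sub' (s : State) (x y : RealExpr) :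
    (x - y).eval s = x.eval s - y.eval s := rfl
@[simp] theorem RealExpr.eval_mul' (s : State) (x y : RealExpr) :
    (x * y).eval s = x.eval s * y.eval s := rfl
@[simp] theorem RealExpr.eval_div' (s : State) (x y : RealExpr) :
    (x / y).eval s = x.eval s / y.eval s := rfl

attribute [simp] NatExpr.eval RealExpr.eval Test.Holds Prog.den

/-- The content of a natural register. -/
abbrev nr (i : ℕ) : NatExpr := .reg i
/-- A natural constant. -/
abbrev nc (c : ℕ) : NatExpr := .const c
/-- The content of a real register. -/
abbrev rr (i : ℕ) : RealExpr := .reg i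
/-- An integer constant, as a real number. -/
abbrev rc (c : ℤ) : RealExpr := .const c

end RealRAM

/-! ### Rectangles in rotated frames -/

/-- The first coordinate of `q` in the frame with origin `o`, rotated by the angle `ψ`. -/
noncomputable def relX (o : Plane) (ψ : ℝ) (q : Plane) : ℝ :=
  (q 0 - o 0) * Real.cos ψ + (q 1 - o 1) * Real.sin ψ

/-- The second coordinate of `q` in the frame with origin `o`, rotated by the angle `ψ`. -/
noncomputable def relY (o : Plane) (ψ : ℝ) (q : Plane) : ℝ :=
  (q 1 - o 1) * Real.cos ψ - (q 0 - o 0) * Real.sin ψ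

/-- The point with coordinates `(x, y)` in the frame with origin `o`, rotated by the angle `ψ`. -/
noncomputable def framePt (o : Plane) (ψ x y : ℝ) : Plane :=
  !₂[o 0 + x * Real.cos ψ - y * Real.sin ψ, o 1 + x * Real.sin ψ + y * Real.cos ψ]

@[simp] theorem framePt_zero (o : Plane) (ψ x y : ℝ) :
    framePt o ψ x y 0 = o 0 + x * Real.cos ψ - y * Real.sin ψ := rfl

@[simp] theorem framePt_one (o : Plane) (ψ x y : ℝ) :
    framePt o ψ x y 1 = o 1 + x * Real.sin ψ + y * Real.cos ψ := rfl

theorem Plane.ext {p q : Plane} (h0 : p 0 = q 0) (h1 : p 1 = q 1) : p = q := by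
  ext i
  fin_cases i
  · exact h0
  · exact h1

theorem framePt_rel (o : Plane) (ψ : ℝ) (q : Plane) :
    framePt o ψ (relX o ψ q) (relY o ψ q) = q := by
  have h := Real.sin_sq_add_cos_sq ψ
  apply Plane.ext
  · simp only [framePt_zero, relX, relY]
    linear_combination (q 0 - o 0) * h
  · simp only [framePt_one, relX, relY]
    linear_combination (q 1 - o 1) * h

@[simp] theorem relX_framePt (o : Plane) (ψ x y : ℝ) : relX o ψ (framePt o ψ x y) = x := by
  have h := Real.sin_sq_add_cos_sq ψ
  simp only [framePt_zero, framePt_one, relX]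
  linear_combination x * h

@[simp] theorem relY_framePt (o : Plane) (ψ x y : ℝ) : relY o ψ (framePt o ψ x y) = y := by
  have h := Real.sin_sq_add_cos_sq ψ
  simp only [framePt_zero, framePt_one, relY]
  linear_combination y * h

theorem framePt_add_angle (o : Plane) (ψ τ x y : ℝ) :
    framePt o (ψ + τ) x y =
      framePt o ψ (x * Real.cos τ - y * Real.sin τ) (x * Real.sin τ + y * Real.cos τ) := by
  apply Plane.ext
  · simp only [framePt_zero, Real.cos_add, Real.sin_add]; ring
  · simp only [framePt_one, Real.cos_add, Real.sin_add]; ring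

theorem framePt_combo (o : Plane) (ψ : ℝ) {a b : ℝ} (hab : a + b = 1) (x y x' y' : ℝ) :
    framePt o ψ (a * x + b * x') (a * y + b * y') =
      a • framePt o ψ x y + b • framePt o ψ x' y' := by
  apply Plane.ext
  · simp only [framePt_zero, PiLp.add_apply, PiLp.smul_apply, smul_eq_mul]
    linear_combination -(o 0) * hab
  · simp only [framePt_one, PiLp.add_apply, PiLp.smul_apply, smul_eq_mul]
    linear_combination -(o 1) * hab

theorem framePt_sq (o : Plane) (ψ x y : ℝ) :
    (framePt o ψ x y 0 - o 0) ^ 2 + (framePt o ψ x y 1 - o 1) ^ 2 = x ^ 2 + y ^ 2 := by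
  have h := Real.sin_sq_add_cos_sq ψ
  simp only [framePt_zero, framePt_one]
  linear_combination (x ^ 2 + y ^ 2) * h

/-- The rectangle `[x₁, x₂] × [y₁, y₂]` of the frame with origin `o` and angle `ψ` has its corners
in `S`; degenerate rectangles are allowed. -/
structure Fits (S : Set Plane) (o : Plane) (ψ x₁ x₂ y₁ y₂ : ℝ) : Prop where
  hx : x₁ ≤ x₂
  hy : y₁ ≤ y₂
  h11 : framePt o ψ x₁ y₁ ∈ S
  h12 : framePt o ψ x₁ y₂ ∈ S
  h21 : framePt o ψ x₂ y₁ ∈ S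
  h22 : framePt o ψ x₂ y₂ ∈ S

theorem exists_combo {x x₁ x₂ : ℝ} (h₁ : x₁ ≤ x) (h₂ : x ≤ x₂) :
    ∃ a b : ℝ, 0 ≤ a ∧ 0 ≤ b ∧ a + b = 1 ∧ x = a * x₁ + b * x₂ := by
  have : x ∈ segment ℝ x₁ x₂ := by
    rw [segment_eq_Icc (h₁.trans h₂)]; exact ⟨h₁, h₂⟩
  obtain ⟨a, b, ha, hb, hab, h⟩ := this
  exact ⟨a, b, ha, hb, hab, by simpa using h.symm⟩

theorem framePt_mem_of_between_x {S : Set Plane} (hS : Convex ℝ S) {o : Plane}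
    {ψ x₁ x₂ x y : ℝ} (h₁ : framePt o ψ x₁ y ∈ S) (h₂ : framePt o ψ x₂ y ∈ S)
    (hx₁ : x₁ ≤ x) (hx₂ : x ≤ x₂) : framePt o ψ x y ∈ S := by
  obtain ⟨a, b, ha, hb, hab, rfl⟩ := exists_combo hx₁ hx₂
  have := framePt_combo o ψ hab x₁ y x₂ y
  rw [← add_mul, hab, one_mul] at this
  rw [this]
  exact hS h₁ h₂ ha hb hab

theorem framePt_mem_of_between_y {S : Set Plane} (hS : Convex ℝ S) {o : Plane}
    {ψ y₁ y₂ x y : ℝ} (h₁ : framePt o ψ x y₁ ∈ S) (h₂ : framePt o ψ x y₂ ∈ S)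
    (hy₁ : y₁ ≤ y) (hy₂ : y ≤ y₂) : framePt o ψ x y ∈ S := by
  obtain ⟨a, b, ha, hb, hab, rfl⟩ := exists_combo hy₁ hy₂
  have := framePt_combo o ψ hab x y₁ x y₂
  rw [← add_mul, hab, one_mul] at this
  rw [this]
  exact hS h₁ h₂ ha hb hab

theorem Fits.mem {S : Set Plane} (hS : Convex ℝ S) {o : Plane} {ψ x₁ x₂ y₁ y₂ x y : ℝ}
    (h : Fits S o ψ x₁ x₂ y₁ y₂) (hx₁ : x₁ ≤ x) (hx₂ : x ≤ x₂) (hy₁ : y₁ ≤ y) (hy₂ : y ≤ y₂) :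
    framePt o ψ x y ∈ S :=
  framePt_mem_of_between_x hS (framePt_mem_of_between_y hS h.h11 h.h12 hy₁ hy₂)
    (framePt_mem_of_between_y hS h.h21 h.h22 hy₁ hy₂) hx₁ hx₂

theorem Plane.inner_eq (p q : Plane) : inner ℝ p q = p 0 * q 0 + p 1 * q 1 := by
  rw [PiLp.inner_apply, Fin.sum_univ_two]
  simp [mul_comm]

theorem Plane.norm_eq (p : Plane) : ‖p‖ = √(p 0 ^ 2 + p 1 ^ 2) := by
  rw [EuclideanSpace.norm_eq, Fin.sum_univ_two]
  simp

/-- The rectangle `[x₁, x₂] × [y₁, y₂]` of a rotated frame. -/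
noncomputable def rectOf (o : Plane) (ψ x₁ x₂ y₁ y₂ : ℝ) (hx : x₁ < x₂) (hy : y₁ < y₂) :
    Rectangle where
  corner := framePt o ψ x₁ y₁
  side₁ := !₂[(x₂ - x₁) * Real.cos ψ, (x₂ - x₁) * Real.sin ψ]
  side₂ := !₂[-((y₂ - y₁) * Real.sin ψ), (y₂ - y₁) * Real.cos ψ]
  side₁_ne_zero := by
    intro h
    have h0 : (x₂ - x₁) * Real.cos ψ = 0 := congrArg (fun v : Plane => v 0) h
    have h1 : (x₂ - x₁) * Real.sin ψ = 0 := congrArg (fun v : Plane => v 1) h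
    have := Real.sin_sq_add_cos_sq ψ
    have h2 : (x₂ - x₁) ^ 2 = 0 := by
      linear_combination (x₂ - x₁) * Real.cos ψ * h0 + (x₂ - x₁) * Real.sin ψ * h1
        - (x₂ - x₁) ^ 2 * this
    nlinarith [pow_eq_zero_iff (two_ne_zero) |>.1 h2]
  side₂_ne_zero := by
    intro h
    have h0 : -((y₂ - y₁) * Real.sin ψ) = 0 := congrArg (fun v : Plane => v 0) h
    have h1 : (y₂ - y₁) * Real.cos ψ = 0 := congrArg (fun v : Plane => v 1) h
    have := Real.sin_sq_add_cos_sq ψ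
    have h2 : (y₂ - y₁) ^ 2 = 0 := by
      linear_combination -(y₂ - y₁) * Real.sin ψ * h0 + (y₂ - y₁) * Real.cos ψ * h1
        - (y₂ - y₁) ^ 2 * this
    nlinarith [pow_eq_zero_iff (two_ne_zero) |>.1 h2]
  orthogonal := by
    rw [Plane.inner_eq]
    simp
    ring

theorem rectOf_area (o : Plane) (ψ x₁ x₂ y₁ y₂ : ℝ) (hx : x₁ < x₂) (hy : y₁ < y₂) :
    (rectOf o ψ x₁ x₂ y₁ y₂ hx hy).area = (x₂ - x₁) * (y₂ - y₁) := by
  have h := Real.sin_sq_add_cos_sq ψ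
  rw [Rectangle.area, Plane.norm_eq, Plane.norm_eq]
  congr 1
  · rw [show (rectOf o ψ x₁ x₂ y₁ y₂ hx hy).side₁ 0 = (x₂ - x₁) * Real.cos ψ from rfl,
      show (rectOf o ψ x₁ x₂ y₁ y₂ hx hy).side₁ 1 = (x₂ - x₁) * Real.sin ψ from rfl,
      Real.sqrt_eq_iff_eq_sq (by positivity) (by linarith)]
    linear_combination (x₂ - x₁) ^ 2 * h
  · rw [show (rectOf o ψ x₁ x₂ y₁ y₂ hx hy).side₂ 0 = -((y₂ - y₁) * Real.sin ψ) from rfl,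
      show (rectOf o ψ x₁ x₂ y₁ y₂ hx hy).side₂ 1 = (y₂ - y₁) * Real.cos ψ from rfl,
      Real.sqrt_eq_iff_eq_sq (by positivity) (by linarith)]
    linear_combination (y₂ - y₁) ^ 2 * h

theorem Fits.region_subset {S : Set Plane} (hS : Convex ℝ S) {o : Plane} {ψ x₁ x₂ y₁ y₂ : ℝ}
    (h : Fits S o ψ x₁ x₂ y₁ y₂) (hx : x₁ < x₂) (hy : y₁ < y₂) :
    (rectOf o ψ x₁ x₂ y₁ y₂ hx hy).region ⊆ S := by
  rintro _ ⟨a, ⟨ha0, ha1⟩, b, ⟨hb0, hb1⟩, rfl⟩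
  have key : (rectOf o ψ x₁ x₂ y₁ y₂ hx hy).corner + a • (rectOf o ψ x₁ x₂ y₁ y₂ hx hy).side₁
      + b • (rectOf o ψ x₁ x₂ y₁ y₂ hx hy).side₂
      = framePt o ψ (x₁ + a * (x₂ - x₁)) (y₁ + b * (y₂ - y₁)) := by
    apply Plane.ext
    · simp [rectOf]; ring
    · simp [rectOf]; ring
  rw [key]
  refine h.mem hS ?_ ?_ ?_ ?_ <;> nlinarith

theorem exists_angle {u v r : ℝ} (hr : 0 ≤ r) (h : u ^ 2 + v ^ 2 = r ^ 2) :
    ∃ ψ : ℝ, r * Real.cos ψ = u ∧ r * Real.sin ψ = v := by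
  have hn : ‖(⟨u, v⟩ : ℂ)‖ = r := by
    rw [Complex.norm_eq_sqrt_sq_add_sq, Real.sqrt_eq_iff_eq_sq (by positivity) hr]
    exact h
  refine ⟨Complex.arg ⟨u, v⟩, ?_, ?_⟩
  · rw [← hn, Complex.norm_mul_cos_arg]
  · rw [← hn, Complex.norm_mul_sin_arg]

theorem Rectangle.exists_fits (R : Rectangle) (o : Plane) :
    ∃ ψ x₁ x₂ y₁ y₂ : ℝ, Fits R.region o ψ x₁ x₂ y₁ y₂ ∧ (x₂ - x₁) * (y₂ - y₁) = R.area := by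
  have ha : 0 < ‖R.side₁‖ := norm_pos_iff.2 R.side₁_ne_zero
  have hb : 0 < ‖R.side₂‖ := norm_pos_iff.2 R.side₂_ne_zero
  have ha2 : R.side₁ 0 ^ 2 + R.side₁ 1 ^ 2 = ‖R.side₁‖ ^ 2 := by
    rw [Plane.norm_eq, Real.sq_sqrt (by positivity)]
  have hb2 : R.side₂ 0 ^ 2 + R.side₂ 1 ^ 2 = ‖R.side₂‖ ^ 2 := by
    rw [Plane.norm_eq, Real.sq_sqrt (by positivity)]
  obtain ⟨ψ, hc, hs⟩ := exists_angle ha.le ha2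
  have horth := R.orthogonal
  rw [Plane.inner_eq] at horth
  have h1 := Real.sin_sq_add_cos_sq ψ
  have horth' : Real.cos ψ * R.side₂ 0 + Real.sin ψ * R.side₂ 1 = 0 := by
    apply mul_left_cancel₀ ha.ne'
    rw [mul_zero, ← horth, ← hc, ← hs]; ring
  -- the signed length of the second side in the direction orthogonal to the first one
  set b := R.side₂ 1 * Real.cos ψ - R.side₂ 0 * Real.sin ψ with hbdef
  have hb0 : R.side₂ 0 = -(b * Real.sin ψ) := by
    rw [hbdef]; linear_combination Real.cos ψ * horth' - R.side₂ 0 * h1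
  have hb1 : R.side₂ 1 = b * Real.cos ψ := by
    rw [hbdef]; linear_combination Real.sin ψ * horth' - R.side₂ 1 * h1
  have hbsq : b ^ 2 = ‖R.side₂‖ ^ 2 := by
    rw [← hb2, hb0, hb1]; linear_combination -b ^ 2 * h1
  have hmem : ∀ s ∈ Set.Icc (0 : ℝ) 1, ∀ t ∈ Set.Icc (0 : ℝ) 1,
      framePt o ψ (relX o ψ R.corner + s * ‖R.side₁‖) (relY o ψ R.corner + t * b) ∈ R.region := by
    intro s hs' t ht'
    refine ⟨s, hs', t, ht', ?_⟩
    have e := framePt_rel o ψ R.corner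
    have e0 := congrArg (fun v : Plane => v 0) e
    have e1 := congrArg (fun v : Plane => v 1) e
    simp only [framePt_zero, framePt_one] at e0 e1
    apply Plane.ext
    · simp only [framePt_zero, PiLp.add_apply, PiLp.smul_apply, smul_eq_mul]
      rw [hb0, ← hc]; linear_combination e0
    · simp only [framePt_one, PiLp.add_apply, PiLp.smul_apply, smul_eq_mul]
      rw [hb1, ← hs]; linear_combination e1
  have z : (0 : ℝ) ∈ Set.Icc (0 : ℝ) 1 := ⟨le_rfl, zero_le_one⟩
  have one : (1 : ℝ) ∈ Set.Icc (0 : ℝ) 1 := ⟨zero_le_one, le_rfl⟩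
  rcases le_or_gt 0 b with h0 | h0
  · have hbn : b = ‖R.side₂‖ := by
      rwa [sq_eq_sq₀ h0 hb.le] at hbsq
    refine ⟨ψ, relX o ψ R.corner, relX o ψ R.corner + ‖R.side₁‖, relY o ψ R.corner,
      relY o ψ R.corner + b, ⟨by linarith, by linarith, ?_, ?_, ?_, ?_⟩, ?_⟩
    · simpa using hmem 0 z 0 z
    · simpa using hmem 0 z 1 one
    · simpa using hmem 1 one 0 z
    · simpa using hmem 1 one 1 one
    · rw [Rectangle.area, ← hbn]; ring
  · have hbn : -b = ‖R.side₂‖ := by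
      rw [← neg_sq] at hbsq
      rwa [sq_eq_sq₀ (by linarith) hb.le] at hbsq
    refine ⟨ψ, relX o ψ R.corner, relX o ψ R.corner + ‖R.side₁‖, relY o ψ R.corner + b,
      relY o ψ R.corner, ⟨by linarith, by linarith, ?_, ?_, ?_, ?_⟩, ?_⟩
    · simpa using hmem 0 z 1 one
    · simpa using hmem 0 z 0 z
    · simpa using hmem 1 one 1 one
    · simpa using hmem 1 one 0 z
    · rw [Rectangle.area, ← hbn]; ring

/-- Some rectangle of area `A` (possibly degenerate), parallel to the axes of the frame with angle
`ψ`, is contained in `S`. -/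
def HasArea (S : Set Plane) (o : Plane) (ψ A : ℝ) : Prop :=
  ∃ x₁ x₂ y₁ y₂ : ℝ, Fits S o ψ x₁ x₂ y₁ y₂ ∧ (x₂ - x₁) * (y₂ - y₁) = A

theorem HasArea.periodic (S : Set Plane) (o : Plane) :
    Function.Periodic (HasArea S o) (Real.pi / 2) := by
  have e : ∀ ψ x y, framePt o (ψ + Real.pi / 2) x y = framePt o ψ (-y) x := by
    intro ψ x y
    rw [framePt_add_angle]; simp
  intro ψ
  funext A
  apply propext
  constructor
  · rintro ⟨x₁, x₂, y₁, y₂, ⟨hx, hy, h11, h12, h21, h22⟩, hA⟩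
    rw [e] at h11 h12 h21 h22
    exact ⟨-y₂, -y₁, x₁, x₂, ⟨by linarith, hx, h12, h22, h11, h21⟩, by rw [← hA]; ring⟩
  · rintro ⟨x₁, x₂, y₁, y₂, ⟨hx, hy, h11, h12, h21, h22⟩, hA⟩
    refine ⟨y₁, y₂, -x₂, -x₁, ⟨hy, by linarith, ?_, ?_, ?_, ?_⟩, by rw [← hA]; ring⟩ <;>
      rw [e, neg_neg] <;> assumption

theorem Fits.bounds {S : Set Plane} {o : Plane} {D : ℝ} (hD0 : 0 ≤ D)
    (hD : ∀ q ∈ S, (q 0 - o 0) ^ 2 + (q 1 - o 1) ^ 2 ≤ D ^ 2) {ψ x₁ x₂ y₁ y₂ : ℝ}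
    (h : Fits S o ψ x₁ x₂ y₁ y₂) : (-D ≤ x₁ ∧ x₂ ≤ D) ∧ (-D ≤ y₁ ∧ y₂ ≤ D) := by
  have h1 := hD _ h.h11
  have h2 := hD _ h.h22
  rw [framePt_sq] at h1 h2
  refine ⟨⟨?_, ?_⟩, ?_, ?_⟩
  · exact (abs_le.1 (abs_le_of_sq_le_sq (by nlinarith [sq_nonneg y₁]) hD0)).1
  · exact (abs_le.1 (abs_le_of_sq_le_sq (by nlinarith [sq_nonneg y₂]) hD0)).2
  · exact (abs_le.1 (abs_le_of_sq_le_sq (by nlinarith [sq_nonneg x₁]) hD0)).1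
  · exact (abs_le.1 (abs_le_of_sq_le_sq (by nlinarith [sq_nonneg x₂]) hD0)).2

/-- The area of the rectangles in a compact set has a maximum. -/
theorem exists_max_hasArea {S : Set Plane} (hS : IsCompact S) (o : Plane) {ψ₀ A₀ D : ℝ}
    (hD0 : 0 ≤ D) (hD : ∀ q ∈ S, (q 0 - o 0) ^ 2 + (q 1 - o 1) ^ 2 ≤ D ^ 2)
    (h₀ : HasArea S o ψ₀ A₀) :
    ∃ ψ A, HasArea S o ψ A ∧ ∀ ψ' A', HasArea S o ψ' A' → A' ≤ A := by
  let Z : Set (ℝ × ℝ × ℝ × ℝ × ℝ) := {z | z.1 ∈ Set.Icc 0 (Real.pi / 2) ∧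
    Fits S o z.1 z.2.1 z.2.2.1 z.2.2.2.1 z.2.2.2.2}
  have hcont : ∀ f g h : ℝ × ℝ × ℝ × ℝ × ℝ → ℝ, Continuous f → Continuous g → Continuous h →
      Continuous fun z => framePt o (f z) (g z) (h z) := by
    intro f g h hf hg hh
    refine (PiLp.continuous_toLp 2 _).comp (continuous_pi fun i => ?_)
    fin_cases i
    · change Continuous fun z => o 0 + g z * Real.cos (f z) - h z * Real.sin (f z)
      fun_prop
    · change Continuous fun z => o 1 + g z * Real.sin (f z) + h z * Real.cos (f z)
      fun_prop
  have hZ : Z = {z | z.1 ∈ Set.Icc 0 (Real.pi / 2)} ∩ {z | z.2.1 ≤ z.2.2.1} ∩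
      {z | z.2.2.2.1 ≤ z.2.2.2.2} ∩ (fun z => framePt o z.1 z.2.1 z.2.2.2.1) ⁻¹' S ∩
      (fun z => framePt o z.1 z.2.1 z.2.2.2.2) ⁻¹' S ∩
      (fun z => framePt o z.1 z.2.2.1 z.2.2.2.1) ⁻¹' S ∩
      (fun z => framePt o z.1 z.2.2.1 z.2.2.2.2) ⁻¹' S := by
    ext z
    constructor
    · rintro ⟨h1, h⟩
      exact ⟨⟨⟨⟨⟨⟨h1, h.hx⟩, h.hy⟩, h.h11⟩, h.h12⟩, h.h21⟩, h.h22⟩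
    · rintro ⟨⟨⟨⟨⟨⟨h1, hx⟩, hy⟩, h11⟩, h12⟩, h21⟩, h22⟩
      exact ⟨h1, hx, hy, h11, h12, h21, h22⟩
  have hclosed : IsClosed Z := by
    rw [hZ]
    refine ((((((isClosed_Icc.preimage (by fun_prop)).inter (isClosed_le (by fun_prop)
      (by fun_prop))).inter (isClosed_le (by fun_prop) (by fun_prop))).inter
      (hS.isClosed.preimage ?_)).inter (hS.isClosed.preimage ?_)).inter
      (hS.isClosed.preimage ?_)).inter (hS.isClosed.preimage ?_) <;>
    exact hcont _ _ _ (by fun_prop) (by fun_prop) (by fun_prop)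
  have hcomp : IsCompact Z := by
    have hbox : IsCompact (Set.Icc (0 : ℝ) (Real.pi / 2) ×ˢ Set.Icc (-D) D ×ˢ Set.Icc (-D) D ×ˢ
        Set.Icc (-D) D ×ˢ Set.Icc (-D) D) :=
      isCompact_Icc.prod (isCompact_Icc.prod (isCompact_Icc.prod
        (isCompact_Icc.prod isCompact_Icc)))
    refine hbox.of_isClosed_subset hclosed ?_
    rintro z ⟨h1, h⟩
    have hb := h.bounds hD0 hD
    have := h.hx
    have := h.hy
    refine ⟨h1, ⟨?_, ?_⟩, ⟨?_, ?_⟩, ⟨?_, ?_⟩, ?_, ?_⟩ <;> linarith [hb.1.1, hb.1.2, hb.2.1, hb.2.2]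
  have hred : ∀ ψ A, HasArea S o ψ A →
      ∃ z ∈ Z, (z.2.2.1 - z.2.1) * (z.2.2.2.2 - z.2.2.2.1) = A := by
    intro ψ A h
    obtain ⟨ψ', hψ', he⟩ := (HasArea.periodic S o).exists_mem_Ico₀ (by positivity) ψ
    rw [he] at h
    obtain ⟨x₁, x₂, y₁, y₂, hf, hA⟩ := h
    exact ⟨(ψ', x₁, x₂, y₁, y₂), ⟨⟨hψ'.1, hψ'.2.le⟩, hf⟩, hA⟩
  obtain ⟨z₀, hz₀, -⟩ := hred _ _ h₀
  obtain ⟨z, hz, hmax⟩ := hcomp.exists_isMaxOn ⟨z₀, hz₀⟩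
    (f := fun z => (z.2.2.1 - z.2.1) * (z.2.2.2.2 - z.2.2.2.1)) (by fun_prop)
  refine ⟨z.1, _, ⟨_, _, _, _, hz.2, rfl⟩, fun ψ' A' h => ?_⟩
  obtain ⟨z', hz', rfl⟩ := hred _ _ h
  exact hmax hz'

/-- A rectangle of maximal area over all frames is a MAIR. -/
theorem isMAIR_rectOf {S : Set Plane} (hS : Convex ℝ S) {o : Plane} {ψ x₁ x₂ y₁ y₂ : ℝ}
    (h : Fits S o ψ x₁ x₂ y₁ y₂) (hx : x₁ < x₂) (hy : y₁ < y₂)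
    (hmax : ∀ ψ' A', HasArea S o ψ' A' → A' ≤ (x₂ - x₁) * (y₂ - y₁)) :
    IsMAIR S (rectOf o ψ x₁ x₂ y₁ y₂ hx hy) := by
  refine ⟨h.region_subset hS hx hy, fun R hR => ?_⟩
  rw [rectOf_area]
  obtain ⟨ψ', a₁, a₂, b₁, b₂, ⟨ha, hb, h11, h12, h21, h22⟩, hA⟩ := R.exists_fits o
  exact hmax ψ' _ ⟨a₁, a₂, b₁, b₂, ⟨ha, hb, hR h11, hR h12, hR h21, hR h22⟩, hA⟩

/-! ### Level sets of the area function -/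

/-- The pairs `(y₁, y₂)` such that, in the frame with angle `ψ`, a rectangle between the heights
`y₁` and `y₂` fits into `S` and the square root of its area is at least `c`. -/
def Lev (S : Set Plane) (o : Plane) (ψ c : ℝ) : Set (ℝ × ℝ) :=
  {z | ∃ x₁ x₂, Fits S o ψ x₁ x₂ z.1 z.2 ∧ c ≤ √((x₂ - x₁) * (z.2 - z.1))}

theorem Lev.anti (S : Set Plane) (o : Plane) (ψ : ℝ) {c c' : ℝ} (h : c ≤ c') :
    Lev S o ψ c' ⊆ Lev S o ψ c := by
  rintro z ⟨x₁, x₂, hf, hc⟩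
  exact ⟨x₁, x₂, hf, h.trans hc⟩

/-- The geometric mean is a concave function of two nonnegative numbers. -/
theorem sqrt_mul_concave {a b a' b' s t : ℝ} (ha : 0 ≤ a) (hb : 0 ≤ b) (ha' : 0 ≤ a')
    (hb' : 0 ≤ b') (hs : 0 ≤ s) (ht : 0 ≤ t) :
    s * √(a * b) + t * √(a' * b') ≤ √((s * a + t * a') * (s * b + t * b')) := by
  apply Real.le_sqrt_of_sq_le
  rw [Real.sqrt_mul ha, Real.sqrt_mul ha']
  obtain ⟨p, hp⟩ : ∃ p, p = √a := ⟨_, rfl⟩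
  obtain ⟨q, hq⟩ : ∃ p, p = √b := ⟨_, rfl⟩
  obtain ⟨p', hp'⟩ : ∃ p, p = √a' := ⟨_, rfl⟩
  obtain ⟨q', hq'⟩ : ∃ p, p = √b' := ⟨_, rfl⟩
  rw [← hp, ← hq, ← hp', ← hq']
  have e1 : a = p ^ 2 := by rw [hp, Real.sq_sqrt ha]
  have e2 : b = q ^ 2 := by rw [hq, Real.sq_sqrt hb]
  have e3 : a' = p' ^ 2 := by rw [hp', Real.sq_sqrt ha']
  have e4 : b' = q' ^ 2 := by rw [hq', Real.sq_sqrt hb']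
  rw [e1, e2, e3, e4]
  nlinarith [mul_nonneg (mul_nonneg hs ht) (sq_nonneg (p * q' - p' * q))]

/-- The square root of the area is a concave function. -/
theorem Lev.combo {S : Set Plane} (hS : Convex ℝ S) {o : Plane} {ψ c c' s t : ℝ} {z z' : ℝ × ℝ}
    (hz : z ∈ Lev S o ψ c) (hz' : z' ∈ Lev S o ψ c') (hs : 0 ≤ s) (ht : 0 ≤ t) (hst : s + t = 1) :
    (s * z.1 + t * z'.1, s * z.2 + t * z'.2) ∈ Lev S o ψ (s * c + t * c') := by
  obtain ⟨x₁, x₂, ⟨hx, hy, h11, h12, h21, h22⟩, hc⟩ := hz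
  obtain ⟨x₁', x₂', ⟨hx', hy', h11', h12', h21', h22'⟩, hc'⟩ := hz'
  refine ⟨s * x₁ + t * x₁', s * x₂ + t * x₂', ⟨?_, ?_, ?_, ?_, ?_, ?_⟩, ?_⟩
  · nlinarith
  · simp only; nlinarith
  · rw [framePt_combo o ψ hst]; exact hS h11 h11' hs ht hst
  · rw [framePt_combo o ψ hst]; exact hS h12 h12' hs ht hst
  · rw [framePt_combo o ψ hst]; exact hS h21 h21' hs ht hst
  · rw [framePt_combo o ψ hst]; exact hS h22 h22' hs ht hst
  · have h1 := sqrt_mul_concave (sub_nonneg.2 hx) (sub_nonneg.2 hy) (sub_nonneg.2 hx')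
      (sub_nonneg.2 hy') hs ht
    have h2 : s * c + t * c' ≤ s * √((x₂ - x₁) * (z.2 - z.1)) + t * √((x₂' - x₁') * (z'.2 - z'.1)) :=
      add_le_add (mul_le_mul_of_nonneg_left hc hs) (mul_le_mul_of_nonneg_left hc' ht)
    refine h2.trans (h1.trans (le_of_eq ?_))
    congr 1
    ring

theorem Lev.shrink {S : Set Plane} (hS : Convex ℝ S) {o : Plane} {ψ x₁ x₂ y₁ y₂ : ℝ}
    (h : Fits S o ψ x₁ x₂ y₁ y₂) {y₁' y₂' c : ℝ} (h1 : y₁ ≤ y₁') (h12 : y₁' ≤ y₂')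
    (h2 : y₂' ≤ y₂) (hc : c ≤ √((x₂ - x₁) * (y₂' - y₁'))) : (y₁', y₂') ∈ Lev S o ψ c := by
  refine ⟨x₁, x₂, ⟨h.hx, h12, ?_, ?_, ?_, ?_⟩, hc⟩
  · exact h.mem hS le_rfl h.hx h1 (h12.trans h2)
  · exact h.mem hS le_rfl h.hx (h1.trans h12) h2
  · exact h.mem hS h.hx le_rfl h1 (h12.trans h2)
  · exact h.mem hS h.hx le_rfl (h1.trans h12) h2

/-- Rectangles of area comparable to `D * w` have both sides comparable to `w` at least. -/
theorem Fits.sides_ge {S : Set Plane} {o : Plane} {D w m c : ℝ} (hD0 : 0 < D)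
    (hD : ∀ q ∈ S, (q 0 - o 0) ^ 2 + (q 1 - o 1) ^ 2 ≤ D ^ 2) (hm0 : 0 ≤ m)
    (hm : D * w / 16 ≤ m ^ 2) (hc : m / 2 ≤ c) {ψ x₁ x₂ y₁ y₂ : ℝ}
    (h : Fits S o ψ x₁ x₂ y₁ y₂) (hA : c ≤ √((x₂ - x₁) * (y₂ - y₁))) :
    w / 128 ≤ x₂ - x₁ ∧ w / 128 ≤ y₂ - y₁ := by
  have hb := h.bounds hD0.le hD
  have hx := h.hx
  have hy := h.hy
  have h1 : m / 2 ≤ √((x₂ - x₁) * (y₂ - y₁)) := hc.trans hA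
  have h2 : (m / 2) ^ 2 ≤ (x₂ - x₁) * (y₂ - y₁) := by
    have := pow_le_pow_left₀ (by linarith) h1 2
    rwa [Real.sq_sqrt (mul_nonneg (by linarith) (by linarith))] at this
  have h3 : D * w / 64 ≤ (x₂ - x₁) * (y₂ - y₁) := by nlinarith
  constructor
  · have : D * (w / 128) ≤ D * (x₂ - x₁) := by
      nlinarith [mul_le_mul_of_nonneg_left (show y₂ - y₁ ≤ 2 * D by linarith [hb.2.1, hb.2.2])
        (show 0 ≤ x₂ - x₁ by linarith)]
    exact le_of_mul_le_mul_left this hD0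
  · have : D * (w / 128) ≤ D * (y₂ - y₁) := by
      nlinarith [mul_le_mul_of_nonneg_right (show x₂ - x₁ ≤ 2 * D by linarith [hb.1.1, hb.1.2])
        (show 0 ≤ y₂ - y₁ by linarith)]
    exact le_of_mul_le_mul_left this hD0

/-- A rotation by a small angle changes the level sets by a small translation and a small loss of
area: shrink the rectangle by `e` on all four sides. -/
theorem Lev.rotate {S : Set Plane} (hS : Convex ℝ S) {o : Plane} {D w m c δ e τ ψ : ℝ}
    (hD0 : 0 < D) (hD : ∀ q ∈ S, (q 0 - o 0) ^ 2 + (q 1 - o 1) ^ 2 ≤ D ^ 2) (hm0 : 0 ≤ m)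
    (hm : D * w / 16 ≤ m ^ 2) (hc : m / 2 ≤ c) (hδ1 : δ ≤ 1) (hτ : |τ| ≤ 1)
    (hτe : 3 * D * |τ| ≤ e) (he : e ≤ δ * w / 256) (hw : 0 < w) {z : ℝ × ℝ}
    (hz : z ∈ Lev S o ψ c) : (z.1 + e, z.2 - e) ∈ Lev S o (ψ + τ) ((1 - δ) * c) := by
  obtain ⟨x₁, x₂, hf, hA⟩ := hz
  obtain ⟨ha, hb⟩ := hf.sides_ge hD0 hD hm0 hm hc hA
  have he0 : 0 ≤ e := le_trans (by positivity) hτe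
  have hδ0 : 0 ≤ δ := by
    by_contra hneg
    push Not at hneg
    nlinarith
  have h2e : 2 * e ≤ δ * (w / 128) := by linarith
  have hbd := hf.bounds hD0.le hD
  have hea : 2 * e ≤ δ * (x₂ - x₁) := h2e.trans (mul_le_mul_of_nonneg_left ha hδ0)
  have heb : 2 * e ≤ δ * (z.2 - z.1) := h2e.trans (mul_le_mul_of_nonneg_left hb hδ0)
  have hw1 : 0 < x₂ - x₁ := by linarith
  have hw2 : 0 < z.2 - z.1 := by linarith
  have hea' : 2 * e ≤ x₂ - x₁ := hea.trans (by nlinarith)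
  have heb' : 2 * e ≤ z.2 - z.1 := heb.trans (by nlinarith)
  have hcos : 1 - |τ| / 2 ≤ Real.cos τ := by
    have h1 := Real.one_sub_sq_div_two_le_cos (x := τ)
    have h2 : τ ^ 2 ≤ |τ| := by rw [← sq_abs]; nlinarith [abs_nonneg τ]
    linarith
  have hcos1 := Real.cos_le_one τ
  have hsin := abs_le.1 (Real.abs_sin_le_abs (x := τ))
  have hmove : ∀ u v : ℝ, |u| ≤ D → |v| ≤ D → |u * Real.cos τ + v * Real.sin τ - u| ≤ e := by
    intro u v hu hv
    have h1 : |u * (Real.cos τ - 1)| ≤ D * (|τ| / 2) := by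
      rw [abs_mul]
      refine mul_le_mul hu ?_ (abs_nonneg _) hD0.le
      rw [abs_le]; constructor <;> linarith [abs_nonneg τ]
    have h2 : |v * Real.sin τ| ≤ D * |τ| := by
      rw [abs_mul]
      exact mul_le_mul hv (Real.abs_sin_le_abs (x := τ)) (abs_nonneg _) hD0.le
    have h3 : u * Real.cos τ + v * Real.sin τ - u = u * (Real.cos τ - 1) + v * Real.sin τ := by ring
    rw [h3]
    refine (abs_add_le _ _).trans ?_
    nlinarith [abs_nonneg τ, mul_nonneg hD0.le (abs_nonneg τ)]
  have hcorner : ∀ x y : ℝ, x₁ + e ≤ x → x ≤ x₂ - e → z.1 + e ≤ y → y ≤ z.2 - e →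
      framePt o (ψ + τ) x y ∈ S := by
    intro x y hx1 hx2 hy1 hy2
    have hxD : |x| ≤ D := abs_le.2 ⟨by linarith [hbd.1.1], by linarith [hbd.1.2]⟩
    have hyD : |y| ≤ D := abs_le.2 ⟨by linarith [hbd.2.1], by linarith [hbd.2.2]⟩
    have m1 := abs_le.1 (hmove x (-y) hxD (by rwa [abs_neg]))
    have m2 := abs_le.1 (hmove y x hyD hxD)
    rw [framePt_add_angle]
    exact hf.mem hS (by linarith [m1.1]) (by linarith [m1.2]) (by linarith [m2.1])
      (by linarith [m2.2])
  refine ⟨x₁ + e, x₂ - e, ⟨by linarith, by simp only; linarith, ?_, ?_, ?_, ?_⟩, ?_⟩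
  · exact hcorner _ _ le_rfl (by linarith) le_rfl (by linarith)
  · exact hcorner _ _ le_rfl (by linarith) (by linarith) le_rfl
  · exact hcorner _ _ (by linarith) le_rfl le_rfl (by linarith)
  · exact hcorner _ _ (by linarith) le_rfl (by linarith) le_rfl
  · have h1 : (1 - δ) * c ≤ (1 - δ) * √((x₂ - x₁) * (z.2 - z.1)) :=
      mul_le_mul_of_nonneg_left hA (by linarith)
    refine h1.trans (Real.le_sqrt_of_sq_le ?_)
    rw [mul_pow, Real.sq_sqrt (by positivity)]
    have h2 : (1 - δ) * (x₂ - x₁) ≤ x₂ - e - (x₁ + e) := by linarith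
    have h3 : (1 - δ) * (z.2 - z.1) ≤ z.2 - e - (z.1 + e) := by linarith
    have := mul_le_mul h2 h3 (mul_nonneg (by linarith) hw2.le) (by linarith)
    nlinarith

/-! ### Size and direction of large rectangles -/

/-- A convex set that contains a segment of length `D` and a point at distance `w` from its line
contains a rectangle of area `D * w / 16`. -/
theorem exists_hasArea_of_triangle {S : Set Plane} (hS : Convex ℝ S) {o g : Plane} {ψ D w : ℝ}
    (hD0 : 0 < D) (hD : ∀ q ∈ S, (q 0 - o 0) ^ 2 + (q 1 - o 1) ^ 2 ≤ D ^ 2)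
    (ho : framePt o ψ 0 0 ∈ S) (hf : framePt o ψ D 0 ∈ S) (hg : g ∈ S) (hw : 0 ≤ w)
    (hgw : |relY o ψ g| = w) : HasArea S o ψ (D * w / 16) := by
  have hu : |relX o ψ g| ≤ D := by
    have h1 := hD _ hg
    rw [← framePt_rel o ψ g, framePt_sq] at h1
    exact abs_le_of_sq_le_sq (by nlinarith [sq_nonneg (relY o ψ g)]) hD0.le
  obtain ⟨hu1, hu2⟩ := abs_le.1 hu
  rw [← framePt_rel o ψ g] at hg
  set u := relX o ψ g
  set v := relY o ψ g
  have hbase : ∀ x, 0 ≤ x → x ≤ D → framePt o ψ x 0 ∈ S := fun x h0 h1 =>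
    framePt_mem_of_between_x hS ho hf h0 h1
  have hup : ∀ x, D / 4 ≤ x → x ≤ D / 2 → framePt o ψ x (v / 4) ∈ S := by
    intro x h0 h1
    have := hS hg (hbase ((x - u / 4) * (4 / 3)) (by linarith) (by linarith))
      (show (0 : ℝ) ≤ 1 / 4 by norm_num) (show (0 : ℝ) ≤ 3 / 4 by norm_num) (by norm_num)
    rw [← framePt_combo o ψ (by norm_num)] at this
    convert this using 1
    congr 1 <;> ring
  have b1 := hbase (D / 4) (by linarith) (by linarith)
  have b2 := hbase (D / 2) (by linarith) (by linarith)
  have t1 := hup (D / 4) le_rfl (by linarith)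
  have t2 := hup (D / 2) (by linarith) le_rfl
  rcases le_or_gt 0 v with h | h
  · rw [abs_of_nonneg h] at hgw
    exact ⟨D / 4, D / 2, 0, v / 4, ⟨by linarith, by linarith, b1, t1, b2, t2⟩, by rw [hgw]; ring⟩
  · rw [abs_of_neg h] at hgw
    exact ⟨D / 4, D / 2, v / 4, 0, ⟨by linarith, by linarith, t1, b1, t2, b2⟩,
      by rw [← hgw]; ring⟩

/-- In a set of length about `D` and width `w`, a rectangle whose area is comparable to `D * w`
is almost parallel to the long direction of the set. -/
theorem angle_le_of_hasArea {S : Set Plane} {o : Plane} {ψ φ D w A : ℝ} (hD0 : 0 < D)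
    (hw : 0 < w) (hY : ∀ q ∈ S, |relY o ψ q| ≤ w) (hA : D * w / 16 ≤ A)
    (h : HasArea S o (ψ + φ) A) (hφ : |φ| ≤ Real.pi / 4) : |φ| ≤ 200 * (w / D) := by
  obtain ⟨x₁, x₂, y₁, y₂, ⟨hx, hy, h11, h12, h21, h22⟩, rfl⟩ := h
  have e : ∀ x y, relY o ψ (framePt o (ψ + φ) x y) = x * Real.sin φ + y * Real.cos φ := by
    intro x y
    rw [framePt_add_angle, relY_framePt]
  have k11 := abs_le.1 (hY _ h11)
  have k12 := abs_le.1 (hY _ h12)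
  have k21 := abs_le.1 (hY _ h21)
  have k22 := abs_le.1 (hY _ h22)
  rw [e] at k11 k12 k21 k22
  have hpi := Real.pi_gt_three
  have hpi4 := Real.pi_le_four
  have hcos : (7 : ℝ) / 10 ≤ Real.cos φ := by
    have h1 : Real.cos (Real.pi / 4) ≤ Real.cos |φ| :=
      Real.cos_le_cos_of_nonneg_of_le_pi (abs_nonneg _) (by linarith) hφ
    rw [Real.cos_abs, Real.cos_pi_div_four] at h1
    have h2 : (7 : ℝ) / 5 ≤ √2 := Real.le_sqrt_of_sq_le (by norm_num)
    linarith
  have ha : 0 ≤ x₂ - x₁ := by linarith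
  have hb : 0 ≤ y₂ - y₁ := by linarith
  -- the extent of the rectangle orthogonal to the long direction
  have hext : (x₂ - x₁) * |Real.sin φ| + (y₂ - y₁) * Real.cos φ ≤ 2 * w := by
    rcases abs_cases (Real.sin φ) with ⟨hs, -⟩ | ⟨hs, -⟩ <;> rw [hs] <;>
      nlinarith [k11.1, k11.2, k12.1, k12.2, k21.1, k21.2, k22.1, k22.2]
  have hb2 : y₂ - y₁ ≤ 20 / 7 * w := by
    nlinarith [mul_nonneg ha (abs_nonneg (Real.sin φ))]
  have ha2 : D * 7 / 320 ≤ x₂ - x₁ := by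
    have : w * (D * 7 / 320) ≤ w * (x₂ - x₁) := by
      nlinarith [mul_le_mul_of_nonneg_left hb2 ha]
    exact le_of_mul_le_mul_left this hw
  have hs : |Real.sin φ| ≤ 640 / 7 * (w / D) := by
    rw [mul_div_assoc', le_div_iff₀ hD0]
    nlinarith [mul_le_mul_of_nonneg_right ha2 (abs_nonneg (Real.sin φ)), mul_nonneg hb
      (show 0 ≤ Real.cos φ by linarith)]
  have hj : 2 / Real.pi * |φ| ≤ |Real.sin φ| := by
    have h1 := Real.mul_le_sin (abs_nonneg φ) (by linarith)
    refine h1.trans ?_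
    rcases abs_cases φ with ⟨h2, -⟩ | ⟨h2, -⟩ <;> rw [h2]
    · exact le_abs_self _
    · rw [Real.sin_neg]; exact neg_le_abs _
  have hj' : |φ| ≤ Real.pi / 2 * |Real.sin φ| := by
    have := mul_le_mul_of_nonneg_left hj (show 0 ≤ Real.pi / 2 by linarith)
    have e2 : Real.pi / 2 * (2 / Real.pi * |φ|) = |φ| := by field_simp
    linarith
  have hq : 0 ≤ w / D := by positivity
  nlinarith [Real.pi_lt_d2, abs_nonneg (Real.sin φ)]

/-! ### Sheared boxes and sampling of concave functions -/

/-- The parallelogram `tl ≤ t ≤ tl + W`, `cl ≤ y - σ t ≤ cl + U` in the plane with coordinates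
`(t, y)`. -/
structure SBox where
  tl : ℝ
  W : ℝ
  σ : ℝ
  cl : ℝ
  U : ℝ

/-- The point lies in the parallelogram. -/
def SBox.Mem (b : SBox) (z : ℝ × ℝ) : Prop :=
  (b.tl ≤ z.1 ∧ z.1 ≤ b.tl + b.W) ∧ (b.cl ≤ z.2 - b.σ * z.1 ∧ z.2 - b.σ * z.1 ≤ b.cl + b.U)

/-- A translate of the parallelogram, scaled by `β`, is contained in `A`. -/
def SBox.Core (b : SBox) (β : ℝ) (A : Set (ℝ × ℝ)) : Prop :=
  ∃ t₀ u₀, ∀ t u, t₀ ≤ t → t ≤ t₀ + β * b.W → u₀ ≤ u → u ≤ u₀ + β * b.U → (t, u + b.σ * t) ∈ A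

/-- The parallelogram contains `A`, and up to the factor `β` it is not larger than `A`. -/
structure SBox.Fat (b : SBox) (β : ℝ) (A : Set (ℝ × ℝ)) : Prop where
  W_pos : 0 < b.W
  U_pos : 0 < b.U
  mem : ∀ z ∈ A, b.Mem z
  core : b.Core β A

/-- The point belongs to `A`, and so do a point to the left of it and a point above it.  For a level
set `Lev S o ψ c` this means that both heights are strictly between those of the lowest and the
highest point, which is where the evaluation of the area is exact. -/
def IsInnerPoint (A : Set (ℝ × ℝ)) (z : ℝ × ℝ) : Prop :=
  z ∈ A ∧ ∃ κ > 0, (z.1 - κ, z.2) ∈ A ∧ (z.1, z.2 + κ) ∈ A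

/-- The superlevel sets of a concave function in the plane. -/
structure ConcaveFamily (S : ℝ → Set (ℝ × ℝ)) : Prop where
  anti : ∀ c c', c ≤ c' → S c' ⊆ S c
  combo : ∀ c c' s t z z', z ∈ S c → z' ∈ S c' → 0 ≤ s → 0 ≤ t → s + t = 1 →
    (s * z.1 + t * z'.1, s * z.2 + t * z'.2) ∈ S (s * c + t * c')

theorem Lev.concaveFamily {S : Set Plane} (hS : Convex ℝ S) (o : Plane) (ψ : ℝ) :
    ConcaveFamily (Lev S o ψ) :=
  ⟨fun _ _ h => Lev.anti S o ψ h, fun _ _ _ _ _ _ hz hz' => Lev.combo hS hz hz'⟩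

theorem SBox.Core.mono {b : SBox} {β β' : ℝ} {A A' : Set (ℝ × ℝ)} (h : b.Core β A) (hβ : β' ≤ β)
    (hW : 0 ≤ b.W) (hU : 0 ≤ b.U) (hA : A ⊆ A') : b.Core β' A' := by
  obtain ⟨t₀, u₀, h⟩ := h
  refine ⟨t₀, u₀, fun t u h1 h2 h3 h4 => hA (h t u h1 (h2.trans ?_) h3 (h4.trans ?_))⟩
  · nlinarith
  · nlinarith

/-- Shrinking a core towards a point of a higher level set. -/
theorem SBox.Core.shrink {S : ℝ → Set (ℝ × ℝ)} (hS : ConcaveFamily S) {b : SBox} {β c c' r : ℝ}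
    {z : ℝ × ℝ} (h : b.Core β (S c)) (hz : z ∈ S c') (hr : 0 < r) (hr1 : r ≤ 1) :
    b.Core (r * β) (S ((1 - r) * c' + r * c)) := by
  obtain ⟨t₀, u₀, h⟩ := h
  refine ⟨(1 - r) * z.1 + r * t₀, (1 - r) * (z.2 - b.σ * z.1) + r * u₀,
    fun t u h1 h2 h3 h4 => ?_⟩
  have hk := h ((t - (1 - r) * z.1) / r) ((u - (1 - r) * (z.2 - b.σ * z.1)) / r)
    (by rw [le_div_iff₀ hr]; linarith) (by rw [div_le_iff₀ hr]; linarith)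
    (by rw [le_div_iff₀ hr]; linarith) (by rw [div_le_iff₀ hr]; linarith)
  have := hS.combo _ _ (1 - r) r _ _ hz hk (by linarith) hr.le (by ring)
  convert this using 1
  simp only
  congr 1
  · field_simp; ring
  · field_simp; ring

theorem exists_grid_point {l W x L : ℝ} {N : ℕ} (hW : 0 < W) (hx : l ≤ x) (hL : x + L ≤ l + W)
    (hN : W < N * L) : ∃ i ≤ N, x < l + i / N * W ∧ l + i / N * W < x + L := by
  have hN0 : (0 : ℝ) < N := by
    rcases Nat.eq_zero_or_pos N with h | h
    · rw [h] at hN; simp at hN; linarith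
    · exact_mod_cast h
  have hy : 0 ≤ (x - l) * N / W := by
    apply div_nonneg _ hW.le
    exact mul_nonneg (by linarith) hN0.le
  have h1 := Nat.lt_floor_add_one ((x - l) * N / W)
  have h2 := Nat.floor_le hy
  set f := ⌊(x - l) * N / W⌋₊
  rw [div_lt_iff₀ hW] at h1
  rw [le_div_iff₀ hW] at h2
  have h3 : x < l + ((f + 1 : ℕ) : ℝ) / N * W := by
    rw [div_mul_eq_mul_div, ← sub_lt_iff_lt_add', lt_div_iff₀ hN0]
    push_cast; linarith
  have h4 : l + ((f + 1 : ℕ) : ℝ) / N * W < x + L := by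
    rw [div_mul_eq_mul_div, ← lt_sub_iff_add_lt', div_lt_iff₀ hN0]
    push_cast; linarith
  refine ⟨f + 1, ?_, h3, h4⟩
  by_contra hlt
  push Not at hlt
  have h5 : (N : ℝ) ≤ ((f + 1 : ℕ) : ℝ) := by exact_mod_cast hlt.le
  have h6 : 1 ≤ ((f + 1 : ℕ) : ℝ) / N := by rwa [le_div_iff₀ hN0, one_mul]
  nlinarith

theorem lt_natCast_mul_mul {N : ℕ} {W x : ℝ} (hW : 0 < W) (hx : 1 < N * x) :
    W < N * (x * W) := by
  nlinarith

/-- A grid point that lies well inside `A`. -/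
theorem exists_inner_grid_point {b : SBox} {A : Set (ℝ × ℝ)} {N : ℕ} {t₀ u₀ L L' : ℝ}
    (hW : 0 < b.W) (hU : 0 < b.U) (hA : ∀ z ∈ A, b.Mem z) (hL : 0 < L) (hL' : 0 < L')
    (h : ∀ t u, t₀ ≤ t → t ≤ t₀ + L → u₀ ≤ u → u ≤ u₀ + L' → (t, u + b.σ * t) ∈ A)
    (hNW : b.W < N * L) (hNU : b.U < N * L') :
    ∃ i ≤ N, ∃ j ≤ N, (t₀ ≤ b.tl + i / N * b.W ∧ b.tl + i / N * b.W ≤ t₀ + L) ∧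
      (u₀ ≤ b.cl + j / N * b.U ∧ b.cl + j / N * b.U ≤ u₀ + L') ∧
      IsInnerPoint A (b.tl + i / N * b.W, b.cl + j / N * b.U + b.σ * (b.tl + i / N * b.W)) := by
  have c1 := hA _ (h t₀ u₀ le_rfl (by linarith) le_rfl (by linarith))
  have c2 := hA _ (h (t₀ + L) (u₀ + L') (by linarith) le_rfl (by linarith) le_rfl)
  simp only [SBox.Mem, add_sub_cancel_right] at c1 c2
  obtain ⟨i, hi, hi1, hi2⟩ := exists_grid_point hW c1.1.1 c2.1.2 hNW
  obtain ⟨j, hj, hj1, hj2⟩ := exists_grid_point hU c1.2.1 c2.2.2 hNU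
  refine ⟨i, hi, j, hj, ⟨hi1.le, hi2.le⟩, ⟨hj1.le, hj2.le⟩, ?_⟩
  generalize b.tl + i / N * b.W = t at *
  generalize b.cl + j / N * b.U = u at *
  refine ⟨h t u hi1.le hi2.le hj1.le hj2.le, ?_⟩
  have hσ : 0 < 1 + |b.σ| := by positivity
  obtain ⟨κ, hκ, k1, k2, k3⟩ : ∃ κ > 0, κ ≤ t - t₀ ∧ κ * (1 + |b.σ|) ≤ u - u₀ ∧
      κ * (1 + |b.σ|) ≤ u₀ + L' - u := by
    refine ⟨min (t - t₀) (min ((u - u₀) / (1 + |b.σ|)) ((u₀ + L' - u) / (1 + |b.σ|))), ?_, ?_, ?_, ?_⟩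
    · refine lt_min (by linarith) (lt_min ?_ ?_) <;> apply div_pos <;> linarith
    · exact min_le_left _ _
    · rw [← le_div_iff₀ hσ]; exact (min_le_right _ _).trans (min_le_left _ _)
    · rw [← le_div_iff₀ hσ]; exact (min_le_right _ _).trans (min_le_right _ _)
  have ha := neg_abs_le b.σ
  have hb := le_abs_self b.σ
  refine ⟨κ, hκ, ?_, ?_⟩
  · have := h (t - κ) (u + b.σ * κ) (by linarith) (by linarith) (by nlinarith) (by nlinarith)
    convert this using 2
    ring
  · have := h t (u + κ) hi1.le hi2.le (by linarith) (by nlinarith [abs_nonneg b.σ])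
    convert this using 2
    ring

/-- Sampling a concave function on a grid in a sheared box `b` that contains the level set
`S ((1 - γ) * m)`, where `m` is an upper bound for the function.  The samples with a value of at
least `1 - γ` times the largest sampled value pin the level set down up to a constant factor: in
the direction from the leftmost to the rightmost of them, the smallest box around them, slightly
enlarged, is fat. -/
structure Sampling (S : ℝ → Set (ℝ × ℝ)) (m γ ρ : ℝ) (N : ℕ) (b : SBox) (cnt : ℕ)
    (T Y V : ℕ → ℝ) (M : ℝ) : Prop where
  fam : ConcaveFamily S
  m_pos : 0 < m
  γ_pos : 0 < γ
  γ_lt : γ < 1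
  ρ_pos : 0 < ρ
  N_large : 1 < N * (ρ * (ρ / 4))
  ρ_le : ρ ≤ 1
  le_m : ∀ c z, z ∈ S c → c ≤ m
  W_pos : 0 < b.W
  U_pos : 0 < b.U
  sub : ∀ z ∈ S ((1 - γ) * m), b.Mem z
  core : b.Core ρ (S ((1 - γ / 4) * m))
  grid : ∀ i ≤ N, ∀ j ≤ N, ∃ k < cnt, T k = b.tl + i / N * b.W ∧
    Y k = b.cl + j / N * b.U + b.σ * (b.tl + i / N * b.W)
  val_mem : ∀ k < cnt, 0 < V k → (T k, Y k) ∈ S (V k)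
  val_ge : ∀ k < cnt, ∀ c, IsInnerPoint (S c) (T k, Y k) → c ≤ V k
  le_M : ∀ k < cnt, V k ≤ M
  M_eq : ∃ k < cnt, V k = M

namespace Sampling

variable {S : ℝ → Set (ℝ × ℝ)} {m γ ρ : ℝ} {N : ℕ} {b : SBox} {cnt : ℕ} {T Y V : ℕ → ℝ} {M : ℝ}

theorem N_large' (h : Sampling S m γ ρ N b cnt T Y V M) : 1 < N * (ρ / 4) := by
  have h1 := h.N_large
  have h2 : ρ * (ρ / 4) ≤ 1 * (ρ / 4) :=
    mul_le_mul_of_nonneg_right h.ρ_le (by linarith [h.ρ_pos])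
  nlinarith [Nat.cast_nonneg (α := ℝ) N]

theorem grid_inner (h : Sampling S m γ ρ N b cnt T Y V M) {c t₀ u₀ L L' : ℝ}
    (hc : (1 - γ) * m ≤ c) (hL : 0 < L) (hL' : 0 < L')
    (hbox : ∀ t u, t₀ ≤ t → t ≤ t₀ + L → u₀ ≤ u → u ≤ u₀ + L' → (t, u + b.σ * t) ∈ S c)
    (hNW : b.W < N * L) (hNU : b.U < N * L') :
    ∃ k < cnt, c ≤ V k ∧ (t₀ ≤ T k ∧ T k ≤ t₀ + L) ∧
      (u₀ ≤ Y k - b.σ * T k ∧ Y k - b.σ * T k ≤ u₀ + L') := by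
  obtain ⟨i, hi, j, hj, h1, h2, h3⟩ := exists_inner_grid_point h.W_pos h.U_pos
    (fun z hz => h.sub z (h.fam.anti _ _ hc hz)) hL hL' hbox hNW hNU
  obtain ⟨k, hk, hT, hY⟩ := h.grid i hi j hj
  refine ⟨k, hk, h.val_ge k hk c ?_, ?_, ?_⟩
  · rwa [hT, hY]
  · rwa [hT]
  · rw [hY, hT, add_sub_cancel_right]; exact h2

theorem M_ge (h : Sampling S m γ ρ N b cnt T Y V M) : (1 - γ / 4) * m ≤ M := by
  obtain ⟨t₀, u₀, hc⟩ := h.core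
  have hρ := h.ρ_pos
  have hN : 1 < N * ρ := by nlinarith [h.N_large', Nat.cast_nonneg (α := ℝ) N]
  obtain ⟨k, hk, h1, -⟩ := h.grid_inner (by nlinarith [h.m_pos, h.γ_pos])
    (mul_pos hρ h.W_pos) (mul_pos hρ h.U_pos) hc
    (lt_natCast_mul_mul h.W_pos hN) (lt_natCast_mul_mul h.U_pos hN)
  exact h1.trans (h.le_M k hk)

theorem M_pos (h : Sampling S m γ ρ N b cnt T Y V M) : 0 < M :=
  lt_of_lt_of_le (mul_pos (by linarith [h.γ_lt, h.γ_pos]) h.m_pos) h.M_ge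

theorem M_le (h : Sampling S m γ ρ N b cnt T Y V M) : M ≤ m := by
  obtain ⟨k, hk, hM⟩ := h.M_eq
  have := h.val_mem k hk (hM ▸ h.M_pos)
  exact hM ▸ h.le_m _ _ this

/-- Every point of the level set is close to a sample that passes the threshold. -/
theorem near_pass (h : Sampling S m γ ρ N b cnt T Y V M) {z : ℝ × ℝ}
    (hz : z ∈ S ((1 - γ) * m)) :
    ∃ k < cnt, (1 - γ) * M ≤ V k ∧ |z.1 - T k| ≤ ρ / 4 * b.W ∧
      |(z.2 - b.σ * z.1) - (Y k - b.σ * T k)| ≤ ρ / 4 * b.U := by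
  have hρ := h.ρ_pos
  have hcore := h.core.mono (A' := S ((1 - γ) * m)) le_rfl h.W_pos.le h.U_pos.le
    (h.fam.anti _ _ (by nlinarith [h.m_pos, h.γ_pos]))
  have hcore' := hcore
  obtain ⟨t₀, u₀, hc⟩ := hcore'
  -- the core, shrunk towards `z` by the factor `ρ / 4`
  have hbox : ∀ t u, (1 - ρ / 4) * z.1 + ρ / 4 * t₀ ≤ t →
      t ≤ (1 - ρ / 4) * z.1 + ρ / 4 * t₀ + ρ * (ρ / 4) * b.W →
      (1 - ρ / 4) * (z.2 - b.σ * z.1) + ρ / 4 * u₀ ≤ u →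
      u ≤ (1 - ρ / 4) * (z.2 - b.σ * z.1) + ρ / 4 * u₀ + ρ * (ρ / 4) * b.U →
      (t, u + b.σ * t) ∈ S ((1 - γ) * m) := by
    intro t u h1 h2 h3 h4
    have hr : 0 < ρ / 4 := by positivity
    have hk := hc ((t - (1 - ρ / 4) * z.1) / (ρ / 4))
      ((u - (1 - ρ / 4) * (z.2 - b.σ * z.1)) / (ρ / 4))
      (by rw [le_div_iff₀ hr]; linarith) (by rw [div_le_iff₀ hr]; linarith)
      (by rw [le_div_iff₀ hr]; linarith) (by rw [div_le_iff₀ hr]; linarith)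
    have := h.fam.combo _ _ (1 - ρ / 4) (ρ / 4) _ _ hz hk (by linarith [h.ρ_le]) hr.le (by ring)
    rw [← add_mul, sub_add_cancel, one_mul] at this
    convert this using 1
    simp only
    congr 1
    · field_simp; ring
    · field_simp; ring
  obtain ⟨k, hk, h1, h2, h3⟩ := h.grid_inner le_rfl
    (mul_pos (mul_pos hρ (by positivity)) h.W_pos) (mul_pos (mul_pos hρ (by positivity)) h.U_pos)
    hbox (lt_natCast_mul_mul h.W_pos h.N_large) (lt_natCast_mul_mul h.U_pos h.N_large)
  have hzb := h.sub z hz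
  have c1 := h.sub _ (hc t₀ u₀ le_rfl (by nlinarith [h.W_pos]) le_rfl (by nlinarith [h.U_pos]))
  have c2 := h.sub _ (hc (t₀ + ρ * b.W) (u₀ + ρ * b.U) (by nlinarith [h.W_pos]) le_rfl
    (by nlinarith [h.U_pos]) le_rfl)
  simp only [SBox.Mem, add_sub_cancel_right] at c1 c2 hzb
  refine ⟨k, hk, ?_, ?_, ?_⟩
  · exact (mul_le_mul_of_nonneg_left h.M_le (by linarith [h.γ_lt])).trans h1
  · rw [abs_le]
    constructor <;> nlinarith [c1.1.1, c1.1.2, c2.1.1, c2.1.2, hzb.1.1, hzb.1.2, h2.1, h2.2]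
  · rw [abs_le]
    constructor <;> nlinarith [c1.2.1, c1.2.2, c2.2.1, c2.2.2, hzb.2.1, hzb.2.2, h3.1, h3.2]

/-- Two passing samples that are far apart, both in `t` and in any sheared coordinate. -/
theorem far_pass (h : Sampling S m γ ρ N b cnt T Y V M) (σ' : ℝ) :
    ∃ k < cnt, ∃ l < cnt, (1 - γ) * M ≤ V k ∧ (1 - γ) * M ≤ V l ∧ ρ / 2 * b.W ≤ T l - T k ∧
      ρ / 2 * (b.U + |σ' - b.σ| * b.W) ≤ |(Y l - σ' * T l) - (Y k - σ' * T k)| := by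
  have hρ := h.ρ_pos
  have hW := h.W_pos
  have hU := h.U_pos
  have hM : (1 - γ) * M ≤ (1 - γ) * m := mul_le_mul_of_nonneg_left h.M_le (by linarith [h.γ_lt])
  obtain ⟨t₀, u₀, hc⟩ := h.core.mono (A' := S ((1 - γ) * m)) le_rfl hW.le hU.le
    (h.fam.anti _ _ (by nlinarith [h.m_pos, h.γ_pos]))
  have hρW := mul_pos hρ hW
  have hρU := mul_pos hρ hU
  have corner : ∀ x y, 0 ≤ x → x ≤ 3 / 4 → 0 ≤ y → y ≤ 3 / 4 → ∃ k < cnt, (1 - γ) * m ≤ V k ∧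
      (t₀ + x * (ρ * b.W) ≤ T k ∧ T k ≤ t₀ + x * (ρ * b.W) + ρ / 4 * b.W) ∧
      (u₀ + y * (ρ * b.U) ≤ Y k - b.σ * T k ∧
        Y k - b.σ * T k ≤ u₀ + y * (ρ * b.U) + ρ / 4 * b.U) := by
    intro x y hx hx' hy hy'
    have p1 := mul_nonneg hx hρW.le
    have p2 := mul_nonneg hy hρU.le
    have p3 := mul_le_mul_of_nonneg_right hx' hρW.le
    have p4 := mul_le_mul_of_nonneg_right hy' hρU.le
    exact h.grid_inner le_rfl (by positivity) (by positivity)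
      (fun t u h1 h2 h3 h4 => hc t u (by linarith) (by linarith) (by linarith) (by linarith))
      (lt_natCast_mul_mul hW h.N_large') (lt_natCast_mul_mul hU h.N_large')
  -- of the two diagonals of the core, take the one along which the shear adds to the extent
  rcases le_total 0 (σ' - b.σ) with hs | hs
  · obtain ⟨k, hk, k1, k2, k3⟩ := corner 0 (3 / 4) le_rfl (by norm_num) (by norm_num) le_rfl
    obtain ⟨l, hl, l1, l2, l3⟩ := corner (3 / 4) 0 (by norm_num) le_rfl le_rfl (by norm_num)
    refine ⟨k, hk, l, hl, hM.trans k1, hM.trans l1, by linarith [k2.2, l2.1], ?_⟩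
    rw [abs_of_nonneg hs]
    refine le_trans ?_ (neg_le_abs _)
    have : ρ / 2 * b.W ≤ T l - T k := by linarith [k2.2, l2.1]
    nlinarith [mul_le_mul_of_nonneg_left this hs, k3.1, l3.2]
  · obtain ⟨k, hk, k1, k2, k3⟩ := corner 0 0 le_rfl (by norm_num) le_rfl (by norm_num)
    obtain ⟨l, hl, l1, l2, l3⟩ := corner (3 / 4) (3 / 4) (by norm_num) le_rfl (by norm_num) le_rfl
    refine ⟨k, hk, l, hl, hM.trans k1, hM.trans l1, by linarith [k2.2, l2.1], ?_⟩
    rw [abs_of_nonpos hs]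
    refine le_trans ?_ (le_abs_self _)
    have : ρ / 2 * b.W ≤ T l - T k := by linarith [k2.2, l2.1]
    nlinarith [mul_le_mul_of_nonneg_left this (neg_nonneg.2 hs), k3.2, l3.1]

theorem pass_mem (h : Sampling S m γ ρ N b cnt T Y V M) {k : ℕ} (hk : k < cnt)
    (hp : (1 - γ) * M ≤ V k) : (T k, Y k) ∈ S ((1 - γ) * ((1 - γ / 4) * m)) := by
  have h1 : (1 - γ) * ((1 - γ / 4) * m) ≤ (1 - γ) * M :=
    mul_le_mul_of_nonneg_left h.M_ge (by linarith [h.γ_lt])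
  have h2 : 0 < (1 - γ) * M := mul_pos (by linarith [h.γ_lt]) h.M_pos
  exact h.fam.anti _ _ (h1.trans hp) (h.val_mem k hk (h2.trans_le hp))

/-- The new box is fat.  The passing samples with the smallest and the largest `t` are `(ta, ya)`
and `(tb, yb)`; `σ'` is the slope of the line through them; `c` and `d` are the smallest and the
largest value of `y - σ' * t` on passing samples.

The level set is contained in the new box by `near_pass`.  The core of the new box is a box in the
triangle whose base joins the two extreme samples and whose apex is a sample with an extreme value
of `y - σ' * t`; it is moved towards a sample with the largest value, since the passing samples
themselves lie slightly outside the level set. -/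
theorem fat (h : Sampling S m γ ρ N b cnt T Y V M) {ta ya tb yb σ' c d : ℝ}
    (ha : ∃ k < cnt, (1 - γ) * M ≤ V k ∧ T k = ta ∧ Y k = ya)
    (hb : ∃ k < cnt, (1 - γ) * M ≤ V k ∧ T k = tb ∧ Y k = yb)
    (hab : ∀ k < cnt, (1 - γ) * M ≤ V k → ta ≤ T k ∧ T k ≤ tb)
    (hσ' : σ' = (yb - ya) / (tb - ta))
    (hc : ∃ k < cnt, (1 - γ) * M ≤ V k ∧ Y k - σ' * T k = c)
    (hd : ∃ k < cnt, (1 - γ) * M ≤ V k ∧ Y k - σ' * T k = d)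
    (hcd : ∀ k < cnt, (1 - γ) * M ≤ V k → c ≤ Y k - σ' * T k ∧ Y k - σ' * T k ≤ d) :
    SBox.Fat ⟨ta - ρ / 4 * b.W, tb - ta + 2 * (ρ / 4 * b.W), σ',
      c - ρ / 4 * (b.U + |σ' - b.σ| * b.W),
      d - c + 2 * (ρ / 4 * (b.U + |σ' - b.σ| * b.W))⟩ (1 / 16) (S ((1 - γ) * m)) := by
  have hρ := h.ρ_pos
  have hW := h.W_pos
  have hU := h.U_pos
  have hγ := h.γ_pos
  have hγ1 := h.γ_lt
  obtain ⟨k, hk, l, hl, kp, lp, hT, hY⟩ := h.far_pass σ'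
  have hρW := mul_pos hρ hW
  have hsW : 0 ≤ |σ' - b.σ| * b.W := mul_nonneg (abs_nonneg _) hW.le
  have hLt : ρ / 2 * b.W ≤ tb - ta := by linarith [(hab k hk kp).1, (hab l hl lp).2]
  have hcd' : ρ / 2 * (b.U + |σ' - b.σ| * b.W) ≤ d - c := by
    refine hY.trans (abs_le.2 ⟨?_, ?_⟩) <;>
      linarith [(hcd k hk kp).1, (hcd k hk kp).2, (hcd l hl lp).1, (hcd l hl lp).2]
  have hLt0 : 0 < tb - ta := by linarith
  have hcd0 : 0 < d - c := by nlinarith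
  have heu : 0 ≤ ρ / 4 * (b.U + |σ' - b.σ| * b.W) := by positivity
  -- the extreme samples have the same sheared coordinate
  have hu : yb - σ' * tb = ya - σ' * ta := by
    rw [hσ']; field_simp; ring
  refine ⟨?_, ?_, ?_, ?_⟩
  · simp only; linarith
  · simp only; linarith
  · intro z hz
    obtain ⟨j, hj, jp, j1, j2⟩ := h.near_pass hz
    have e1 := hab j hj jp
    have e2 := hcd j hj jp
    have e3 : |(z.2 - σ' * z.1) - (Y j - σ' * T j)| ≤ ρ / 4 * (b.U + |σ' - b.σ| * b.W) := by
      have : (z.2 - σ' * z.1) - (Y j - σ' * T j)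
          = ((z.2 - b.σ * z.1) - (Y j - b.σ * T j)) - (σ' - b.σ) * (z.1 - T j) := by ring
      rw [this]
      refine (abs_sub _ _).trans ?_
      rw [abs_mul]
      nlinarith [mul_le_mul_of_nonneg_left j1 (abs_nonneg (σ' - b.σ))]
    rw [abs_le] at j1 e3
    refine ⟨⟨?_, ?_⟩, ?_, ?_⟩ <;> simp only <;>
      linarith [e1.1, e1.2, e2.1, e2.2, e3.1, e3.2, j1.1, j1.2]
  · obtain ⟨ka, hka, pa, rfl, rfl⟩ := ha
    obtain ⟨kb, hkb, pb, rfl, rfl⟩ := hb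
    have ma := h.pass_mem hka pa
    have mb := h.pass_mem hkb pb
    have hua := hcd ka hka pa
    set ua := Y ka - σ' * T ka with hua_def
    -- an apex whose sheared coordinate differs from that of the base by half the extent
    obtain ⟨kg, hkg, pg, hg⟩ : ∃ kg < cnt, (1 - γ) * M ≤ V kg ∧
        (d - c) / 2 ≤ |(Y kg - σ' * T kg) - ua| := by
      rcases le_total (d - ua) (ua - c) with hle | hle
      · obtain ⟨kc, hkc, pc, ec⟩ := hc
        exact ⟨kc, hkc, pc, by rw [ec, abs_of_nonpos (by linarith)]; linarith⟩
      · obtain ⟨kd, hkd, pd, ed⟩ := hd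
        exact ⟨kd, hkd, pd, by rw [ed, abs_of_nonneg (by linarith)]; linarith⟩
    have mg := h.pass_mem hkg pg
    have htg := hab kg hkg pg
    set ug := Y kg - σ' * T kg with hug_def
    set c₁ := (1 - γ) * ((1 - γ / 4) * m)
    have htri : ∀ t l, 0 ≤ l → l ≤ 1 / 2 → (T ka + T kg) / 2 ≤ t → t ≤ (T kb + T kg) / 2 →
        (t, ua + l * (ug - ua) + σ' * t) ∈ S c₁ := by
      intro t l hl0 hl1 ht1 ht2
      have hl' : 0 < 1 - l := by linarith
      obtain ⟨p, q, hp, hq, hpq, hx⟩ := exists_combo (x := (t - l * T kg) / (1 - l))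
        (x₁ := T ka) (x₂ := T kb) (by rw [le_div_iff₀ hl']; nlinarith)
        (by rw [div_le_iff₀ hl']; nlinarith)
      have m1 := h.fam.combo _ _ p q _ _ ma mb hp hq hpq
      rw [← add_mul, hpq, one_mul] at m1
      have m2 := h.fam.combo _ _ (1 - l) l _ _ m1 mg hl'.le hl0 (by ring)
      rw [← add_mul, sub_add_cancel, one_mul] at m2
      convert m2 using 1
      simp only
      have ht : t = (1 - l) * (p * T ka + q * T kb) + l * T kg := by
        rw [← hx]; field_simp; ring
      congr 1
      have eb : Y kb = ua + σ' * T kb := by linarith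
      have eg : Y kg = ug + σ' * T kg := by rw [hug_def]; ring
      have ea : Y ka = ua + σ' * T ka := by rw [hua_def]; ring
      rw [eb, eg, ea, ht]
      linear_combination -(1 - l) * ua * hpq
    have hcore : SBox.Core ⟨T ka - ρ / 4 * b.W, T kb - T ka + 2 * (ρ / 4 * b.W), σ',
        c - ρ / 4 * (b.U + |σ' - b.σ| * b.W),
        d - c + 2 * (ρ / 4 * (b.U + |σ' - b.σ| * b.W))⟩ (1 / 8) (S c₁) := by
      have hne : ug - ua ≠ 0 := by
        intro h0; rw [h0, abs_zero] at hg; linarith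
      refine ⟨(T ka + T kg) / 2, min ua ((ua + ug) / 2), fun t u h1 h2 h3 h4 => ?_⟩
      simp only at h2 h4 ⊢
      have key := htri t ((u - ua) / (ug - ua))
      rw [div_mul_cancel₀ _ hne, add_sub_cancel] at key
      refine key ?_ ?_ h1 (by linarith)
      · rcases lt_or_gt_of_ne hne with hlt | hgt
        · rw [abs_of_neg hlt] at hg
          rw [min_eq_right (by linarith)] at h3 h4
          exact div_nonneg_of_nonpos (by linarith) hlt.le
        · rw [abs_of_pos hgt] at hg
          rw [min_eq_left (by linarith)] at h3 h4
          exact div_nonneg (by linarith) hgt.le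
      · rcases lt_or_gt_of_ne hne with hlt | hgt
        · rw [abs_of_neg hlt] at hg
          rw [min_eq_right (by linarith)] at h3 h4
          rw [div_le_iff_of_neg hlt]; linarith
        · rw [abs_of_pos hgt] at hg
          rw [min_eq_left (by linarith)] at h3 h4
          rw [div_le_iff₀ hgt]; linarith
    obtain ⟨kM, hkM, hM⟩ := h.M_eq
    have mM := h.fam.anti _ _ h.M_ge (hM ▸ h.val_mem kM hkM (hM ▸ h.M_pos))
    have := hcore.shrink h.fam mM (r := 1 / 2) (by norm_num) (by norm_num)
    refine this.mono (by norm_num) (by simp only; linarith) (by simp only; linarith)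
      (h.fam.anti _ _ ?_)
    have : (1 - 1 / 2) * ((1 - γ / 4) * m) + 1 / 2 * c₁
        = (1 - γ) * m + (γ / 4 + γ * γ / 8) * m := by simp only [c₁]; ring
    rw [this]
    have := h.m_pos
    have : 0 ≤ (γ / 4 + γ * γ / 8) * m := by positivity
    linarith

end Sampling

/-! ### Convex polygons in a rotated frame -/

/-- A linear inequality that holds at the vertices holds on the polygon. -/
theorem polygonRegion_le {n : ℕ} {p : Fin n → Plane} {A B c : ℝ}
    (h : ∀ i, A * p i 0 + B * p i 1 ≤ c) {q : Plane} (hq : q ∈ polygonRegion p) :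
    A * q 0 + B * q 1 ≤ c := by
  have hconv : Convex ℝ {q : Plane | A * q 0 + B * q 1 ≤ c} := by
    intro x hx y hy a b ha hb hab
    simp only [Set.mem_ofPred_eq, PiLp.add_apply, PiLp.smul_apply, smul_eq_mul] at *
    have h1 := mul_le_mul_of_nonneg_left hx ha
    have h2 := mul_le_mul_of_nonneg_left hy hb
    have h3 : a * c + b * c = c := by rw [← add_mul, hab, one_mul]
    linarith
  have hsub : polygonRegion p ⊆ {q : Plane | A * q 0 + B * q 1 ≤ c} := by
    refine convexHull_min ?_ hconv
    rintro _ ⟨i, rfl⟩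
    exact h i
  exact hsub hq

theorem polygonRegion_convex {n : ℕ} (p : Fin n → Plane) : Convex ℝ (polygonRegion p) :=
  convex_convexHull ℝ _

theorem mem_polygonRegion {n : ℕ} (p : Fin n → Plane) (i : Fin n) : p i ∈ polygonRegion p :=
  subset_convexHull ℝ _ ⟨i, rfl⟩

/-- The vertex with index `i`, where index `n` stands for the first vertex again. -/
noncomputable def vert {n : ℕ} (p : Fin n → Plane) (i : ℕ) : Plane :=
  if h : i < n then p ⟨i, h⟩ else if h : 0 < n then p ⟨0, h⟩ else 0

/-- The first coordinate of the vertex with index `i` in the frame whose origin is the first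
vertex. -/
noncomputable def vX {n : ℕ} (p : Fin n → Plane) (ψ : ℝ) (i : ℕ) : ℝ :=
  relX (vert p 0) ψ (vert p i)

/-- The second coordinate of the vertex with index `i` in the frame whose origin is the first
vertex. -/
noncomputable def vY {n : ℕ} (p : Fin n → Plane) (ψ : ℝ) (i : ℕ) : ℝ :=
  relY (vert p 0) ψ (vert p i)

theorem vert_of_lt {n : ℕ} (p : Fin n → Plane) {i : ℕ} (h : i < n) : vert p i = p ⟨i, h⟩ :=
  dif_pos h

theorem vert_self {n : ℕ} (p : Fin n → Plane) : vert p n = vert p 0 := by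
  unfold vert
  rcases Nat.eq_zero_or_pos n with rfl | h
  · rfl
  · rw [dif_neg (lt_irrefl n), dif_pos h, dif_pos h]

@[simp] theorem vX_zero {n : ℕ} (p : Fin n → Plane) (ψ : ℝ) : vX p ψ 0 = 0 := by simp [vX, relX]
@[simp] theorem vY_zero {n : ℕ} (p : Fin n → Plane) (ψ : ℝ) : vY p ψ 0 = 0 := by simp [vY, relY]
@[simp] theorem vX_self {n : ℕ} (p : Fin n → Plane) (ψ : ℝ) : vX p ψ n = 0 := by
  rw [vX, vert_self]; exact vX_zero p ψ
@[simp] theorem vY_self {n : ℕ} (p : Fin n → Plane) (ψ : ℝ) : vY p ψ n = 0 := by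
  rw [vY, vert_self]; exact vY_zero p ψ

theorem vert_mem {n : ℕ} (p : Fin n → Plane) (hn : 0 < n) (i : ℕ) :
    vert p i ∈ polygonRegion p := by
  unfold vert
  split_ifs with h
  · exact mem_polygonRegion p _
  · exact mem_polygonRegion p _

theorem framePt_v {n : ℕ} (p : Fin n → Plane) (ψ : ℝ) (i : ℕ) :
    framePt (vert p 0) ψ (vX p ψ i) (vY p ψ i) = vert p i :=
  framePt_rel _ _ _

/-- Twice the signed area of a triangle. -/
def turn (a b c : Plane) : ℝ := (b 0 - a 0) * (c 1 - a 1) - (b 1 - a 1) * (c 0 - a 0)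

theorem turn_rel (o : Plane) (ψ : ℝ) (a b c : Plane) :
    (relX o ψ b - relX o ψ a) * (relY o ψ c - relY o ψ a)
      - (relY o ψ b - relY o ψ a) * (relX o ψ c - relX o ψ a) = turn a b c := by
  have h := Real.sin_sq_add_cos_sq ψ
  simp only [relX, relY, turn]
  linear_combination ((b 0 - a 0) * (c 1 - a 1) - (b 1 - a 1) * (c 0 - a 0)) * h

theorem turn_vert_pos {n : ℕ} {p : Fin n → Plane} (hp : IsConvexPolygon p) {i j k : ℕ}
    (hij : i < j) (hjk : j < k) (hk : k < n) : 0 < turn (vert p i) (vert p j) (vert p k) := by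
  rw [vert_of_lt p (hij.trans (hjk.trans hk)), vert_of_lt p (hjk.trans hk), vert_of_lt p hk]
  exact hp.2 _ _ _ hij hjk

/-- The polygon lies to the left of each of its edges. -/
theorem turn_edge_nonneg {n : ℕ} {p : Fin n → Plane} (hp : IsConvexPolygon p) {i : ℕ} (hi : i < n)
    {q : Plane} (hq : q ∈ polygonRegion p) : 0 ≤ turn (vert p i) (vert p (i + 1)) q := by
  have hvert : ∀ j : Fin n, 0 ≤ turn (vert p i) (vert p (i + 1)) (p j) := by
    intro j
    obtain ⟨j, hj⟩ := j
    rw [← vert_of_lt p hj]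
    rcases Nat.lt_or_ge (i + 1) n with h | h
    · rcases lt_trichotomy j i with h1 | h1 | h1
      · have := turn_vert_pos hp h1 (Nat.lt_succ_self i) h
        simp only [turn] at *; linarith
      · subst h1; simp [turn]
      · rcases Nat.lt_or_ge (i + 1) j with h2 | h2
        · exact (turn_vert_pos hp (Nat.lt_succ_self i) h2 hj).le
        · obtain rfl : j = i + 1 := by omega
          simp only [turn]; apply le_of_eq; ring
    · obtain rfl : n = i + 1 := by omega
      rw [vert_self]
      rcases Nat.eq_zero_or_pos j with h1 | h1
      · subst h1; simp only [turn]; apply le_of_eq; ring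
      · rcases Nat.lt_or_ge j i with h2 | h2
        · have := turn_vert_pos hp h1 h2 hi
          simp only [turn] at *; linarith
        · obtain rfl : j = i := by omega
          simp [turn]
  have := polygonRegion_le (p := p) (A := vert p (i + 1) 1 - vert p i 1)
    (B := -(vert p (i + 1) 0 - vert p i 0))
    (c := (vert p (i + 1) 1 - vert p i 1) * vert p i 0
      - (vert p (i + 1) 0 - vert p i 0) * vert p i 1)
    (fun j => by have := hvert j; simp only [turn] at this; linarith) hq
  simp only [turn]
  linarith

/-- The index of the vertex after vertex `a`, for `0 < a ≤ n`. -/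
def nextIdx (n a : ℕ) : ℕ := if n ≤ a then 1 else a + 1

theorem turn_consecutive_pos {n : ℕ} {p : Fin n → Plane} (hp : IsConvexPolygon p) {a : ℕ}
    (ha : 0 < a) (han : a ≤ n) :
    0 < turn (vert p (a - 1)) (vert p a) (vert p (nextIdx n a)) := by
  have hn := hp.1
  unfold nextIdx
  split_ifs with h
  · obtain rfl : a = n := by omega
    have := turn_vert_pos hp (show 0 < 1 by norm_num) (show 1 < a - 1 by omega)
      (show a - 1 < a by omega)
    rw [vert_self]
    simp only [turn] at *; linarith
  · rcases Nat.lt_or_ge (a + 1) n with h' | h'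
    · exact turn_vert_pos hp (by omega) (by omega) h'
    · obtain rfl : n = a + 1 := by omega
      have := turn_vert_pos hp (show 0 < a - 1 by omega) (show a - 1 < a by omega)
        (show a < a + 1 by omega)
      rw [vert_self]
      simp only [turn] at *; linarith

/-- A vertex that is at least as high as its two neighbours is a highest point of the polygon.
The sign `σ` allows to use this for lowest points, too. -/
theorem le_of_local_max {n : ℕ} {p : Fin n → Plane} (hp : IsConvexPolygon p) {a : ℕ}
    (ha : 0 < a) (han : a ≤ n) {ψ σ : ℝ} (h1 : σ * vY p ψ (a - 1) ≤ σ * vY p ψ a)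
    (h2 : σ * vY p ψ (nextIdx n a) ≤ σ * vY p ψ a) {q : Plane} (hq : q ∈ polygonRegion p) :
    σ * relY (vert p 0) ψ q ≤ σ * vY p ψ a := by
  have hC := turn_consecutive_pos hp ha han
  have e1 := turn_edge_nonneg hp (show a - 1 < n by omega) hq
  rw [Nat.sub_add_cancel ha] at e1
  have e2 : 0 ≤ turn (vert p a) (vert p (nextIdx n a)) q := by
    unfold nextIdx
    split_ifs with h
    · obtain rfl : a = n := by omega
      rw [vert_self]
      exact turn_edge_nonneg hp (show 0 < a by omega) hq
    · exact turn_edge_nonneg hp (show a < n by omega) hq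
  rw [← turn_rel (vert p 0) ψ] at hC e1 e2
  change 0 < (vX p ψ a - vX p ψ (a - 1)) * (vY p ψ (nextIdx n a) - vY p ψ (a - 1))
    - (vY p ψ a - vY p ψ (a - 1)) * (vX p ψ (nextIdx n a) - vX p ψ (a - 1)) at hC
  change 0 ≤ (vX p ψ a - vX p ψ (a - 1)) * (relY (vert p 0) ψ q - vY p ψ (a - 1))
    - (vY p ψ a - vY p ψ (a - 1)) * (relX (vert p 0) ψ q - vX p ψ (a - 1)) at e1
  change 0 ≤ (vX p ψ (nextIdx n a) - vX p ψ a) * (relY (vert p 0) ψ q - vY p ψ a)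
    - (vY p ψ (nextIdx n a) - vY p ψ a) * (relX (vert p 0) ψ q - vX p ψ a) at e2
  generalize vX p ψ (nextIdx n a) = x3 at *
  generalize vY p ψ (nextIdx n a) = y3 at *
  generalize vX p ψ (a - 1) = x1 at *
  generalize vY p ψ (a - 1) = y1 at *
  generalize vX p ψ a = x2 at *
  generalize vY p ψ a = y2 at *
  generalize relX (vert p 0) ψ q = x at *
  generalize relY (vert p 0) ψ q = y at *
  -- the difference vector is a combination of the two edge vectors
  have key : ((x2 - x1) * (y3 - y1) - (y2 - y1) * (x3 - x1)) * (σ * (y - y2)) =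
      ((x2 - x1) * (y - y1) - (y2 - y1) * (x - x1)) * (σ * (y3 - y2))
      - ((x3 - x2) * (y - y2) - (y3 - y2) * (x - x2)) * (σ * (y2 - y1)) := by ring
  have : σ * (y - y2) ≤ 0 := by
    by_contra hneg
    push Not at hneg
    have k1 := mul_pos hC hneg
    have k2 := mul_nonneg e1 (show 0 ≤ -(σ * (y3 - y2)) by linarith)
    have k3 := mul_nonneg e2 (show 0 ≤ σ * (y2 - y1) by linarith)
    linarith
  linarith

/-! ### Horizontal chords -/

/-- The first coordinate of the point at height `t` of the line through two points. -/
noncomputable def crossX (xa ya xb yb t : ℝ) : ℝ := xa + (t - ya) * (xb - xa) / (yb - ya)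

theorem crossX_comm {xa ya xb yb t : ℝ} (h : ya ≠ yb) :
    crossX xa ya xb yb t = crossX xb yb xa ya t := by
  have h1 : yb - ya ≠ 0 := sub_ne_zero.2 h.symm
  have h2 : ya - yb ≠ 0 := sub_ne_zero.2 h
  unfold crossX
  field_simp
  ring

theorem crossX_mem {n : ℕ} (p : Fin n → Plane) (hn : 0 < n) {a b : ℕ} {ψ t : ℝ}
    (h : vY p ψ a ≠ vY p ψ b)
    (hab : (vY p ψ a ≤ t ∧ t ≤ vY p ψ b) ∨ (vY p ψ b ≤ t ∧ t ≤ vY p ψ a)) :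
    framePt (vert p 0) ψ (crossX (vX p ψ a) (vY p ψ a) (vX p ψ b) (vY p ψ b) t) t
      ∈ polygonRegion p := by
  wlog hle : vY p ψ a ≤ vY p ψ b generalizing a b
  · rw [crossX_comm h]
    exact this h.symm hab.symm (not_le.1 hle).le
  have hlt : vY p ψ a < vY p ψ b := lt_of_le_of_ne hle h
  have ht : vY p ψ a ≤ t ∧ t ≤ vY p ψ b := by
    rcases hab with h1 | h1
    · exact h1
    · constructor <;> linarith [h1.1, h1.2]
  obtain ⟨r, s, hr, hs, hrs, he⟩ := exists_combo ht.1 ht.2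
  have hd : vY p ψ b - vY p ψ a ≠ 0 := by linarith
  have hc : crossX (vX p ψ a) (vY p ψ a) (vX p ψ b) (vY p ψ b) t = r * vX p ψ a + s * vX p ψ b := by
    have hr' : r = 1 - s := by linarith
    unfold crossX
    rw [he, hr']
    field_simp
    ring
  rw [hc, he, framePt_combo _ _ hrs, framePt_v, framePt_v]
  exact polygonRegion_convex p (vert_mem p hn a) (vert_mem p hn b) hr hs hrs

/-- An edge going up bounds the polygon on the right. -/
theorem le_crossX {n : ℕ} {p : Fin n → Plane} (hp : IsConvexPolygon p) {i : ℕ} (hi : i < n)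
    {ψ t x : ℝ} (hup : vY p ψ i < vY p ψ (i + 1))
    (hx : framePt (vert p 0) ψ x t ∈ polygonRegion p) :
    x ≤ crossX (vX p ψ i) (vY p ψ i) (vX p ψ (i + 1)) (vY p ψ (i + 1)) t := by
  have h := turn_edge_nonneg hp hi hx
  rw [← turn_rel (vert p 0) ψ, relX_framePt, relY_framePt] at h
  change 0 ≤ (vX p ψ (i + 1) - vX p ψ i) * (t - vY p ψ i)
    - (vY p ψ (i + 1) - vY p ψ i) * (x - vX p ψ i) at h
  unfold crossX
  rw [← sub_le_iff_le_add', le_div_iff₀ (by linarith)]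
  linarith

/-- An edge going down bounds the polygon on the left. -/
theorem crossX_le {n : ℕ} {p : Fin n → Plane} (hp : IsConvexPolygon p) {i : ℕ} (hi : i < n)
    {ψ t x : ℝ} (hdn : vY p ψ (i + 1) < vY p ψ i)
    (hx : framePt (vert p 0) ψ x t ∈ polygonRegion p) :
    crossX (vX p ψ i) (vY p ψ i) (vX p ψ (i + 1)) (vY p ψ (i + 1)) t ≤ x := by
  have h := turn_edge_nonneg hp hi hx
  rw [← turn_rel (vert p 0) ψ, relX_framePt, relY_framePt] at h
  change 0 ≤ (vX p ψ (i + 1) - vX p ψ i) * (t - vY p ψ i)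
    - (vY p ψ (i + 1) - vY p ψ i) * (x - vX p ψ i) at h
  unfold crossX
  rw [← le_sub_iff_add_le', div_le_iff_of_neg (by linarith)]
  linarith

/-- `[L, R]` is the intersection of the polygon with the horizontal line at height `t` of the
frame with angle `ψ`. -/
def IsChord {n : ℕ} (p : Fin n → Plane) (ψ t L R : ℝ) : Prop :=
  framePt (vert p 0) ψ L t ∈ polygonRegion p ∧ framePt (vert p 0) ψ R t ∈ polygonRegion p ∧
    ∀ x, framePt (vert p 0) ψ x t ∈ polygonRegion p → L ≤ x ∧ x ≤ R

/-- The two edges of the boundary that cross the height `t`, in either orientation, determine the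
chord.  Vertices `A, B` are adjacent in the cyclic order, and so are `A', B'`; the first edge has
its end above `t` (in the direction given by `σ`) after its other end, the second edge before. -/
theorem isChord_of_edges {n : ℕ} {p : Fin n → Plane} (hp : IsConvexPolygon p) {A B' : ℕ}
    {ψ t σ : ℝ} (hσ : σ = 1 ∨ σ = -1) (hA : A + 1 ≤ n) (hB' : B' + 1 ≤ n)
    (h1 : σ * (vY p ψ A - t) ≤ 0) (h2 : 0 < σ * (vY p ψ (A + 1) - t))
    (h3 : 0 < σ * (vY p ψ B' - t)) (h4 : σ * (vY p ψ (B' + 1) - t) ≤ 0) :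
    let u := crossX (vX p ψ A) (vY p ψ A) (vX p ψ (A + 1)) (vY p ψ (A + 1)) t
    let v := crossX (vX p ψ (B' + 1)) (vY p ψ (B' + 1)) (vX p ψ B') (vY p ψ B') t
    IsChord p ψ t (min u v) (max u v) := by
  intro u v
  have hn : 0 < n := by have := hp.1; omega
  rcases hσ with rfl | rfl
  · have n1 : vY p ψ A < vY p ψ (A + 1) := by linarith
    have n2 : vY p ψ (B' + 1) < vY p ψ B' := by linarith
    have mu : framePt (vert p 0) ψ u t ∈ polygonRegion p :=
      crossX_mem p hn n1.ne (Or.inl ⟨by linarith, by linarith⟩)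
    have mv : framePt (vert p 0) ψ v t ∈ polygonRegion p :=
      crossX_mem p hn n2.ne (Or.inl ⟨by linarith, by linarith⟩)
    have hR : ∀ x, framePt (vert p 0) ψ x t ∈ polygonRegion p → x ≤ u := fun x hx =>
      le_crossX hp (by omega) n1 hx
    have hL : ∀ x, framePt (vert p 0) ψ x t ∈ polygonRegion p → v ≤ x := fun x hx => by
      have := crossX_le hp (show B' < n by omega) n2 hx
      rwa [crossX_comm n2.ne'] at this
    have huv : v ≤ u := hL u mu
    rw [min_eq_right huv, max_eq_left huv]
    exact ⟨mv, mu, fun x hx => ⟨hL x hx, hR x hx⟩⟩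
  · have n1 : vY p ψ (A + 1) < vY p ψ A := by linarith
    have n2 : vY p ψ B' < vY p ψ (B' + 1) := by linarith
    have mu : framePt (vert p 0) ψ u t ∈ polygonRegion p :=
      crossX_mem p hn n1.ne' (Or.inr ⟨by linarith, by linarith⟩)
    have mv : framePt (vert p 0) ψ v t ∈ polygonRegion p :=
      crossX_mem p hn n2.ne' (Or.inr ⟨by linarith, by linarith⟩)
    have hL : ∀ x, framePt (vert p 0) ψ x t ∈ polygonRegion p → u ≤ x := fun x hx =>
      crossX_le hp (by omega) n1 hx
    have hR : ∀ x, framePt (vert p 0) ψ x t ∈ polygonRegion p → x ≤ v := fun x hx => by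
      have := le_crossX hp (show B' < n by omega) n2 hx
      rwa [crossX_comm n2.ne] at this
    have huv : u ≤ v := hL v mv
    rw [min_eq_left huv, max_eq_right huv]
    exact ⟨mu, mv, fun x hx => ⟨hL x hx, hR x hx⟩⟩

theorem fits_of_chords {n : ℕ} {p : Fin n → Plane} {ψ y₁ y₂ L₁ R₁ L₂ R₂ : ℝ}
    (h₁ : IsChord p ψ y₁ L₁ R₁) (h₂ : IsChord p ψ y₂ L₂ R₂) (hy : y₁ ≤ y₂)
    (hx : max L₁ L₂ ≤ min R₁ R₂) :
    Fits (polygonRegion p) (vert p 0) ψ (max L₁ L₂) (min R₁ R₂) y₁ y₂ := by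
  have hP := polygonRegion_convex p
  refine ⟨hx, hy, ?_, ?_, ?_, ?_⟩
  · exact framePt_mem_of_between_x hP h₁.1 h₁.2.1 (le_max_left _ _) (hx.trans (min_le_left _ _))
  · exact framePt_mem_of_between_x hP h₂.1 h₂.2.1 (le_max_right _ _) (hx.trans (min_le_right _ _))
  · exact framePt_mem_of_between_x hP h₁.1 h₁.2.1 ((le_max_left _ _).trans hx) (min_le_left _ _)
  · exact framePt_mem_of_between_x hP h₂.1 h₂.2.1 ((le_max_right _ _).trans hx) (min_le_right _ _)

theorem le_sqrt_of_mem_lev {n : ℕ} {p : Fin n → Plane} {ψ y₁ y₂ L₁ R₁ L₂ R₂ c : ℝ}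
    (h₁ : IsChord p ψ y₁ L₁ R₁) (h₂ : IsChord p ψ y₂ L₂ R₂)
    (h : (y₁, y₂) ∈ Lev (polygonRegion p) (vert p 0) ψ c) :
    y₁ ≤ y₂ ∧ max L₁ L₂ ≤ min R₁ R₂ ∧ c ≤ √((min R₁ R₂ - max L₁ L₂) * (y₂ - y₁)) := by
  obtain ⟨x₁, x₂, ⟨hx, hy, h11, h12, h21, h22⟩, hc⟩ := h
  simp only at hy h11 h12 h21 h22 hc
  have hl : max L₁ L₂ ≤ x₁ := max_le (h₁.2.2 _ h11).1 (h₂.2.2 _ h12).1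
  have hr : x₂ ≤ min R₁ R₂ := le_min (h₁.2.2 _ h21).2 (h₂.2.2 _ h22).2
  refine ⟨hy, by linarith, hc.trans (Real.sqrt_le_sqrt ?_)⟩
  exact mul_le_mul_of_nonneg_right (by linarith) (by linarith)

namespace RealRAM

/-! ### Running times with a logarithmic factor -/

theorem Runs.seq_bound {c d : Prog} {s : State} {L : ℕ} {Q Q' : State → Prop}
    (h : Runs c s (c.bound * L) Q) (h' : ∀ s', Q s' → Runs d s' (d.bound * L) Q') :
    Runs (c ;; d) s ((c ;; d).bound * L) Q' :=
  (h.seq h').mono (le_of_eq (add_mul _ _ _).symm) fun _ h => h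

theorem Runs.ite_bound {b : Test} {c d : Prog} {s : State} {L : ℕ} {Q : State → Prop} (hL : 1 ≤ L)
    (h : b.Holds s → Runs c s (c.bound * L) Q) (h' : ¬ b.Holds s → Runs d s (d.bound * L) Q) :
    Runs (.ite b c d) s ((Prog.ite b c d).bound * L) Q := by
  have hle : b.cost + (c.bound + d.bound) * L + 1 ≤ (b.cost + (c.bound + d.bound) + 1) * L := by
    nlinarith
  refine (Runs.ite (B := (c.bound + d.bound) * L) (fun hb => ?_) fun hb => ?_).mono hle fun _ h => h
  · exact (h hb).mono (Nat.mul_le_mul_right L (Nat.le_add_right _ _)) fun _ h => h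
  · exact (h' hb).mono (Nat.mul_le_mul_right L (Nat.le_add_left _ _)) fun _ h => h

theorem Runs.straight_mul {c : Prog} {L : ℕ} (hL : 1 ≤ L) (s : State)
    (hc : c.straight = true := by rfl) :
    Runs c s (c.bound * L) (fun s' => s' = c.den s ∧ Frame c s s') :=
  (Runs.straight_frame s hc).mono (Nat.le_mul_of_pos_right _ hL) fun _ h => h

theorem Runs.weaken {c : Prog} {s : State} {C C' L : ℕ} {Q Q' : State → Prop}
    (h : Runs c s (C * L) Q) (hC : C ≤ C') (hQ : ∀ s', Q s' → Q' s') : Runs c s (C' * L) Q' :=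
  h.mono (Nat.mul_le_mul_right L hC) hQ

/-! ### Binary search -/

/-- Binary search between the indices in the natural registers `11` and `12`, in either order.
The program `step` tests the index in register `10` and moves it to register `11` or `12`. -/
def search (step : Prog) : Prog :=
  .loop (.natLE (nc 2) ((nr 11 - nr 12) + (nr 12 - nr 11)))
    (.setNat 10 (.half (nr 11 + nr 12)) ;; step)

/-- If `Q` holds at the first bound and fails at the second one, then binary search ends with two
adjacent indices of this kind.  Nothing is assumed about the values of `Q` in between. -/
theorem search_runs {step : Prog} {n : ℕ} (I : State → Prop) (Q : ℕ → Prop) {a b : ℕ}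
    (ha : a ≤ n) (hb : b ≤ n) (hab : a ≠ b) (hQa : Q a) (hQb : ¬ Q b)
    (hset : ∀ s m, I s → I { s with nreg := Function.update s.nreg 10 m })
    (hstep : ∀ s, I s → (min a b < s.nreg 10 ∧ s.nreg 10 < max a b) →
      Runs step s step.bound (fun s' => I s' ∧
      ((Q (s.nreg 10) ∧ s'.nreg 11 = s.nreg 10 ∧ s'.nreg 12 = s.nreg 12) ∨
        (¬ Q (s.nreg 10) ∧ s'.nreg 11 = s.nreg 11 ∧ s'.nreg 12 = s.nreg 10))))
    {s : State} (hI : I s) (hsa : s.nreg 11 = a) (hsb : s.nreg 12 = b) :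
    Runs (search step) s ((search step).bound * (Nat.clog 2 n + 1)) (fun s' => I s' ∧
      Q (s'.nreg 11) ∧ ¬ Q (s'.nreg 12) ∧
      ((a < b ∧ a ≤ s'.nreg 11 ∧ s'.nreg 12 = s'.nreg 11 + 1 ∧ s'.nreg 12 ≤ b) ∨
        (b < a ∧ b ≤ s'.nreg 12 ∧ s'.nreg 11 = s'.nreg 12 + 1 ∧ s'.nreg 11 ≤ a))) := by
  let J : State → Prop := fun s' => I s' ∧ Q (s'.nreg 11) ∧ ¬ Q (s'.nreg 12) ∧
      ((a < b ∧ a ≤ s'.nreg 11 ∧ s'.nreg 11 < s'.nreg 12 ∧ s'.nreg 12 ≤ b) ∨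
        (b < a ∧ b ≤ s'.nreg 12 ∧ s'.nreg 12 < s'.nreg 11 ∧ s'.nreg 11 ≤ a))
  let μ : State → ℕ := fun s' => Nat.clog 2 ((s'.nreg 11 - s'.nreg 12) + (s'.nreg 12 - s'.nreg 11))
  have hJ : J s := ⟨hI, hsa ▸ hQa, hsb ▸ hQb, by omega⟩
  have hloop := Runs.loop (b := .natLE (nc 2) ((nr 11 - nr 12) + (nr 12 - nr 11)))
    (c := .setNat 10 (.half (nr 11 + nr 12)) ;; step) (B := 5 + step.bound) J μ ?_ hJ
  · refine hloop.mono ?_ ?_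
    · have h1 : μ s ≤ Nat.clog 2 n := Nat.clog_mono_right 2 (by omega)
      have h2 : (Test.natLE (nc 2) ((nr 11 - nr 12) + (nr 12 - nr 11))).cost = 9 := rfl
      have h3 : (search step).bound = 5 + step.bound + 30 := rfl
      rw [h2, h3]
      nlinarith
    · rintro s' ⟨⟨h1, h2, h3, h4⟩, h5⟩
      simp only [Test.Holds, NatExpr.eval, NatExpr.eval_sub'] at h5
      exact ⟨h1, h2, h3, by omega⟩
  · rintro s ⟨h1, h2, h3, h4⟩ hb
    simp only [Test.Holds, NatExpr.eval, NatExpr.eval_sub'] at hb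
    obtain ⟨m, hm⟩ : ∃ m, m = (s.nreg 11 + s.nreg 12) / 2 := ⟨_, rfl⟩
    have hset' : Runs (.setNat 10 (.half (nr 11 + nr 12))) s 5
        (fun s' => s' = { s with nreg := Function.update s.nreg 10 m }) := by
      refine ⟨_, _, .setNat s 10 _, le_of_eq rfl, ?_⟩
      simp [hm]
    refine hset'.seq fun s' hs' => ?_
    subst hs'
    refine (hstep _ (hset s m h1) ?_).mono le_rfl ?_
    · simp only [Function.update_self]; omega
    · rintro s' ⟨k1, k2⟩
      simp at k2
      have hd : ∀ x y : ℕ, 2 ≤ y → x ≤ (y + 1) / 2 → Nat.clog 2 x < Nat.clog 2 y := by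
        intro x y hy hxy
        rw [Nat.clog_of_two_le (by norm_num) hy]
        exact Nat.lt_succ_of_le (Nat.clog_mono_right 2 hxy)
      rcases k2 with ⟨q, e1, e2⟩ | ⟨q, e1, e2⟩
      · refine ⟨⟨k1, e1 ▸ q, e2 ▸ h3, by omega⟩, hd _ _ hb ?_⟩
        omega
      · refine ⟨⟨k1, e1 ▸ h2, e2 ▸ q, by omega⟩, hd _ _ hb ?_⟩
        omega

/-! ### Access to the vertices of a row -/

/-- The registers and arrays are set up for the frame with angle `ψ`: the vertices, in absolute
coordinates of this frame, start at the index in the natural register `4`, and the real registers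
`20` and `21` hold those of the first vertex. -/
structure RowEnv {n : ℕ} (p : Fin n → Plane) (ψ : ℝ) (s : State) : Prop where
  hn : s.nreg 0 = n
  hX : ∀ i < n, s.rarr 4 (s.nreg 4 + i) - s.rreg 20 = vX p ψ i
  hY : ∀ i < n, s.rarr 5 (s.nreg 4 + i) - s.rreg 21 = vY p ψ i

theorem RowEnv.congr {n : ℕ} {p : Fin n → Plane} {ψ : ℝ} {s s' : State} (h : RowEnv p ψ s)
    (h0 : s'.nreg 0 = s.nreg 0) (h4 : s'.nreg 4 = s.nreg 4) (h20 : s'.rreg 20 = s.rreg 20)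
    (h21 : s'.rreg 21 = s.rreg 21) (a4 : s'.rarr 4 = s.rarr 4) (a5 : s'.rarr 5 = s.rarr 5) :
    RowEnv p ψ s' := by
  refine ⟨h0.trans h.hn, fun i hi => ?_, fun i hi => ?_⟩
  · rw [a4, h4, h20]; exact h.hX i hi
  · rw [a5, h4, h21]; exact h.hY i hi

theorem RowEnv.frame {n : ℕ} {p : Fin n → Plane} {ψ : ℝ} {s s' : State} {c : Prog}
    (h : RowEnv p ψ s) (hf : Frame c s s') (h0 : c.wNat 0 = false := by rfl)
    (h4 : c.wNat 4 = false := by rfl) (h20 : c.wReal 20 = false := by rfl)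
    (h21 : c.wReal 21 = false := by rfl) (a4 : c.wRealArr 4 = false := by rfl)
    (a5 : c.wRealArr 5 = false := by rfl) : RowEnv p ψ s' :=
  h.congr (hf.nreg 0 h0) (hf.nreg 4 h4) (hf.rreg 20 h20) (hf.rreg 21 h21) (hf.rarr 4 a4)
    (hf.rarr 5 a5)

/-- Load the coordinates of the vertex with the index in the natural register `10`, relative to
the first vertex, into the real registers `22` and `23`. -/
def loadV : Prog :=
  .ite (.natLE (nr 0) (nr 10)) (.setReal 22 (rc 0) ;; .setReal 23 (rc 0))
    (.setReal 22 (.load 4 (nr 4 + nr 10) - rr 20) ;; .setReal 23 (.load 5 (nr 4 + nr 10) - rr 21))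

theorem loadV_runs {n : ℕ} {p : Fin n → Plane} {ψ : ℝ} {s : State} {L : ℕ} (hL : 1 ≤ L)
    (h : RowEnv p ψ s) (hi : s.nreg 10 ≤ n) :
    Runs loadV s (loadV.bound * L) (fun s' => s'.rreg 22 = vX p ψ (s.nreg 10) ∧
      s'.rreg 23 = vY p ψ (s.nreg 10) ∧ Frame loadV s s') := by
  refine (Runs.straight_mul hL s).weaken le_rfl ?_
  rintro s' ⟨rfl, hf⟩
  refine ⟨?_, ?_, hf⟩
  · rcases hi.eq_or_lt with e | e
    · simp [loadV, h.hn, e]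
    · simp [loadV, h.hn, not_le.2 e, ← h.hX _ e]
  · rcases hi.eq_or_lt with e | e
    · simp [loadV, h.hn, e]
    · simp [loadV, h.hn, not_le.2 e, ← h.hY _ e]

/-! ### Search for an extreme vertex -/

/-- Accept the tested index as the new first bound. -/
def setA : Prog := .setNat 11 (nr 10)
/-- Accept the tested index as the new second bound. -/
def setB : Prog := .setNat 12 (nr 10)

/-- One step of the search for a vertex of extreme height. -/
def apexStep : Prog :=
  loadV ;; .setReal 27 (rr 24 * rr 23) ;; .setNat 10 (nr 10 + nc 1) ;; loadV ;;
  .setReal 28 (rr 24 * rr 23) ;; .setNat 10 (nr 10 - nc 1) ;;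
  .ite (.realLE (rr 28) (rr 27))
    (.ite (.realLE (rr 26) (rc 0)) (.ite (.realLE (rr 27) (rc 0)) setA setB) setB)
    (.ite (.realLE (rr 26) (rc 0)) setA (.ite (.realLE (rc 0) (rr 27)) setA setB))

/-- Find the index of a highest vertex (if the real register `24` holds `1`) or of a lowest vertex
(if it holds `-1`); the result is in the natural register `12`. -/
def apex : Prog :=
  .setNat 10 (nc 1) ;; loadV ;; .setReal 26 (rr 24 * rr 23) ;; .setNat 11 (nc 0) ;;
  .setNat 12 (nr 0) ;; search apexStep

/-- The search criterion for a maximum of `y` on the cyclic sequence `y 0, …, y n` with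
`y n = y 0 = 0`: it compares neighbours, and it uses the sign of `y 1` in order to tell the last
part of the sequence from the first one. -/
def ApexQ (n : ℕ) (y : ℕ → ℝ) (i : ℕ) : Prop :=
  i < n ∧ ((y 1 ≤ 0 ∧ (y i < y (i + 1) ∨ y i ≤ 0)) ∨ (0 < y 1 ∧ y i < y (i + 1) ∧ 0 ≤ y i))

theorem apexStep_runs {n : ℕ} {p : Fin n → Plane} {ψ σ : ℝ} {s : State} {L : ℕ} (hL : 1 ≤ L)
    (h : RowEnv p ψ s) (h24 : s.rreg 24 = σ) (h26 : s.rreg 26 = σ * vY p ψ 1)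
    (hi : s.nreg 10 < n) :
    Runs apexStep s (apexStep.bound * L) (fun s' =>
      (RowEnv p ψ s' ∧ s'.rreg 24 = σ ∧ s'.rreg 26 = σ * vY p ψ 1) ∧
      ((ApexQ n (fun i => σ * vY p ψ i) (s.nreg 10) ∧ s'.nreg 11 = s.nreg 10 ∧
          s'.nreg 12 = s.nreg 12) ∨
        (¬ ApexQ n (fun i => σ * vY p ψ i) (s.nreg 10) ∧ s'.nreg 11 = s.nreg 11 ∧
          s'.nreg 12 = s.nreg 10))) := by
  have hstep : Runs apexStep s (apexStep.bound * L) (fun s' =>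
      (ApexQ n (fun i => σ * vY p ψ i) (s.nreg 10) ∧ s'.nreg 11 = s.nreg 10 ∧
          s'.nreg 12 = s.nreg 12) ∨
        (¬ ApexQ n (fun i => σ * vY p ψ i) (s.nreg 10) ∧ s'.nreg 11 = s.nreg 11 ∧
          s'.nreg 12 = s.nreg 10)) := by
    refine (loadV_runs hL h hi.le).seq_bound ?_
    rintro s1 ⟨-, e1, f1⟩
    refine (Runs.straight_mul hL s1).seq_bound ?_
    rintro s2 ⟨e2, f2⟩
    refine (Runs.straight_mul hL s2).seq_bound ?_
    rintro s3 ⟨e3, f3⟩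
    have i3 : s3.nreg 10 = s.nreg 10 + 1 := by
      rw [e3]; simp [f2.nreg 10, f1.nreg 10]
    refine (loadV_runs hL (((h.frame f1).frame f2).frame f3) (by omega)).seq_bound ?_
    rintro s4 ⟨-, e4, f4⟩
    refine (Runs.straight_mul (c := .setReal 28 (rr 24 * rr 23) ;; .setNat 10 (nr 10 - nc 1) ;;
      .ite (.realLE (rr 28) (rr 27))
        (.ite (.realLE (rr 26) (rc 0)) (.ite (.realLE (rr 27) (rc 0)) setA setB) setB)
        (.ite (.realLE (rr 26) (rc 0)) setA (.ite (.realLE (rc 0) (rr 27)) setA setB))) hL s4).weaken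
      le_rfl ?_
    rintro s5 ⟨e5, -⟩
    have g27 : s4.rreg 27 = σ * vY p ψ (s.nreg 10) := by
      rw [f4.rreg 27, f3.rreg 27, e2]
      simp [e1, f1.rreg 24, h24]
    have g24 : s4.rreg 24 = σ := by
      rw [f4.rreg 24, f3.rreg 24, f2.rreg 24, f1.rreg 24, h24]
    have g26 : s4.rreg 26 = σ * vY p ψ 1 := by
      rw [f4.rreg 26, f3.rreg 26, f2.rreg 26, f1.rreg 26, h26]
    have g10 : s4.nreg 10 = s.nreg 10 + 1 := by rw [f4.nreg 10, i3]
    have g11 : s4.nreg 11 = s.nreg 11 := by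
      rw [f4.nreg 11, f3.nreg 11, f2.nreg 11, f1.nreg 11]
    have g12 : s4.nreg 12 = s.nreg 12 := by
      rw [f4.nreg 12, f3.nreg 12, f2.nreg 12, f1.nreg 12]
    rw [i3] at e4
    subst e5
    generalize s.nreg 10 = i at *
    by_cases c1 : σ * vY p ψ (i + 1) ≤ σ * vY p ψ i <;>
    by_cases c2 : σ * vY p ψ 1 ≤ 0 <;>
    by_cases c3 : σ * vY p ψ i ≤ 0 <;>
    by_cases c4 : 0 ≤ σ * vY p ψ i <;>
    simp [setA, setB, e4, g24, g26, g27, g10, g11, g12, ApexQ, c1, c2, c3, c4, hi, not_lt.2,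
      lt_of_not_ge]
  refine hstep.frame.weaken (le_of_eq rfl) ?_
  rintro s' ⟨hs', hf⟩
  exact ⟨⟨h.frame hf, (hf.rreg 24).trans h24, (hf.rreg 26).trans h26⟩, hs'⟩

theorem apex_runs {n : ℕ} {p : Fin n → Plane} (hp : IsConvexPolygon p) {ψ σ : ℝ}
    {s : State} (h : RowEnv p ψ s) (h24 : s.rreg 24 = σ) :
    Runs apex s (apex.bound * (Nat.clog 2 n + 1)) (fun s' => (0 < s'.nreg 12 ∧ s'.nreg 12 ≤ n ∧
      ∀ q ∈ polygonRegion p, σ * relY (vert p 0) ψ q ≤ σ * vY p ψ (s'.nreg 12)) ∧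
      Frame apex s s') := by
  refine Runs.frame ?_
  have hn := hp.1
  have hL : 1 ≤ Nat.clog 2 n + 1 := by omega
  refine (Runs.straight_mul hL s).seq_bound ?_
  rintro s1 ⟨e1, f1⟩
  refine (loadV_runs hL (h.frame f1) ?_).seq_bound ?_
  · rw [e1]; simp; omega
  rintro s2 ⟨-, e2, f2⟩
  refine (Runs.straight_mul hL s2).seq_bound ?_
  rintro s3 ⟨e3, f3⟩
  refine (Runs.straight_mul hL s3).seq_bound ?_
  rintro s4 ⟨e4, f4⟩
  refine (Runs.straight_mul hL s4).seq_bound ?_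
  rintro s5 ⟨e5, f5⟩
  have i1 : s1.nreg 10 = 1 := by rw [e1]; simp
  rw [i1] at e2
  have r5 : RowEnv p ψ s5 := ((((h.frame f1).frame f2).frame f3).frame f4).frame f5
  have g24 : s5.rreg 24 = σ := by
    rw [f5.rreg 24, f4.rreg 24, f3.rreg 24, f2.rreg 24, f1.rreg 24, h24]
  have g26 : s5.rreg 26 = σ * vY p ψ 1 := by
    rw [f5.rreg 26, f4.rreg 26, e3]
    simp [f2.rreg 24, f1.rreg 24, h24, e2]
  have g11 : s5.nreg 11 = 0 := by rw [f5.nreg 11, e4]; simp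
  have g12 : s5.nreg 12 = n := by
    rw [e5]; simp; rw [f4.nreg 0, f3.nreg 0, f2.nreg 0, f1.nreg 0, h.hn]
  refine (search_runs (n := n) 
    (fun s' => RowEnv p ψ s' ∧ s'.rreg 24 = σ ∧ s'.rreg 26 = σ * vY p ψ 1)
    (ApexQ n (fun i => σ * vY p ψ i)) (Nat.zero_le n) le_rfl (by omega) ?_ ?_ ?_ ?_
    ⟨r5, g24, g26⟩ g11 g12).weaken le_rfl ?_
  · refine ⟨by omega, ?_⟩
    by_cases c : σ * vY p ψ 1 ≤ 0
    · simp [c]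
    · simp [lt_of_not_ge c]
  · simp [ApexQ]
  · rintro s' m ⟨h1, h2, h3⟩
    exact ⟨h1.congr (by simp) (by simp) rfl rfl rfl rfl, h2, h3⟩
  · rintro s' ⟨h1, h2, h3⟩ hm
    exact (apexStep_runs le_rfl h1 h2 h3 (by omega)).mono (by rw [mul_one]) fun _ h => h
  · rintro s' ⟨-, hA, hB, hAB⟩
    obtain ⟨-, h1, h2, h3⟩ : _ ∧ 0 ≤ s'.nreg 11 ∧ s'.nreg 12 = s'.nreg 11 + 1 ∧ s'.nreg 12 ≤ n := by
      rcases hAB with hh | hh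
      · exact hh
      · omega
    refine ⟨by omega, h3, fun q hq => ?_⟩
    rw [h2] at hB ⊢
    rw [h2] at h3
    generalize s'.nreg 11 = a at *
    refine le_of_local_max hp (Nat.succ_pos a) h3 ?_ ?_ hq
    · change σ * vY p ψ a ≤ σ * vY p ψ (a + 1)
      rcases h3.eq_or_lt with he | he
      · have hz : σ * vY p ψ (a + 1) = 0 := by rw [he, vY_self, mul_zero]
        obtain ⟨-, ⟨-, hh | hh⟩ | ⟨-, hh, -⟩⟩ := hA <;> simp only at hh <;> linarith
      · obtain ⟨-, ⟨h5, hh | hh⟩ | ⟨-, hh, -⟩⟩ := hA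
        · exact hh.le
        · by_contra hneg
          push Not at hneg
          exact hB ⟨he, Or.inl ⟨h5, Or.inr (by simp only at hh ⊢; linarith)⟩⟩
        · exact hh.le
    · unfold nextIdx
      split_ifs with hs
      · obtain rfl : n = a + 1 := by omega
        rw [vY_self, mul_zero]
        obtain ⟨-, ⟨h5, -⟩ | ⟨h5, h6, h7⟩⟩ := hA
        · exact h5
        · simp only [vY_self, mul_zero] at h6 h7; linarith
      · by_contra hneg
        push Not at hneg
        refine hB ⟨by omega, ?_⟩
        obtain ⟨-, ⟨h5, -⟩ | ⟨h5, h6, h7⟩⟩ := hA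
        · exact Or.inl ⟨h5, Or.inl hneg⟩
        · exact Or.inr ⟨h5, hneg, by simp only at h6 h7 ⊢; linarith⟩

end RealRAM

namespace RealRAM

theorem Prog.den_ite_neg {b : Test} {c d : Prog} {s : State} (h : ¬ b.Holds s) :
    (Prog.ite b c d).den s = d.den s := if_neg h

/-! ### Chords -/

/-- One step of the search for an edge that crosses the height in the real register `25`. -/
def crossStep : Prog :=
  loadV ;; .ite (.realLE (rr 24 * (rr 23 - rr 25)) (rc 0)) setA setB

/-- Find an edge between the indices in the natural registers `11` and `12` that crosses the height
in the real register `25`, and compute the point of intersection. -/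
def cross : Prog :=
  search crossStep ;; .setNat 10 (nr 11) ;; loadV ;;
  (.setReal 27 (rr 22) ;; .setReal 28 (rr 23) ;; .setNat 10 (nr 12)) ;; loadV ;;
  .setReal 40 (rr 27 + (rr 25 - rr 28) * (rr 22 - rr 27) / (rr 23 - rr 28))

theorem crossStep_runs {n : ℕ} {p : Fin n → Plane} {ψ σ t : ℝ} {s : State} {L : ℕ} (hL : 1 ≤ L)
    (h : RowEnv p ψ s) (h24 : s.rreg 24 = σ) (h25 : s.rreg 25 = t) (hi : s.nreg 10 ≤ n) :
    Runs crossStep s (crossStep.bound * L) (fun s' =>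
      (RowEnv p ψ s' ∧ s'.rreg 24 = σ ∧ s'.rreg 25 = t) ∧
      ((σ * (vY p ψ (s.nreg 10) - t) ≤ 0 ∧ s'.nreg 11 = s.nreg 10 ∧ s'.nreg 12 = s.nreg 12) ∨
        (¬ σ * (vY p ψ (s.nreg 10) - t) ≤ 0 ∧ s'.nreg 11 = s.nreg 11 ∧
          s'.nreg 12 = s.nreg 10))) := by
  have hstep : Runs crossStep s (crossStep.bound * L) (fun s' =>
      (σ * (vY p ψ (s.nreg 10) - t) ≤ 0 ∧ s'.nreg 11 = s.nreg 10 ∧ s'.nreg 12 = s.nreg 12) ∨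
        (¬ σ * (vY p ψ (s.nreg 10) - t) ≤ 0 ∧ s'.nreg 11 = s.nreg 11 ∧
          s'.nreg 12 = s.nreg 10)) := by
    refine (loadV_runs hL h hi).seq_bound ?_
    rintro s1 ⟨-, e1, f1⟩
    refine (Runs.straight_mul hL s1).weaken le_rfl ?_
    rintro s2 ⟨rfl, -⟩
    have g24 : s1.rreg 24 = σ := (f1.rreg 24).trans h24
    have g25 : s1.rreg 25 = t := (f1.rreg 25).trans h25
    have g10 : s1.nreg 10 = s.nreg 10 := f1.nreg 10
    have g11 : s1.nreg 11 = s.nreg 11 := f1.nreg 11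
    have g12 : s1.nreg 12 = s.nreg 12 := f1.nreg 12
    by_cases c : σ * (vY p ψ (s.nreg 10) - t) ≤ 0
    · simp [setA, e1, g24, g25, g10, g12, c]
    · simp [setB, e1, g24, g25, g10, g11, c]
  refine hstep.frame.weaken (le_of_eq rfl) ?_
  rintro s' ⟨hs', hf⟩
  exact ⟨⟨h.frame hf, (hf.rreg 24).trans h24, (hf.rreg 25).trans h25⟩, hs'⟩

theorem cross_runs {n : ℕ} {p : Fin n → Plane} {ψ σ t : ℝ} {s : State} {a b : ℕ}
    (h : RowEnv p ψ s) (h24 : s.rreg 24 = σ) (h25 : s.rreg 25 = t) (ha : a ≤ n) (hb : b ≤ n)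
    (hsa : s.nreg 11 = a) (hsb : s.nreg 12 = b) (hQa : σ * (vY p ψ a - t) ≤ 0)
    (hQb : 0 < σ * (vY p ψ b - t)) :
    Runs cross s (cross.bound * (Nat.clog 2 n + 1)) (fun s' => (∃ A B,
      σ * (vY p ψ A - t) ≤ 0 ∧ 0 < σ * (vY p ψ B - t) ∧
      s'.rreg 40 = crossX (vX p ψ A) (vY p ψ A) (vX p ψ B) (vY p ψ B) t ∧
      ((a < b ∧ B = A + 1 ∧ B ≤ n) ∨ (b < a ∧ A = B + 1 ∧ A ≤ n))) ∧ Frame cross s s') := by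
  have hL : 1 ≤ Nat.clog 2 n + 1 := by omega
  have hab : a ≠ b := by rintro rfl; exact absurd hQa (not_le.2 hQb)
  refine Runs.frame ?_
  have hsearch := search_runs (step := crossStep) (n := n) (s := s)
    (fun s' => RowEnv p ψ s' ∧ s'.rreg 24 = σ ∧ s'.rreg 25 = t)
    (fun i => σ * (vY p ψ i - t) ≤ 0) ha hb hab hQa (not_le.2 hQb)
    (fun s' m h' => ⟨h'.1.congr (by simp) (by simp) rfl rfl rfl rfl, h'.2⟩)
    (fun s' h' hm => (crossStep_runs le_rfl h'.1 h'.2.1 h'.2.2 (by omega)).mono (by rw [mul_one])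
      fun _ h => h) ⟨h, h24, h25⟩ hsa hsb
  refine hsearch.seq_bound ?_
  rintro s1 ⟨⟨r1, -, g25⟩, hA, hB, hAB⟩
  obtain ⟨A, hAe⟩ : ∃ A, s1.nreg 11 = A := ⟨_, rfl⟩
  obtain ⟨B, hBe⟩ : ∃ B, s1.nreg 12 = B := ⟨_, rfl⟩
  simp only [hAe, hBe] at hA hB hAB
  refine (Runs.straight_mul hL s1).seq_bound ?_
  rintro s2 ⟨e2, f2⟩
  have i2 : s2.nreg 10 = A := by rw [e2]; simp [hAe]
  refine (loadV_runs hL (r1.frame f2) (by omega)).seq_bound ?_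
  rintro s3 ⟨e3x, e3y, f3⟩
  refine (Runs.straight_mul hL s3).seq_bound ?_
  rintro s4 ⟨e4, f4⟩
  have i4 : s4.nreg 10 = B := by rw [e4]; simp [f3.nreg 12, f2.nreg 12, hBe]
  refine (loadV_runs hL (((r1.frame f2).frame f3).frame f4) (by omega)).seq_bound ?_
  rintro s5 ⟨e5x, e5y, f5⟩
  refine (Runs.straight_mul hL s5).weaken le_rfl ?_
  rintro s6 ⟨e6, -⟩
  refine ⟨A, B, hA, not_le.1 hB, ?_, by omega⟩
  have g27 : s5.rreg 27 = vX p ψ A := by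
    rw [f5.rreg 27, e4]; simp [e3x, i2]
  have g28 : s5.rreg 28 = vY p ψ A := by
    rw [f5.rreg 28, e4]; simp [e3y, i2]
  have g25' : s5.rreg 25 = t := by
    rw [f5.rreg 25, f4.rreg 25, f3.rreg 25, f2.rreg 25, g25]
  rw [i4] at e5x e5y
  rw [e6]
  simp [crossX, g27, g28, g25', e5x, e5y]

/-- Compute the chord at the height in the real register `25`.  Its ends are stored in the real
registers `42` and `43`; the natural register `14` is set to `0` if the height is at most or at
least that of every point of the polygon.  The first vertex has height `0`; the search is for an
apex on the other side of the given height, and the boundary crosses this height once on each of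
the two ways from the first vertex to the apex. -/
def chord : Prog :=
  (.setReal 24 (rc 1) ;; .ite (.realLE (rc 0) (rr 25)) .skip (.setReal 24 (rc (-1)))) ;; apex ;;
  (.setNat 13 (nr 12) ;; .setNat 10 (nr 12)) ;; loadV ;;
  .ite (.realLE (rr 24 * (rr 23 - rr 25)) (rc 0)) (.setNat 14 (nc 0))
    ((.setNat 14 (nc 1) ;; .setNat 11 (nc 0) ;; .setNat 12 (nr 13)) ;; cross ;;
      (.setReal 41 (rr 40) ;; .setNat 11 (nr 0) ;; .setNat 12 (nr 13)) ;; cross ;;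
      .ite (.realLE (rr 40) (rr 41)) (.setReal 42 (rr 40) ;; .setReal 43 (rr 41))
        (.setReal 42 (rr 41) ;; .setReal 43 (rr 40)))

theorem chord_runs {n : ℕ} {p : Fin n → Plane} (hp : IsConvexPolygon p) {ψ t : ℝ} {s : State}
    (h : RowEnv p ψ s) (h25 : s.rreg 25 = t) :
    Runs chord s (chord.bound * (Nat.clog 2 n + 1)) (fun s' =>
      ((s'.nreg 14 = 0 ∧ ((∀ q ∈ polygonRegion p, relY (vert p 0) ψ q ≤ t) ∨
          ∀ q ∈ polygonRegion p, t ≤ relY (vert p 0) ψ q)) ∨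
        (s'.nreg 14 = 1 ∧ IsChord p ψ t (s'.rreg 42) (s'.rreg 43))) ∧ Frame chord s s') := by
  have hn := hp.1
  have hL : 1 ≤ Nat.clog 2 n + 1 := by omega
  refine Runs.frame ?_
  refine (Runs.straight_mul hL s).seq_bound ?_
  rintro s1 ⟨e1, f1⟩
  obtain ⟨σ, hσe, hσ, hσt⟩ : ∃ σ, s1.rreg 24 = σ ∧ (σ = 1 ∨ σ = -1) ∧ 0 ≤ σ * t := by
    rw [e1]
    by_cases c : 0 ≤ t
    · exact ⟨1, by simp [h25, c], Or.inl rfl, by simpa using c⟩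
    · exact ⟨-1, by simp [h25, c], Or.inr rfl, by linarith⟩
  refine (apex_runs hp (h.frame f1) hσe).seq_bound ?_
  rintro s2 ⟨⟨ha0, han, hmax⟩, f2⟩
  obtain ⟨a, hae⟩ : ∃ a, s2.nreg 12 = a := ⟨_, rfl⟩
  rw [hae] at ha0 han hmax
  refine (Runs.straight_mul hL s2).seq_bound ?_
  rintro s3 ⟨e3, f3⟩
  have i3 : s3.nreg 10 = a := by rw [e3]; simp [hae]
  have a3 : s3.nreg 13 = a := by rw [e3]; simp [hae]
  refine (loadV_runs hL (((h.frame f1).frame f2).frame f3) (by omega)).seq_bound ?_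
  rintro s4 ⟨-, e4y, f4⟩
  rw [i3] at e4y
  have r4 : RowEnv p ψ s4 := (((h.frame f1).frame f2).frame f3).frame f4
  have a4 : s4.nreg 13 = a := (f4.nreg 13).trans a3
  have σ4 : s4.rreg 24 = σ := by rw [f4.rreg 24, f3.rreg 24, f2.rreg 24, hσe]
  have t4 : s4.rreg 25 = t := by rw [f4.rreg 25, f3.rreg 25, f2.rreg 25, f1.rreg 25, h25]
  refine Runs.ite_bound hL (fun hc => ?_) fun hc => ?_
  · simp [σ4, t4, e4y] at hc
    refine (Runs.straight_mul hL s4).weaken le_rfl ?_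
    rintro s5 ⟨rfl, -⟩
    refine Or.inl ⟨by simp, ?_⟩
    rcases hσ with rfl | rfl
    · exact Or.inl fun q hq => by linarith [hmax q hq]
    · exact Or.inr fun q hq => by linarith [hmax q hq]
  · simp [σ4, t4, e4y] at hc
    refine (Runs.straight_mul hL s4).seq_bound ?_
    rintro s5 ⟨e5, f5⟩
    have r5 := r4.frame f5
    have σ5 : s5.rreg 24 = σ := (f5.rreg 24).trans σ4
    have t5 : s5.rreg 25 = t := (f5.rreg 25).trans t4
    have a5 : s5.nreg 13 = a := (f5.nreg 13).trans a4
    refine (cross_runs (a := 0) (b := a) r5 σ5 t5 (Nat.zero_le n) han (by rw [e5]; simp)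
      (by rw [e5]; simp [a4]) (by rw [vY_zero]; linarith) hc).seq_bound ?_
    rintro s6 ⟨⟨A, B, hA, hB, hx, hAB⟩, f6⟩
    refine (Runs.straight_mul hL s6).seq_bound ?_
    rintro s7 ⟨e7, f7⟩
    have r7 := (r5.frame f6).frame f7
    have σ7 : s7.rreg 24 = σ := by rw [f7.rreg 24, f6.rreg 24, σ5]
    have t7 : s7.rreg 25 = t := by rw [f7.rreg 25, f6.rreg 25, t5]
    have a7 : s7.nreg 13 = a := by rw [f7.nreg 13, f6.nreg 13, a5]
    refine (cross_runs (a := n) (b := a) r7 σ7 t7 le_rfl han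
      (by rw [e7]; simp; rw [f6.nreg 0, r5.hn]) (by rw [e7]; simp [f6.nreg 13, a5])
      (by rw [vY_self]; linarith) hc).seq_bound ?_
    rintro s8 ⟨⟨A', B', hA', hB', hx', hAB'⟩, f8⟩
    refine (Runs.straight_mul hL s8).weaken le_rfl ?_
    rintro s9 ⟨e9, f9⟩
    right
    obtain ⟨-, rfl, hBn⟩ : _ ∧ B = A + 1 ∧ B ≤ n := by
      rcases hAB with hh | hh
      · exact hh
      · omega
    obtain ⟨-, rfl, hAn⟩ : _ ∧ A' = B' + 1 ∧ A' ≤ n := by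
      rcases hAB' with hh | hh
      · omega
      · exact hh
    have hch := isChord_of_edges hp hσ hBn hAn hA hB hB' hA'
    simp only at hch
    have g41 : s8.rreg 41 = s6.rreg 40 := by rw [f8.rreg 41, e7]; simp
    refine ⟨?_, ?_⟩
    · rw [f9.nreg 14, f8.nreg 14, f7.nreg 14, f6.nreg 14, e5]; simp
    · rw [← hx, ← hx'] at hch
      rw [e9]
      by_cases c : s8.rreg 40 ≤ s6.rreg 40
      · rw [min_eq_right c, max_eq_left c] at hch
        simpa [g41, c] using hch
      · rw [min_eq_left (not_le.1 c).le, max_eq_right (not_le.1 c).le] at hch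
        simpa [g41, c] using hch

/-! ### The value of a pair of heights -/

/-- Compute the square root of the largest area of a rectangle between the heights in the real
registers `44` and `45`; the result is stored in the real register `46`, which is `0` if there is
no such rectangle or one of the chords is degenerate. -/
def evalV : Prog :=
  .setReal 25 (rr 44) ;; chord ;;
  (.setReal 48 (rr 42) ;; .setReal 49 (rr 43) ;; .setNat 15 (nr 14) ;; .setReal 25 (rr 45)) ;;
  chord ;;
  .setReal 46 (rc 0) ;;
  .ite (.natLE (nr 15) (nc 0)) .skip (.ite (.natLE (nr 14) (nc 0)) .skip
    (.ite (.realLE (rr 42) (rr 48)) (.setReal 42 (rr 48)) .skip ;;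
      .ite (.realLE (rr 43) (rr 49)) .skip (.setReal 43 (rr 49)) ;;
      .ite (.realLE (rr 42) (rr 43)) (.ite (.realLE (rr 44) (rr 45))
        (.setReal 46 (.sqrt ((rr 43 - rr 42) * (rr 45 - rr 44)))) .skip) .skip))

theorem not_isInnerPoint_lev {S : Set Plane} {o : Plane} {ψ c y₁ y₂ t : ℝ}
    (h : (∀ q ∈ S, relY o ψ q ≤ t) ∨ ∀ q ∈ S, t ≤ relY o ψ q) (ht : t = y₁ ∨ t = y₂) :
    ¬ IsInnerPoint (Lev S o ψ c) (y₁, y₂) := by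
  rintro ⟨⟨x₁, x₂, h0, -⟩, κ, hκ, ⟨u₁, u₂, h1, -⟩, ⟨v₁, v₂, h2, -⟩⟩
  have k0 := h0.hy
  simp only at k0
  rcases h with h | h
  · have := h _ h2.h12
    rw [relY_framePt] at this
    simp only at this
    rcases ht with rfl | rfl <;> linarith
  · have := h _ h1.h11
    rw [relY_framePt] at this
    simp only at this
    rcases ht with rfl | rfl <;> linarith

theorem evalV_runs {n : ℕ} {p : Fin n → Plane} (hp : IsConvexPolygon p) {ψ y₁ y₂ : ℝ} {s : State}
    (h : RowEnv p ψ s) (h44 : s.rreg 44 = y₁) (h45 : s.rreg 45 = y₂) :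
    Runs evalV s (evalV.bound * (Nat.clog 2 n + 1)) (fun s' =>
      (0 ≤ s'.rreg 46 ∧ (0 < s'.rreg 46 →
        Fits (polygonRegion p) (vert p 0) ψ (s'.rreg 42) (s'.rreg 43) y₁ y₂ ∧
          s'.rreg 46 = √((s'.rreg 43 - s'.rreg 42) * (y₂ - y₁))) ∧
        ∀ c, IsInnerPoint (Lev (polygonRegion p) (vert p 0) ψ c) (y₁, y₂) → c ≤ s'.rreg 46) ∧
      Frame evalV s s') := by
  have hL : 1 ≤ Nat.clog 2 n + 1 := by omega
  refine Runs.frame ?_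
  refine (Runs.straight_mul hL s).seq_bound ?_
  rintro s1 ⟨e1, f1⟩
  refine (chord_runs hp (h.frame f1) (t := y₁) (by rw [e1]; simp [h44])).seq_bound ?_
  rintro s2 ⟨h2, f2⟩
  refine (Runs.straight_mul hL s2).seq_bound ?_
  rintro s3 ⟨e3, f3⟩
  have g15 : s3.nreg 15 = s2.nreg 14 := by rw [e3]; simp
  have g48 : s3.rreg 48 = s2.rreg 42 := by rw [e3]; simp
  have g49 : s3.rreg 49 = s2.rreg 43 := by rw [e3]; simp
  refine (chord_runs hp (((h.frame f1).frame f2).frame f3) (t := y₂)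
    (by rw [e3]; simp [f2.rreg 45, f1.rreg 45, h45])).seq_bound ?_
  rintro s4 ⟨h4, f4⟩
  refine (Runs.straight_mul hL s4).seq_bound ?_
  rintro s5 ⟨e5, f5⟩
  refine (Runs.straight_mul hL s5).weaken le_rfl ?_
  rintro s6 ⟨rfl, -⟩
  have k15 : s5.nreg 15 = s2.nreg 14 := by rw [f5.nreg 15, f4.nreg 15, g15]
  have k48 : s5.rreg 48 = s2.rreg 42 := by rw [f5.rreg 48, f4.rreg 48, g48]
  have k49 : s5.rreg 49 = s2.rreg 43 := by rw [f5.rreg 49, f4.rreg 49, g49]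
  have k44 : s5.rreg 44 = y₁ := by
    rw [f5.rreg 44, f4.rreg 44, f3.rreg 44, f2.rreg 44, f1.rreg 44, h44]
  have k45 : s5.rreg 45 = y₂ := by
    rw [f5.rreg 45, f4.rreg 45, f3.rreg 45, f2.rreg 45, f1.rreg 45, h45]
  have k46 : s5.rreg 46 = 0 := by rw [e5]; simp
  have k14 : s5.nreg 14 = s4.nreg 14 := f5.nreg 14
  have k42 : s5.rreg 42 = s4.rreg 42 := f5.rreg 42
  have k43 : s5.rreg 43 = s4.rreg 43 := f5.rreg 43
  rcases h2 with ⟨z2, h2⟩ | ⟨z2, h2⟩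
  · simp only [Prog.den, Test.Holds, NatExpr.eval, k15, z2, le_refl, if_true, k46, lt_irrefl,
      false_imp_iff, true_and]
    exact fun c hc => absurd hc (not_isInnerPoint_lev h2 (Or.inl rfl))
  rcases h4 with ⟨z4, h4⟩ | ⟨z4, h4⟩
  · simp only [Prog.den, Test.Holds, NatExpr.eval, k15, z2, k14, z4, le_refl, if_true, k46,
      lt_irrefl, false_imp_iff, true_and, nonpos_iff_eq_zero, one_ne_zero, if_false]
    exact fun c hc => absurd hc (not_isInnerPoint_lev h4 (Or.inr rfl))
  -- both chords are proper
  obtain ⟨s6, hs6⟩ : ∃ s6, s6 = (Prog.ite (.realLE (rr 42) (rr 48)) (.setReal 42 (rr 48)) .skip ;;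
      .ite (.realLE (rr 43) (rr 49)) .skip (.setReal 43 (rr 49))).den s5 := ⟨_, rfl⟩
  have m42 : s6.rreg 42 = max (s2.rreg 42) (s4.rreg 42) := by
    rw [hs6]
    by_cases c1 : s4.rreg 42 ≤ s2.rreg 42 <;> by_cases c2 : s4.rreg 43 ≤ s2.rreg 43 <;>
      simp [k48, k49, k42, k43, c1, c2, (not_le.1 _).le]
  have m43 : s6.rreg 43 = min (s2.rreg 43) (s4.rreg 43) := by
    rw [hs6]
    by_cases c1 : s4.rreg 42 ≤ s2.rreg 42 <;> by_cases c2 : s4.rreg 43 ≤ s2.rreg 43 <;>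
      simp [k48, k49, k42, k43, c1, c2, le_of_not_ge]
  have m44 : s6.rreg 44 = y₁ := by
    rw [hs6]
    by_cases c1 : s4.rreg 42 ≤ s2.rreg 42 <;> by_cases c2 : s4.rreg 43 ≤ s2.rreg 43 <;>
      simp [k48, k49, k42, k43, c1, c2, k44]
  have m45 : s6.rreg 45 = y₂ := by
    rw [hs6]
    by_cases c1 : s4.rreg 42 ≤ s2.rreg 42 <;> by_cases c2 : s4.rreg 43 ≤ s2.rreg 43 <;>
      simp [k48, k49, k42, k43, c1, c2, k45]
  have m46 : s6.rreg 46 = 0 := by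
    rw [hs6]
    by_cases c1 : s4.rreg 42 ≤ s2.rreg 42 <;> by_cases c2 : s4.rreg 43 ≤ s2.rreg 43 <;>
      simp [k48, k49, k42, k43, c1, c2, k46]
  have hden : (Prog.ite (.natLE (nr 15) (nc 0)) .skip (.ite (.natLE (nr 14) (nc 0)) .skip
    (.ite (.realLE (rr 42) (rr 48)) (.setReal 42 (rr 48)) .skip ;;
      .ite (.realLE (rr 43) (rr 49)) .skip (.setReal 43 (rr 49)) ;;
      .ite (.realLE (rr 42) (rr 43)) (.ite (.realLE (rr 44) (rr 45))
        (.setReal 46 (.sqrt ((rr 43 - rr 42) * (rr 45 - rr 44)))) .skip) .skip))).den s5 =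
      (Prog.ite (.realLE (rr 42) (rr 43)) (.ite (.realLE (rr 44) (rr 45))
        (.setReal 46 (.sqrt ((rr 43 - rr 42) * (rr 45 - rr 44)))) .skip) .skip).den s6 := by
    rw [hs6, Prog.den_ite_neg (by simp [k15, z2]), Prog.den_ite_neg (by simp [k14, z4])]
    rfl
  rw [hden]
  clear hden hs6
  by_cases c1 : s6.rreg 42 ≤ s6.rreg 43
  · by_cases c2 : y₁ ≤ y₂
    · simp only [Prog.den, Test.Holds, RealExpr.eval, c1, m44, m45, c2, if_true,
        Function.update_self, RealExpr.eval_sub', ne_eq, Nat.reduceEqDiff,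
        not_false_eq_true, Function.update_of_ne]
      refine ⟨Real.sqrt_nonneg _, fun _ => ⟨?_, trivial⟩, fun c hc => ?_⟩
      · rw [m42, m43] at c1 ⊢
        exact fits_of_chords h2 h4 c2 c1
      · rw [m42, m43]
        exact (le_sqrt_of_mem_lev h2 h4 hc.1).2.2
    · simp only [Prog.den, Test.Holds, RealExpr.eval, c1, m44, m45, c2, if_true, if_false, m46,
        lt_irrefl, false_imp_iff, true_and, le_refl]
      exact fun c hc => absurd (le_sqrt_of_mem_lev h2 h4 hc.1).1 c2
  · simp only [Prog.den, Test.Holds, RealExpr.eval, c1, if_false, m46, lt_irrefl, false_imp_iff,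
      true_and, le_refl]
    rw [m42, m43] at c1
    exact fun c hc => absurd (le_sqrt_of_mem_lev h2 h4 hc.1).2.1 c1

/-! ### The best rectangle so far -/

/-- The data for the output of rectangles: the direction of the frame and the first vertex. -/
structure OutEnv {n : ℕ} (p : Fin n → Plane) (ψ : ℝ) (s : State) : Prop where
  hcos : s.rreg 50 = Real.cos ψ
  hsin : s.rreg 51 = Real.sin ψ
  h0 : s.rarr 0 0 = vert p 0 0
  h1 : s.rarr 1 0 = vert p 0 1

/-- The real registers `31, …, 36` hold an inscribed rectangle whose area is the square of the
number in the real register `30`, unless this number is `0`. -/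
def BestOK {n : ℕ} (p : Fin n → Plane) (s : State) : Prop :=
  0 ≤ s.rreg 30 ∧ (0 < s.rreg 30 → ∃ R : Rectangle, R.region ⊆ polygonRegion p ∧
    R.area = s.rreg 30 ^ 2 ∧ s.rreg 31 = R.corner 0 ∧ s.rreg 32 = R.corner 1 ∧
    s.rreg 33 = R.side₁ 0 ∧ s.rreg 34 = R.side₁ 1 ∧ s.rreg 35 = R.side₂ 0 ∧ s.rreg 36 = R.side₂ 1)

theorem BestOK.frame {n : ℕ} {p : Fin n → Plane} {s s' : State} {c : Prog} (h : BestOK p s)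
    (hf : Frame c s s') (h30 : c.wReal 30 = false := by rfl)
    (h31 : c.wReal 31 = false := by rfl) (h32 : c.wReal 32 = false := by rfl)
    (h33 : c.wReal 33 = false := by rfl) (h34 : c.wReal 34 = false := by rfl)
    (h35 : c.wReal 35 = false := by rfl) (h36 : c.wReal 36 = false := by rfl) : BestOK p s' := by
  unfold BestOK
  rw [hf.rreg 30 h30, hf.rreg 31 h31, hf.rreg 32 h32, hf.rreg 33 h33, hf.rreg 34 h34,
    hf.rreg 35 h35, hf.rreg 36 h36]
  exact h

/-- Evaluate a pair of heights, and keep the rectangle if it is better than all previous ones. -/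
def evalBest : Prog :=
  evalV ;; .ite (.realLE (rr 46) (rr 30)) .skip (.setReal 30 (rr 46) ;;
    .setReal 31 (.load 0 (nc 0) + rr 42 * rr 50 - rr 44 * rr 51) ;;
    .setReal 32 (.load 1 (nc 0) + rr 42 * rr 51 + rr 44 * rr 50) ;;
    .setReal 33 ((rr 43 - rr 42) * rr 50) ;; .setReal 34 ((rr 43 - rr 42) * rr 51) ;;
    .setReal 35 (rc 0 - (rr 45 - rr 44) * rr 51) ;; .setReal 36 ((rr 45 - rr 44) * rr 50))

theorem evalBest_runs {n : ℕ} {p : Fin n → Plane} (hp : IsConvexPolygon p) {ψ y₁ y₂ : ℝ}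
    {s : State} (h : RowEnv p ψ s) (ho : OutEnv p ψ s) (hbest : BestOK p s)
    (h44 : s.rreg 44 = y₁) (h45 : s.rreg 45 = y₂) :
    Runs evalBest s (evalBest.bound * (Nat.clog 2 n + 1)) (fun s' =>
      (BestOK p s' ∧ s.rreg 30 ≤ s'.rreg 30 ∧ s'.rreg 46 ≤ s'.rreg 30 ∧ 0 ≤ s'.rreg 46 ∧
        (0 < s'.rreg 46 → (y₁, y₂) ∈ Lev (polygonRegion p) (vert p 0) ψ (s'.rreg 46)) ∧
        ∀ c, IsInnerPoint (Lev (polygonRegion p) (vert p 0) ψ c) (y₁, y₂) → c ≤ s'.rreg 46) ∧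
      Frame evalBest s s') := by
  have hL : 1 ≤ Nat.clog 2 n + 1 := by omega
  refine Runs.frame ?_
  refine (evalV_runs hp h h44 h45).seq_bound ?_
  rintro s1 ⟨⟨v0, v1, v2⟩, f1⟩
  refine (Runs.straight_mul hL s1).weaken le_rfl ?_
  rintro s2 ⟨rfl, f2⟩
  rw [f2.rreg 46]
  have b1 : BestOK p s1 := hbest.frame f1
  have k30 : s1.rreg 30 = s.rreg 30 := f1.rreg 30
  have hlev : 0 < s1.rreg 46 → (y₁, y₂) ∈ Lev (polygonRegion p) (vert p 0) ψ (s1.rreg 46) :=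
    fun hv => ⟨_, _, (v1 hv).1, (v1 hv).2.le⟩
  by_cases c : s1.rreg 46 ≤ s1.rreg 30
  · simp only [Prog.den, Test.Holds, RealExpr.eval, c, if_true]
    exact ⟨b1, k30.ge, trivial, v0, hlev, v2⟩
  · have hv : 0 < s1.rreg 46 := lt_of_le_of_lt b1.1 (not_le.1 c)
    obtain ⟨hf, hsq⟩ := v1 hv
    have hprod : 0 < (s1.rreg 43 - s1.rreg 42) * (y₂ - y₁) := by
      rw [hsq] at hv; exact Real.sqrt_pos.1 hv
    have hx : s1.rreg 42 < s1.rreg 43 := by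
      rcases hf.hx.lt_or_eq with hh | hh
      · exact hh
      · rw [hh] at hprod; simp at hprod
    have hy : y₁ < y₂ := by
      rcases hf.hy.lt_or_eq with hh | hh
      · exact hh
      · rw [hh] at hprod; simp at hprod
    have k44 : s1.rreg 44 = y₁ := (f1.rreg 44).trans h44
    have k45 : s1.rreg 45 = y₂ := (f1.rreg 45).trans h45
    have k50 : s1.rreg 50 = Real.cos ψ := (f1.rreg 50).trans ho.hcos
    have k51 : s1.rreg 51 = Real.sin ψ := (f1.rreg 51).trans ho.hsin
    have a0 : s1.rarr 0 0 = vert p 0 0 := by rw [f1.rarr 0]; exact ho.h0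
    have a1 : s1.rarr 1 0 = vert p 0 1 := by rw [f1.rarr 1]; exact ho.h1
    simp only [Prog.den, Test.Holds, RealExpr.eval, c, if_false]
    refine ⟨⟨by simp [hv.le], fun _ => ?_⟩, ?_, ?_, v0, hlev, v2⟩
    · refine ⟨rectOf (vert p 0) ψ _ _ _ _ hx hy,
        hf.region_subset (polygonRegion_convex p) hx hy, ?_, ?_, ?_, ?_, ?_, ?_, ?_⟩
      · rw [rectOf_area]
        simp only [Function.update_self, ne_eq, Nat.reduceEqDiff, not_false_eq_true,
          Function.update_of_ne]
        rw [hsq, Real.sq_sqrt hprod.le]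
      all_goals simp [rectOf, k44, k45, k50, k51, a0, a1]
    · simp [k30 ▸ (not_le.1 c).le]
    · simp

end RealRAM

namespace RealRAM

theorem Runs.seq_mul {c d : Prog} {s : State} {C C' L : ℕ} {Q Q' : State → Prop}
    (h : Runs c s (C * L) Q) (h' : ∀ s', Q s' → Runs d s' (C' * L) Q') :
    Runs (c ;; d) s ((C + C') * L) Q' :=
  (h.seq h').mono (le_of_eq (add_mul _ _ _).symm) fun _ h => h

/-- The running time of a loop with `m` passes. -/
def forCost (m : ℕ) (b : Test) (C : ℕ) : ℕ := m * (b.cost + C + 1) + (b.cost + 1)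

theorem Runs.forLoop_mul {b : Test} {c : Prog} {C L : ℕ} (hL : 1 ≤ L) (I : ℕ → State → Prop)
    (m : ℕ) (hb : ∀ j s, j ≤ m → I j s → (b.Holds s ↔ j < m))
    (hstep : ∀ j s, j < m → I j s → Runs c s (C * L) (I (j + 1)))
    {s : State} (hs : I 0 s) : Runs (.loop b c) s (forCost m b C * L) (I m) := by
  refine (Runs.forLoop I m hb hstep hs).mono ?_ fun _ h => h
  have h1 : b.cost + C * L + 1 ≤ (b.cost + C + 1) * L := by nlinarith
  have h2 := Nat.mul_le_mul_left m h1
  have h3 := Nat.le_mul_of_pos_right (b.cost + 1) hL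
  unfold forCost
  nlinarith

theorem Frame.refl (c : Prog) (s : State) : Frame c s s :=
  ⟨fun _ _ => rfl, fun _ _ => rfl, fun _ _ => rfl, fun _ _ => rfl⟩

theorem Frame.trans {c : Prog} {s s' s'' : State} (h : Frame c s s') (h' : Frame c s' s'') :
    Frame c s s'' :=
  ⟨fun j hj => (h'.nreg' j hj).trans (h.nreg' j hj),
    fun j hj => (h'.narr' j hj).trans (h.narr' j hj),
    fun j hj => (h'.rreg' j hj).trans (h.rreg' j hj),
    fun j hj => (h'.rarr' j hj).trans (h.rarr' j hj)⟩

theorem OutEnv.frame {n : ℕ} {p : Fin n → Plane} {ψ : ℝ} {s s' : State} {c : Prog}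
    (h : OutEnv p ψ s) (hf : Frame c s s') (h50 : c.wReal 50 = false := by rfl)
    (h51 : c.wReal 51 = false := by rfl) (a0 : c.wRealArr 0 = false := by rfl)
    (a1 : c.wRealArr 1 = false := by rfl) : OutEnv p ψ s' :=
  ⟨(hf.rreg 50 h50).trans h.hcos, (hf.rreg 51 h51).trans h.hsin,
    (congrFun (hf.rarr 0 a0) 0).trans h.h0, (congrFun (hf.rarr 1 a1) 0).trans h.h1⟩

/-! ### Evaluation on a grid -/

/-- The box whose parameters are stored in the real registers `60, …, 64`. -/
def boxOf (s : State) : SBox := ⟨s.rreg 60, s.rreg 61, s.rreg 62, s.rreg 63, s.rreg 64⟩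

theorem boxOf_frame {s s' : State} {c : Prog} (hf : Frame c s s')
    (h60 : c.wReal 60 = false := by rfl) (h61 : c.wReal 61 = false := by rfl)
    (h62 : c.wReal 62 = false := by rfl) (h63 : c.wReal 63 = false := by rfl)
    (h64 : c.wReal 64 = false := by rfl) : boxOf s' = boxOf s := by
  simp only [boxOf, hf.rreg 60 h60, hf.rreg 61 h61, hf.rreg 62 h62, hf.rreg 63 h63, hf.rreg 64 h64]

/-- Evaluate a point of the grid in the current box, store it, and move on to the next point.  The
real registers `65` and `66` hold the position in the grid, the natural register `18` the number of
the point. -/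
def fillStep (N : ℕ) : Prog :=
  (.setReal 44 (rr 60 + rr 65 / rc N * rr 61) ;;
    .setReal 45 (rr 63 + rr 66 / rc N * rr 64 + rr 62 * rr 44)) ;; evalBest ;;
  (.storeReal 12 (nr 18) (rr 44) ;; .storeReal 13 (nr 18) (rr 45) ;;
    .storeReal 14 (nr 18) (rr 46) ;;
    .ite (.realLE (rr 46) (rr 67)) .skip (.setReal 67 (rr 46) ;; .setNat 19 (nr 18)) ;;
    .setNat 18 (nr 18 + nc 1) ;;
    .ite (.realLE (rc N) (rr 66)) (.setReal 66 (rc 0) ;; .setReal 65 (rr 65 + rc 1))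
      (.setReal 66 (rr 66 + rc 1)))

/-- The number of grid points. -/
def gridCount (N : ℕ) : ℕ := (N + 1) * (N + 1)

/-- Move to the first point of the grid. -/
def fillInit : Prog :=
  .setNat 18 (nc 0) ;; .setNat 19 (nc 0) ;; .setReal 65 (rc 0) ;; .setReal 66 (rc 0) ;;
  .setReal 67 (rc (-1))

/-- Evaluate all points of the grid.  The largest value is stored in the real register `67`, and its
index in the natural register `19`. -/
def fill (N : ℕ) : Prog :=
  fillInit ;; .loop (.not (.natLE (nc (gridCount N)) (nr 18))) (fillStep N)

/-- The running time of `fill`, without the logarithmic factor. -/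
def fillCost (N : ℕ) : ℕ := fillInit.bound +
  forCost (gridCount N) (.not (.natLE (nc (gridCount N)) (nr 18))) (fillStep N).bound

/-- The first `k` points of the grid in the box `b` have been evaluated. -/
structure FillInv {n : ℕ} (p : Fin n → Plane) (ψ : ℝ) (N : ℕ) (b : SBox) (k : ℕ) (s : State) :
    Prop where
  best : BestOK p s
  grid : ∀ i j, j ≤ N → i * (N + 1) + j < k → s.rarr 12 (i * (N + 1) + j) = b.tl + i / N * b.W ∧
    s.rarr 13 (i * (N + 1) + j) = b.cl + j / N * b.U + b.σ * (b.tl + i / N * b.W)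
  val : ∀ l < k, s.rarr 14 l ≤ s.rreg 67 ∧
    (0 < s.rarr 14 l →
      (s.rarr 12 l, s.rarr 13 l) ∈ Lev (polygonRegion p) (vert p 0) ψ (s.rarr 14 l)) ∧
    ∀ c, IsInnerPoint (Lev (polygonRegion p) (vert p 0) ψ c) (s.rarr 12 l, s.rarr 13 l) →
      c ≤ s.rarr 14 l
  le_best : s.rreg 67 ≤ s.rreg 30
  max : (k = 0 ∧ s.rreg 67 = -1) ∨ (s.nreg 19 < k ∧ s.rarr 14 (s.nreg 19) = s.rreg 67)

theorem grid_index_inj {N i j i' j' : ℕ} (hj : j ≤ N) (hj' : j' ≤ N)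
    (h : i * (N + 1) + j = i' * (N + 1) + j') : i = i' ∧ j = j' := by
  have hi : i = i' := by
    rcases lt_trichotomy i i' with h1 | h1 | h1
    · nlinarith
    · exact h1
    · nlinarith
  subst hi
  exact ⟨rfl, by omega⟩

theorem fill_runs {n : ℕ} {p : Fin n → Plane} (hp : IsConvexPolygon p) {ψ : ℝ} {N : ℕ}
    {s : State} (h : RowEnv p ψ s) (ho : OutEnv p ψ s) (hbest : BestOK p s) :
    Runs (fill N) s (fillCost N * (Nat.clog 2 n + 1))
      (fun s' => (FillInv p ψ N (boxOf s) (gridCount N) s' ∧ s.rreg 30 ≤ s'.rreg 30) ∧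
        Frame (fill N) s s') := by
  have hL : 1 ≤ Nat.clog 2 n + 1 := by omega
  refine Runs.frame ?_
  refine (Runs.straight_mul (c := fillInit) hL s).seq_mul ?_
  rintro s0 ⟨e0, f0⟩
  rw [← boxOf_frame f0, ← f0.rreg 30]
  have r0 := h.frame f0
  have o0 := ho.frame f0
  have b0 : BestOK p s0 := hbest.frame f0
  refine (Runs.forLoop_mul hL (fun k s' => FillInv p ψ N (boxOf s0) k s' ∧
    s0.rreg 30 ≤ s'.rreg 30 ∧ s'.nreg 18 = k ∧ (∃ i j : ℕ, k = i * (N + 1) + j ∧ j ≤ N ∧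
      s'.rreg 65 = i ∧ s'.rreg 66 = j) ∧ Frame (fillStep N) s0 s')
    (gridCount N) ?_ ?_ ?_).weaken le_rfl ?_
  · rintro k s1 - ⟨-, -, hk, -⟩
    simp [hk]
  · rintro k s1 hk ⟨hinv, h30, h18, ⟨i, j, hij, hj, h65, h66⟩, hf⟩
    refine (Runs.straight_mul hL s1).seq_bound ?_
    rintro s2 ⟨e2, f2⟩
    have g44 : s2.rreg 44 = (boxOf s0).tl + i / N * (boxOf s0).W := by
      rw [e2, ← boxOf_frame hf]; simp [boxOf, h65]
    have g45 : s2.rreg 45 = (boxOf s0).cl + j / N * (boxOf s0).U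
        + (boxOf s0).σ * ((boxOf s0).tl + i / N * (boxOf s0).W) := by
      rw [e2, ← boxOf_frame hf]; simp [boxOf, h65, h66]
    refine (evalBest_runs hp ((r0.frame hf).frame f2) ((o0.frame hf).frame f2)
      (hinv.best.frame f2) g44 g45).seq_bound ?_
    rintro s3 ⟨⟨k1, k2, k3, k4, k5, k6⟩, f3⟩
    refine ((Runs.straight_mul hL s3).weaken le_rfl ?_)
    rintro s4 ⟨e4, f4⟩
    have g44' := (f3.rreg 44).trans g44
    have g45' := (f3.rreg 45).trans g45
    have g65 : s3.rreg 65 = i := by rw [f3.rreg 65, f2.rreg 65, h65]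
    have g66 : s3.rreg 66 = j := by rw [f3.rreg 66, f2.rreg 66, h66]
    have g67 : s3.rreg 67 = s1.rreg 67 := by rw [f3.rreg 67, f2.rreg 67]
    have g18 : s3.nreg 18 = k := by rw [f3.nreg 18, f2.nreg 18, h18]
    have g19 : s3.nreg 19 = s1.nreg 19 := by rw [f3.nreg 19, f2.nreg 19]
    have g12 : s3.rarr 12 = s1.rarr 12 := by rw [f3.rarr 12, f2.rarr 12]
    have g13 : s3.rarr 13 = s1.rarr 13 := by rw [f3.rarr 13, f2.rarr 13]
    have g14 : s3.rarr 14 = s1.rarr 14 := by rw [f3.rarr 14, f2.rarr 14]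
    set v := s3.rreg 46 with hv
    have a12 : s4.rarr 12 = Function.update (s1.rarr 12) k
        ((boxOf s0).tl + i / N * (boxOf s0).W) := by
      rw [e4]
      by_cases c1 : s3.rreg 46 ≤ s3.rreg 67 <;> by_cases c2 : (N : ℝ) ≤ j <;>
        simp [c1, c2, g66, g18, g12, g44']
    have a13 : s4.rarr 13 = Function.update (s1.rarr 13) k ((boxOf s0).cl + j / N * (boxOf s0).U
        + (boxOf s0).σ * ((boxOf s0).tl + i / N * (boxOf s0).W)) := by
      rw [e4]
      by_cases c1 : s3.rreg 46 ≤ s3.rreg 67 <;> by_cases c2 : (N : ℝ) ≤ j <;>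
        simp [c1, c2, g66, g18, g13, g45']
    have a14 : s4.rarr 14 = Function.update (s1.rarr 14) k v := by
      rw [e4]
      by_cases c1 : s3.rreg 46 ≤ s3.rreg 67 <;> by_cases c2 : (N : ℝ) ≤ j <;>
        simp [c1, c2, g66, g18, g14, hv]
    have a67 : s4.rreg 67 = max (s1.rreg 67) v := by
      rw [e4]
      by_cases c1 : s3.rreg 46 ≤ s1.rreg 67 <;> by_cases c2 : (N : ℝ) ≤ j <;>
        simp [c1, c2, g66, g67, hv, le_of_not_ge]
    have a19 : (v ≤ s1.rreg 67 ∧ s4.nreg 19 = s1.nreg 19) ∨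
        (s1.rreg 67 < v ∧ s4.nreg 19 = k) := by
      rw [e4]
      by_cases c1 : s3.rreg 46 ≤ s1.rreg 67 <;> by_cases c2 : (N : ℝ) ≤ j <;>
        simp [c1, c2, g66, g67, hv, g18, g19, lt_of_not_ge]
    have b4 : BestOK p s4 := k1.frame f4
    refine ⟨⟨b4, ?_, ?_, ?_, ?_⟩, ?_, ?_, ?_, ?_⟩
    · intro i' j' hj' hlt
      rw [a12, a13]
      by_cases hkk : i' * (N + 1) + j' = k
      · obtain ⟨rfl, rfl⟩ := grid_index_inj hj' hj (hkk.trans hij)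
        simp [hkk]
      · rw [Function.update_of_ne hkk, Function.update_of_ne hkk]
        exact hinv.grid i' j' hj' (by omega)
    · intro l hl
      rw [a12, a13, a14, a67]
      by_cases hkk : l = k
      · subst hkk
        simp only [Function.update_self]
        exact ⟨le_max_right _ _, k5, k6⟩
      · rw [Function.update_of_ne hkk, Function.update_of_ne hkk, Function.update_of_ne hkk]
        obtain ⟨l1, l2, l3⟩ := hinv.val l (by omega)
        exact ⟨l1.trans (le_max_left _ _), l2, l3⟩
    · rw [a67, f4.rreg 30]
      exact max_le (hinv.le_best.trans ((f2.rreg 30) ▸ k2)) k3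
    · right
      rw [a67, a14]
      rcases a19 with ⟨c, e⟩ | ⟨c, e⟩
      · rcases hinv.max with ⟨-, hm⟩ | ⟨hm, hm'⟩
        · linarith
        · rw [e, max_eq_left c, Function.update_of_ne (by omega)]
          exact ⟨by omega, hm'⟩
      · rw [e, max_eq_right c.le]
        simp
    · rw [f4.rreg 30]
      exact h30.trans ((f2.rreg 30) ▸ k2)
    · rw [e4]
      by_cases c1 : s3.rreg 46 ≤ s3.rreg 67 <;> by_cases c2 : (N : ℝ) ≤ j <;>
        simp [c1, c2, g66, g18]
    · by_cases c2 : N ≤ j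
      · obtain rfl : N = j := le_antisymm c2 hj
        refine ⟨i + 1, 0, by rw [hij]; ring, Nat.zero_le _, ?_, ?_⟩ <;> rw [e4] <;>
          by_cases c1 : s3.rreg 46 ≤ s3.rreg 67 <;> simp [c1, g65, g66]
      · have c3 : ¬ (N : ℝ) ≤ j := by exact_mod_cast c2
        refine ⟨i, j + 1, by rw [hij]; ring, by omega, ?_, ?_⟩ <;> rw [e4] <;>
          by_cases c1 : s3.rreg 46 ≤ s3.rreg 67 <;> simp [c1, c3, g65, g66]
    · have : Frame (fillStep N) s1 s4 := by
        refine ⟨fun q hq => ?_, fun q hq => ?_, fun q hq => ?_, fun q hq => ?_⟩ <;>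
          simp only [fillStep, Prog.wNat, Prog.wNatArr, Prog.wReal, Prog.wRealArr,
            Bool.or_eq_false_iff] at hq
        · rw [f4.nreg' q (by simp [Prog.wNat, hq]), f3.nreg' q hq.2.1, f2.nreg' q rfl]
        · rw [f4.narr' q rfl, f3.narr' q hq.2.1, f2.narr' q rfl]
        · rw [f4.rreg' q (by simp [Prog.wReal, hq]), f3.rreg' q hq.2.1,
            f2.rreg' q (by simp [Prog.wReal, hq])]
        · rw [f4.rarr' q (by simp [Prog.wRealArr, hq]), f3.rarr' q hq.2.1, f2.rarr' q rfl]
      exact hf.trans this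
  · refine ⟨⟨b0, by simp, by simp, ?_, Or.inl ⟨rfl, ?_⟩⟩, le_rfl, ?_,
      ⟨0, 0, by simp, by simp, ?_, ?_⟩, Frame.refl _ _⟩
    · have := b0.1
      have h67 : s0.rreg 67 = -1 := by rw [e0]; simp [fillInit]
      linarith
    all_goals rw [e0]; simp [fillInit]
  · rintro s' ⟨h1, h2, -⟩
    exact ⟨h1, h2⟩

/-! ### Extreme samples -/

/-- The linear function of a sample that is minimised and maximised. -/
def key (i : NatExpr) : RealExpr := rr 70 * .load 13 i - rr 71 * .load 12 i

/-- Compare the sample with the index in the natural register `18`, if it passes the threshold in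
the real register `68`, with the extreme ones so far. -/
def scanStep : Prog :=
  .ite (.realLE (rr 68) (.load 14 (nr 18)))
    (.ite (.realLE (key (nr 20)) (key (nr 18))) .skip (.setNat 20 (nr 18)) ;;
      .ite (.realLE (key (nr 18)) (key (nr 21))) .skip (.setNat 21 (nr 18))) .skip ;;
  .setNat 18 (nr 18 + nc 1)

/-- Start with the sample whose index is in the natural register `19`. -/
def scanInit : Prog := .setNat 18 (nc 0) ;; .setNat 20 (nr 19) ;; .setNat 21 (nr 19)

/-- Find the passing samples with the smallest and the largest key; their indices are stored in the
natural registers `20` and `21`. -/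
def scan (m : ℕ) : Prog :=
  scanInit ;; .loop (.not (.natLE (nc m) (nr 18))) scanStep

/-- The running time of `scan`. -/
def scanCost (m : ℕ) : ℕ :=
  scanInit.bound + forCost m (.not (.natLE (nc m) (nr 18))) scanStep.bound

/-- The value of the key at sample `k`. -/
def keyVal (s : State) (k : ℕ) : ℝ := s.rreg 70 * s.rarr 13 k - s.rreg 71 * s.rarr 12 k

theorem scan_runs {m : ℕ} {s : State} {L : ℕ} (hL : 1 ≤ L) (h19 : s.nreg 19 < m)
    (hpass : s.rreg 68 ≤ s.rarr 14 (s.nreg 19)) :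
    Runs (scan m) s (scanCost m * L) (fun s' =>
      ((s'.nreg 20 < m ∧ s.rreg 68 ≤ s.rarr 14 (s'.nreg 20)) ∧
        (s'.nreg 21 < m ∧ s.rreg 68 ≤ s.rarr 14 (s'.nreg 21)) ∧
        ∀ k < m, s.rreg 68 ≤ s.rarr 14 k →
          keyVal s (s'.nreg 20) ≤ keyVal s k ∧ keyVal s k ≤ keyVal s (s'.nreg 21)) ∧
      Frame (scan m) s s') := by
  refine Runs.frame ?_
  refine (Runs.straight_mul (c := scanInit) hL s).seq_mul ?_
  rintro s0 ⟨e0, f0⟩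
  refine (Runs.forLoop_mul hL (fun k s' => s'.nreg 18 = k ∧ Frame scanStep s0 s' ∧
    (s'.nreg 20 < m ∧ s.rreg 68 ≤ s.rarr 14 (s'.nreg 20)) ∧
    (s'.nreg 21 < m ∧ s.rreg 68 ≤ s.rarr 14 (s'.nreg 21)) ∧
    ∀ l < k, s.rreg 68 ≤ s.rarr 14 l →
      keyVal s (s'.nreg 20) ≤ keyVal s l ∧ keyVal s l ≤ keyVal s (s'.nreg 21)) m ?_ ?_ ?_).weaken
      le_rfl ?_
  · rintro k s1 - ⟨hk, -⟩
    simp [hk]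
  · rintro k s1 hk ⟨h18, hf, ⟨h20, h20'⟩, ⟨h21, h21'⟩, hall⟩
    refine (Runs.straight_mul (c := scanStep) hL s1).weaken le_rfl ?_
    rintro s2 ⟨e2, f2⟩
    have k68 : s1.rreg 68 = s.rreg 68 := by rw [hf.rreg 68, f0.rreg 68]
    have k14 : s1.rarr 14 = s.rarr 14 := by rw [hf.rarr 14, f0.rarr 14]
    have hkey : ∀ l, s1.rreg 70 * s1.rarr 13 l - s1.rreg 71 * s1.rarr 12 l = keyVal s l := by
      intro l
      rw [hf.rreg 70, f0.rreg 70, hf.rreg 71, f0.rreg 71, hf.rarr 12, f0.rarr 12, hf.rarr 13,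
        f0.rarr 13]
      rfl
    have i18 : s2.nreg 18 = k + 1 := by
      rw [e2]
      by_cases c1 : s.rreg 68 ≤ s.rarr 14 k <;>
      by_cases c2 : keyVal s (s1.nreg 20) ≤ keyVal s k <;>
      by_cases c3 : keyVal s k ≤ keyVal s (s1.nreg 21) <;>
        simp [scanStep, key, hkey, k68, k14, h18, c1, c2, c3]
    have i20 : s2.nreg 20 = if s.rreg 68 ≤ s.rarr 14 k ∧ ¬ keyVal s (s1.nreg 20) ≤ keyVal s k
        then k else s1.nreg 20 := by
      rw [e2]
      by_cases c1 : s.rreg 68 ≤ s.rarr 14 k <;>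
      by_cases c2 : keyVal s (s1.nreg 20) ≤ keyVal s k <;>
      by_cases c3 : keyVal s k ≤ keyVal s (s1.nreg 21) <;>
        simp [scanStep, key, hkey, k68, k14, h18, c1, c2, c3]
    have i21 : s2.nreg 21 = if s.rreg 68 ≤ s.rarr 14 k ∧ ¬ keyVal s k ≤ keyVal s (s1.nreg 21)
        then k else s1.nreg 21 := by
      rw [e2]
      by_cases c1 : s.rreg 68 ≤ s.rarr 14 k <;>
      by_cases c2 : keyVal s (s1.nreg 20) ≤ keyVal s k <;>
      by_cases c3 : keyVal s k ≤ keyVal s (s1.nreg 21) <;>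
        simp [scanStep, key, hkey, k68, k14, h18, c1, c2, c3]
    have m20 : keyVal s (s2.nreg 20) ≤ keyVal s (s1.nreg 20) ∧
        (s.rreg 68 ≤ s.rarr 14 k → keyVal s (s2.nreg 20) ≤ keyVal s k) := by
      rw [i20]
      split_ifs with c
      · exact ⟨(not_le.1 c.2).le, fun _ => le_rfl⟩
      · exact ⟨le_rfl, fun c1 => by_contra fun c2 => c ⟨c1, c2⟩⟩
    have m21 : keyVal s (s1.nreg 21) ≤ keyVal s (s2.nreg 21) ∧
        (s.rreg 68 ≤ s.rarr 14 k → keyVal s k ≤ keyVal s (s2.nreg 21)) := by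
      rw [i21]
      split_ifs with c
      · exact ⟨(not_le.1 c.2).le, fun _ => le_rfl⟩
      · exact ⟨le_rfl, fun c1 => by_contra fun c2 => c ⟨c1, c2⟩⟩
    refine ⟨i18, hf.trans f2, ?_, ?_, ?_⟩
    · rw [i20]
      split_ifs with c
      · exact ⟨hk, c.1⟩
      · exact ⟨h20, h20'⟩
    · rw [i21]
      split_ifs with c
      · exact ⟨hk, c.1⟩
      · exact ⟨h21, h21'⟩
    · intro l hl hp
      rcases Nat.lt_succ_iff_lt_or_eq.1 hl with hl | rfl
      · obtain ⟨q1, q2⟩ := hall l hl hp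
        exact ⟨m20.1.trans q1, q2.trans m21.1⟩
      · exact ⟨m20.2 hp, m21.2 hp⟩
  · have j20 : s0.nreg 20 = s.nreg 19 := by rw [e0]; simp [scanInit]
    have j21 : s0.nreg 21 = s.nreg 19 := by rw [e0]; simp [scanInit]
    refine ⟨by rw [e0]; simp [scanInit], Frame.refl _ _, ?_, ?_, by simp⟩
    · rw [j20]; exact ⟨h19, hpass⟩
    · rw [j21]; exact ⟨h19, hpass⟩
  · rintro s' ⟨-, -, h1, h2, h3⟩
    exact ⟨h1, h2, h3⟩

end RealRAM

namespace RealRAM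

/-! ### Refinement of a box -/

/-- Compute the threshold and choose the first coordinate as the key.  The threshold is at most the
largest sampled value, so that at least one sample passes, whatever the box is. -/
def refineA : Prog :=
  .setReal 68 ((rc 1 - rr 59) * rr 67) ;;
  .ite (.realLE (rr 68) (rr 67)) .skip (.setReal 68 (rr 67)) ;;
  .setReal 70 (rc 0) ;; .setReal 71 (rc (-1))

/-- Compute the new slope and choose the sheared second coordinate as the key. -/
def refineB : Prog :=
  .setReal 74 (.load 12 (nr 20)) ;; .setReal 75 (.load 12 (nr 21)) ;;
  .setReal 76 ((.load 13 (nr 21) - .load 13 (nr 20)) / (rr 75 - rr 74)) ;;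
  .setReal 70 (rc 1) ;; .setReal 71 (rr 76)

/-- Compute the new box. -/
def refineC (q : ℕ) : Prog :=
  .setReal 72 (key (nr 20)) ;; .setReal 73 (key (nr 21)) ;; .setReal 77 (rr 61 / rc q) ;;
  .setReal 78 ((rr 64 + .sqrt ((rr 76 - rr 62) * (rr 76 - rr 62)) * rr 61) / rc q) ;;
  .setReal 60 (rr 74 - rr 77) ;; .setReal 61 (rr 75 - rr 74 + (rr 77 + rr 77)) ;;
  .setReal 62 (rr 76) ;; .setReal 63 (rr 72 - rr 78) ;;
  .setReal 64 (rr 73 - rr 72 + (rr 78 + rr 78))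

/-- Sample the current box and replace it by the smallest box around the passing samples, slightly
enlarged. -/
def refineBox (N q : ℕ) : Prog :=
  fill N ;; refineA ;; scan (gridCount N) ;; refineB ;; scan (gridCount N) ;; refineC q

/-- The running time of `refineBox`, without the logarithmic factor. -/
def refineCost (N q : ℕ) : ℕ :=
  fillCost N + (refineA.bound + (scanCost (gridCount N) + (refineB.bound +
    (scanCost (gridCount N) + (refineC q).bound))))

theorem refineBox_runs {n : ℕ} {p : Fin n → Plane} (hp : IsConvexPolygon p) {ψ : ℝ} {N q : ℕ}
    {s : State} (h : RowEnv p ψ s) (ho : OutEnv p ψ s) (hbest : BestOK p s) :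
    Runs (refineBox N q) s (refineCost N q * (Nat.clog 2 n + 1)) (fun s' =>
      (BestOK p s' ∧ s.rreg 30 ≤ s'.rreg 30 ∧ ∀ m γ ρ : ℝ, s.rreg 59 = γ → ρ / 4 = 1 / q → 0 < m →
        0 < γ → γ < 1 → 0 < ρ → 1 < N * (ρ * (ρ / 4)) → ρ ≤ 1 →
        (∀ c z, z ∈ Lev (polygonRegion p) (vert p 0) ψ c → c ≤ m) →
        0 < (boxOf s).W → 0 < (boxOf s).U →
        (∀ z ∈ Lev (polygonRegion p) (vert p 0) ψ ((1 - γ) * m), (boxOf s).Mem z) →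
        (boxOf s).Core ρ (Lev (polygonRegion p) (vert p 0) ψ ((1 - γ / 4) * m)) →
        (boxOf s').Fat (1 / 16) (Lev (polygonRegion p) (vert p 0) ψ ((1 - γ) * m)) ∧
          (1 - γ / 4) * m ≤ s'.rreg 30) ∧ Frame (refineBox N q) s s') := by
  have hL : 1 ≤ Nat.clog 2 n + 1 := by omega
  refine Runs.frame ?_
  refine (fill_runs hp h ho hbest).seq_mul ?_
  rintro s1 ⟨⟨inv, h30⟩, f1⟩
  have hcnt : 0 < gridCount N := by unfold gridCount; positivity
  obtain ⟨hkM, hVM⟩ : s1.nreg 19 < gridCount N ∧ s1.rarr 14 (s1.nreg 19) = s1.rreg 67 := by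
    rcases inv.max with hh | hh
    · omega
    · exact hh
  refine (Runs.straight_mul (c := refineA) hL s1).seq_mul ?_
  rintro s2 ⟨e2, f2⟩
  have g68 : s2.rreg 68 = min ((1 - s1.rreg 59) * s1.rreg 67) (s1.rreg 67) := by
    rw [e2]
    by_cases c : (1 - s1.rreg 59) * s1.rreg 67 ≤ s1.rreg 67
    · simp [refineA, c]
    · simp [refineA, c, le_of_not_ge]
  have g70 : s2.rreg 70 = 0 := by rw [e2]; simp [refineA]
  have g71 : s2.rreg 71 = -1 := by rw [e2]; simp [refineA]
  have g19 : s2.nreg 19 = s1.nreg 19 := f2.nreg 19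
  have g14 : s2.rarr 14 = s1.rarr 14 := f2.rarr 14
  have g12 : s2.rarr 12 = s1.rarr 12 := f2.rarr 12
  have g13 : s2.rarr 13 = s1.rarr 13 := f2.rarr 13
  refine (scan_runs hL (by rw [g19]; exact hkM)
    (by rw [g68, g19, g14, hVM]; exact min_le_right _ _)).seq_mul ?_
  rintro s3 ⟨⟨⟨lo1, lo1'⟩, ⟨hi1, hi1'⟩, all1⟩, f3⟩
  simp only [keyVal, g70, g71, g14, g12, g68, zero_mul, zero_sub, neg_mul, one_mul, neg_neg]
    at lo1' hi1' all1
  refine (Runs.straight_mul (c := refineB) hL s3).seq_mul ?_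
  rintro s4 ⟨e4, f4⟩
  have j68 : s4.rreg 68 = s2.rreg 68 := by rw [f4.rreg 68, f3.rreg 68]
  have j19 : s4.nreg 19 = s1.nreg 19 := by rw [f4.nreg 19, f3.nreg 19, g19]
  have j14 : s4.rarr 14 = s1.rarr 14 := by rw [f4.rarr 14, f3.rarr 14, g14]
  have j12 : s4.rarr 12 = s1.rarr 12 := by rw [f4.rarr 12, f3.rarr 12, g12]
  have j13 : s4.rarr 13 = s1.rarr 13 := by rw [f4.rarr 13, f3.rarr 13, g13]
  have j12' : s3.rarr 12 = s1.rarr 12 := by rw [f3.rarr 12, g12]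
  have j13' : s3.rarr 13 = s1.rarr 13 := by rw [f3.rarr 13, g13]
  have j70 : s4.rreg 70 = 1 := by rw [e4]; simp [refineB]
  have j71 : s4.rreg 71 = s4.rreg 76 := by rw [e4]; simp [refineB]
  have j74 : s4.rreg 74 = s1.rarr 12 (s3.nreg 20) := by rw [e4]; simp [refineB, j12']
  have j75 : s4.rreg 75 = s1.rarr 12 (s3.nreg 21) := by rw [e4]; simp [refineB, j12']
  have j76 : s4.rreg 76 = (s1.rarr 13 (s3.nreg 21) - s1.rarr 13 (s3.nreg 20)) /
      (s1.rarr 12 (s3.nreg 21) - s1.rarr 12 (s3.nreg 20)) := by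
    rw [e4]; simp [refineB, j12', j13']
  refine (scan_runs hL (by rw [j19]; exact hkM)
    (by rw [j68, g68, j19, j14, hVM]; exact min_le_right _ _)).seq_mul ?_
  rintro s5 ⟨⟨⟨lo2, lo2'⟩, ⟨hi2, hi2'⟩, all2⟩, f5⟩
  simp only [keyVal, j70, j71, j14, j12, j13, j68, g68, one_mul] at lo2' hi2' all2
  refine (Runs.straight_mul (c := refineC q) hL s5).weaken le_rfl ?_
  rintro s6 ⟨e6, f6⟩
  have k70 : s5.rreg 70 = 1 := by rw [f5.rreg 70, j70]
  have k71 : s5.rreg 71 = s4.rreg 76 := by rw [f5.rreg 71, j71]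
  have k76 : s5.rreg 76 = s4.rreg 76 := by rw [f5.rreg 76]
  have k74 : s5.rreg 74 = s1.rarr 12 (s3.nreg 20) := by rw [f5.rreg 74, j74]
  have k75 : s5.rreg 75 = s1.rarr 12 (s3.nreg 21) := by rw [f5.rreg 75, j75]
  have k12 : s5.rarr 12 = s1.rarr 12 := by rw [f5.rarr 12, j12]
  have k13 : s5.rarr 13 = s1.rarr 13 := by rw [f5.rarr 13, j13]
  have kbox : boxOf s5 = boxOf s := by
    rw [boxOf_frame f5, boxOf_frame f4, boxOf_frame f3, boxOf_frame f2, boxOf_frame f1]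
  have k61 : s5.rreg 61 = (boxOf s).W := congrArg SBox.W kbox
  have k62 : s5.rreg 62 = (boxOf s).σ := congrArg SBox.σ kbox
  have k64 : s5.rreg 64 = (boxOf s).U := congrArg SBox.U kbox
  have i30 : s6.rreg 30 = s1.rreg 30 := by
    rw [f6.rreg 30, f5.rreg 30, f4.rreg 30, f3.rreg 30, f2.rreg 30]
  refine ⟨((((inv.best.frame f2).frame f3).frame f4).frame f5).frame f6, i30 ▸ h30, ?_⟩
  intro m γ ρ hγ hq hm hγ0 hγ1 hρ hN hρ1 hlem hW hU hsub hcore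
  have S : Sampling (Lev (polygonRegion p) (vert p 0) ψ) m γ ρ N (boxOf s) (gridCount N)
      (s1.rarr 12) (s1.rarr 13) (s1.rarr 14) (s1.rreg 67) :=
    { fam := Lev.concaveFamily (polygonRegion_convex p) _ _
      m_pos := hm
      γ_pos := hγ0
      γ_lt := hγ1
      ρ_pos := hρ
      N_large := hN
      ρ_le := hρ1
      le_m := hlem
      W_pos := hW
      U_pos := hU
      sub := hsub
      core := hcore
      grid := fun i hi j hj => by
        have hlt : i * (N + 1) + j < gridCount N := by unfold gridCount; nlinarith
        exact ⟨_, hlt, inv.grid i j hj hlt⟩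
      val_mem := fun k hk hv => (inv.val k hk).2.1 hv
      val_ge := fun k hk => (inv.val k hk).2.2
      le_M := fun k hk => (inv.val k hk).1
      M_eq := ⟨_, hkM, hVM⟩ }
  refine ⟨?_, ?_⟩
  · have hthr : min ((1 - s1.rreg 59) * s1.rreg 67) (s1.rreg 67) = (1 - γ) * s1.rreg 67 := by
      rw [f1.rreg 59, hγ]
      exact min_eq_left (by nlinarith [S.M_pos])
    simp only [hthr] at lo1' hi1' all1 lo2' hi2' all2
    have hfat := S.fat (σ' := s4.rreg 76) ⟨_, lo1, lo1', rfl, rfl⟩ ⟨_, hi1, hi1', rfl, rfl⟩ all1 j76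
      ⟨_, lo2, lo2', rfl⟩ ⟨_, hi2, hi2', rfl⟩ all2
    rw [hq] at hfat
    convert hfat using 1
    have habs : √((s4.rreg 76 - (boxOf s).σ) * (s4.rreg 76 - (boxOf s).σ))
        = |s4.rreg 76 - (boxOf s).σ| := Real.sqrt_mul_self_eq_abs _
    generalize (boxOf s).W = bW at k61 ⊢
    generalize (boxOf s).σ = bσ at k62 habs ⊢
    generalize (boxOf s).U = bU at k64 ⊢
    rw [e6]
    simp only [boxOf, SBox.mk.injEq]
    refine ⟨?_, ?_, ?_, ?_, ?_⟩
    · simp [refineC, key, k74, k61]; ring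
    · simp [refineC, key, k74, k75, k61]; ring
    · simp [refineC, key, k76]
    · simp [refineC, key, k61, k62, k64, k70, k71, k76, k12, k13, habs]; ring
    · simp [refineC, key, k61, k62, k64, k70, k71, k76, k12, k13, habs]; ring
  · rw [i30]
    exact S.M_ge.trans inv.le_best

end RealRAM

/-! ### Transfer of fat boxes between directions -/

/-- A convex set `S` of size `D` and width `w` (with respect to the direction `θ₀`), together with
the square root `m` of the largest area of a rectangle in `S` and the angle `ψ₀` of such a
rectangle. -/
structure Extremal (S : Set Plane) (o : Plane) (D w m θ₀ ψ₀ : ℝ) : Prop where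
  conv : Convex ℝ S
  D_pos : 0 < D
  w_pos : 0 < w
  w_le : w ≤ D
  m_pos : 0 < m
  hD : ∀ q ∈ S, (q 0 - o 0) ^ 2 + (q 1 - o 1) ^ 2 ≤ D ^ 2
  hY : ∀ q ∈ S, |relY o θ₀ q| ≤ w
  hm : D * w / 16 ≤ m ^ 2
  le_m : ∀ ψ c z, z ∈ Lev S o ψ c → c ≤ m
  opt : ∃ z, z ∈ Lev S o ψ₀ m

namespace Extremal

variable {S : Set Plane} {o : Plane} {D w m θ₀ ψ₀ : ℝ}

/-- `Lev.rotate`, where the angle need not be assumed to be small: this follows from the bound on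
the translation. -/
theorem rotate (h : Extremal S o D w m θ₀ ψ₀) {ψ ψ' c δ e : ℝ} (hc : m / 2 ≤ c) (hδ : δ ≤ 1)
    (h3 : 3 * D * |ψ' - ψ| ≤ e) (he : e ≤ δ * w / 256) {z : ℝ × ℝ} (hz : z ∈ Lev S o ψ c) :
    (z.1 + e, z.2 - e) ∈ Lev S o ψ' ((1 - δ) * c) := by
  have hD := h.D_pos
  have hw := h.w_pos
  have hτ : |ψ' - ψ| ≤ 1 := by
    by_contra hn
    push Not at hn
    have : D * 1 < D * |ψ' - ψ| := mul_lt_mul_of_pos_left hn hD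
    have : δ * w ≤ 1 * w := mul_le_mul_of_nonneg_right hδ hw.le
    linarith [h.w_le]
  have := Lev.rotate h.conv hD h.hD h.m_pos.le h.hm hc hδ hτ h3 he hw hz
  rwa [add_sub_cancel] at this

/-- A fat box for a direction `ψ` becomes, after a small translation, an almost fat box for a
nearby direction `ψ'`, with respect to a level that is closer to the maximum.  The higher level is
reached by moving the core towards an optimal rectangle, at the cost of the factor `1 / 32`. -/
theorem transfer (h : Extremal S o D w m θ₀ ψ₀) {ψ ψ' γ e β : ℝ} {b : SBox} (hγ : 0 < γ)
    (hγ1 : γ ≤ 1 / 4) (h1 : 3 * D * |ψ' - ψ| ≤ e) (h2 : 3 * D * |ψ' - ψ₀| ≤ e)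
    (he : e ≤ γ / 16 * w / 256) (hb : b.Fat β (Lev S o ψ ((1 - γ) * m))) :
    (∀ z ∈ Lev S o ψ' ((1 - γ / 2) * m),
      SBox.Mem ⟨b.tl - e, b.W, b.σ, b.cl + e * (1 + b.σ), b.U⟩ z) ∧
    SBox.Core ⟨b.tl - e, b.W, b.σ, b.cl + e * (1 + b.σ), b.U⟩ (1 / 32 * β)
      (Lev S o ψ' ((1 - γ / 2 / 4) * m)) := by
  have hm := h.m_pos
  have fam := Lev.concaveFamily h.conv o ψ'
  refine ⟨fun z hz => ?_, ?_⟩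
  · have hz' := h.rotate (ψ' := ψ) (δ := γ / 16) (by nlinarith) (by linarith)
      (by rwa [abs_sub_comm]) he hz
    have hpos : 0 ≤ (7 * γ / 16 + γ * γ / 32) * m := by positivity
    have := hb.mem _ (Lev.anti S o ψ (c := (1 - γ) * m) (by linarith) hz')
    simp only [SBox.Mem] at this ⊢
    refine ⟨⟨?_, ?_⟩, ?_, ?_⟩ <;> linarith [this.1.1, this.1.2, this.2.1, this.2.2]
  · obtain ⟨z₀, hz₀⟩ := h.opt
    have hz' := h.rotate (ψ' := ψ') (δ := γ / 16) (by linarith) (by linarith) h2 he hz₀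
    obtain ⟨t₀, u₀, hc⟩ := hb.core
    have hcore : SBox.Core ⟨b.tl - e, b.W, b.σ, b.cl + e * (1 + b.σ), b.U⟩ β
        (Lev S o ψ' ((1 - γ / 16) * ((1 - γ) * m))) := by
      refine ⟨t₀ + e, u₀ - e * (1 + b.σ), fun t u k1 k2 k3 k4 => ?_⟩
      simp only at k2 k4 ⊢
      have := h.rotate (ψ' := ψ') (δ := γ / 16) (by nlinarith) (by linarith) h1 he
        (hc (t - e) (u + e * (1 + b.σ)) (by linarith) (by linarith) (by linarith) (by linarith))
      convert this using 1
      simp only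
      congr 1
      · ring
      · ring
    have := hcore.shrink fam hz' (r := 1 / 32) (by norm_num) (by norm_num)
    refine this.mono le_rfl hb.W_pos.le hb.U_pos.le (Lev.anti S o ψ' ?_)
    have : (1 - 1 / 32) * ((1 - γ / 16) * m) + 1 / 32 * ((1 - γ / 16) * ((1 - γ) * m))
      = (1 - γ / 2 / 4) * m + (γ / 32 + γ * γ / 512) * m := by ring
    rw [this]
    have : 0 ≤ (γ / 32 + γ * γ / 512) * m := by positivity
    linarith

/-- A square box of the size of the width is fat for all directions close to that of an optimal
rectangle: all heights are at most `321 * w ≤ 512 * E`, and the second side of the optimal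
rectangle is at least `w / 128`. -/
theorem fat_square (h : Extremal S o D w m θ₀ ψ₀) {ψ E : ℝ} (hE1 : w ≤ E) (hE2 : E ≤ 2 * w)
    (h1 : D * |ψ - θ₀| ≤ 320 * w) (h2 : 3 * D * |ψ - ψ₀| ≤ w / 16384) :
    SBox.Fat ⟨-(512 * E), 1024 * E, 0, -(512 * E), 1024 * E⟩ (1 / 2 ^ 22)
      (Lev S o ψ ((1 - 1 / 4) * m)) := by
  have hD := h.D_pos
  have hw := h.w_pos
  have hm := h.m_pos
  have hY : ∀ q ∈ S, |relY o ψ q| ≤ 321 * w := by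
    intro q hq
    have e1 : relY o ψ q = relY o θ₀ q * Real.cos (ψ - θ₀) - relX o θ₀ q * Real.sin (ψ - θ₀) := by
      have hs := Real.sin_sq_add_cos_sq θ₀
      simp only [relX, relY, Real.cos_sub, Real.sin_sub]
      linear_combination (-(q 1 - o 1) * Real.cos ψ + (q 0 - o 0) * Real.sin ψ) * hs
    have hX : |relX o θ₀ q| ≤ D := by
      have hs := Real.sin_sq_add_cos_sq θ₀
      refine abs_le_of_sq_le_sq ?_ hD.le
      refine le_trans ?_ (h.hD q hq)
      have : relX o θ₀ q ^ 2 + relY o θ₀ q ^ 2 = (q 0 - o 0) ^ 2 + (q 1 - o 1) ^ 2 := by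
        simp only [relX, relY]
        linear_combination ((q 0 - o 0) ^ 2 + (q 1 - o 1) ^ 2) * hs
      linarith [sq_nonneg (relY o θ₀ q)]
    rw [e1]
    refine (abs_sub _ _).trans ?_
    rw [abs_mul, abs_mul]
    have a1 : |relY o θ₀ q| * |Real.cos (ψ - θ₀)| ≤ w * 1 :=
      mul_le_mul (h.hY q hq) (Real.abs_cos_le_one _) (abs_nonneg _) hw.le
    have a2 : |relX o θ₀ q| * |Real.sin (ψ - θ₀)| ≤ D * |ψ - θ₀| :=
      mul_le_mul hX Real.abs_sin_le_abs (abs_nonneg _) hD.le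
    linarith
  refine ⟨by simp only; linarith, by simp only; linarith, ?_, ?_⟩
  · rintro z ⟨x₁, x₂, hf, -⟩
    have k1 := hY _ hf.h11
    have k2 := hY _ hf.h12
    rw [relY_framePt, abs_le] at k1 k2
    refine ⟨⟨?_, ?_⟩, ?_, ?_⟩ <;> simp only <;> linarith [k1.1, k1.2, k2.1, k2.2]
  · obtain ⟨z₀, hz₀⟩ := h.opt
    obtain ⟨x₁, x₂, hf, hA⟩ := h.rotate (ψ' := ψ) (δ := 1 / 64) (e := w / 16384) (by linarith)
      (by norm_num) h2 (by linarith) hz₀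
    set y₁ := (z₀.1 + w / 16384, z₀.2 - w / 16384).1
    set y₂ := (z₀.1 + w / 16384, z₀.2 - w / 16384).2
    have hside := (Fits.sides_ge hD h.hD hm.le h.hm (by linarith) hf hA).2
    have hx := hf.hx
    refine ⟨y₁, y₂ - (y₂ - y₁) / 16, fun t u k1 k2 k3 k4 => ?_⟩
    simp only at k2 k4 ⊢
    rw [zero_mul, add_zero]
    have hsz : 1 / 2 ^ 22 * (1024 * E) ≤ (y₂ - y₁) / 16 := by norm_num; linarith
    refine Lev.shrink h.conv hf k1 (by linarith) (by linarith) ?_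
    have hle : (7 / 8) ^ 2 * ((x₂ - x₁) * (y₂ - y₁)) ≤ (x₂ - x₁) * (u - t) := by
      have : (7 / 8) * (y₂ - y₁) ≤ u - t := by linarith
      have h3 := mul_le_mul_of_nonneg_left this (show 0 ≤ x₂ - x₁ by linarith)
      have h4 : 0 ≤ (x₂ - x₁) * (y₂ - y₁) := mul_nonneg (by linarith) (by linarith)
      linarith
    refine le_trans ?_ (Real.sqrt_le_sqrt hle)
    rw [Real.sqrt_mul (by norm_num), Real.sqrt_sq (by norm_num)]
    linarith

end Extremal

namespace RealRAM

/-! ### The memory after the preprocessing -/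

/-- The rows for the directions `θ + k * α`, `k < K`, are available. -/
structure Rows {n : ℕ} (p : Fin n → Plane) (K : ℕ) (θ α : ℝ) (s : State) : Prop where
  hn : s.nreg 0 = n
  hK : s.nreg 1 = K
  h0 : s.rarr 0 0 = vert p 0 0
  h1 : s.rarr 1 0 = vert p 0 1
  hcos : ∀ k < K, s.rarr 2 k = Real.cos (θ + k * α)
  hsin : ∀ k < K, s.rarr 3 k = Real.sin (θ + k * α)
  hX : ∀ k < K, ∀ i < n, s.rarr 4 (k * n + i) = rotatedX (θ + k * α) (vert p i)
  hY : ∀ k < K, ∀ i < n, s.rarr 5 (k * n + i) = rotatedY (θ + k * α) (vert p i)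

theorem Rows.frame {n : ℕ} {p : Fin n → Plane} {K : ℕ} {θ α : ℝ} {s s' : State} {c : Prog}
    (h : Rows p K θ α s) (hf : Frame c s s') (h0 : c.wNat 0 = false := by rfl)
    (h1 : c.wNat 1 = false := by rfl) (a0 : c.wRealArr 0 = false := by rfl)
    (a1 : c.wRealArr 1 = false := by rfl) (a2 : c.wRealArr 2 = false := by rfl)
    (a3 : c.wRealArr 3 = false := by rfl) (a4 : c.wRealArr 4 = false := by rfl)
    (a5 : c.wRealArr 5 = false := by rfl) : Rows p K θ α s' := by
  refine ⟨(hf.nreg 0 h0).trans h.hn, (hf.nreg 1 h1).trans h.hK, ?_, ?_, ?_, ?_, ?_, ?_⟩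
  · rw [hf.rarr 0 a0]; exact h.h0
  · rw [hf.rarr 1 a1]; exact h.h1
  · rw [hf.rarr 2 a2]; exact h.hcos
  · rw [hf.rarr 3 a3]; exact h.hsin
  · rw [hf.rarr 4 a4]; exact h.hX
  · rw [hf.rarr 5 a5]; exact h.hY

theorem rows_preparedState {n : ℕ} {p : Fin n → Plane} (hn : 0 < n) (ε : ℝ) (K : ℕ) (θ α : ℝ) :
    Rows p K θ α (preparedState p ε K θ α) := by
  have hlt : ∀ k < K, ∀ i < n, k * n + i < K * n := fun k hk i hi => by nlinarith
  have hdiv : ∀ k i, i < n → (k * n + i) / n = k := fun k i hi => by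
    rw [mul_comm, Nat.mul_add_div hn, Nat.div_eq_of_lt hi, add_zero]
  have hmod : ∀ k i, i < n → (k * n + i) % n = i := fun k i hi => by
    rw [mul_comm, Nat.mul_add_mod, Nat.mod_eq_of_lt hi]
  refine ⟨rfl, rfl, ?_, ?_, fun k hk => ?_, fun k hk => ?_, fun k hk i hi => ?_,
    fun k hk i hi => ?_⟩
  · simp [preparedState, arrayOf, hn, vert]
  · simp [preparedState, arrayOf, hn, vert]
  · simp [preparedState, arrayOf, hk]
  · simp [preparedState, arrayOf, hk]
  · simp [preparedState, arrayOf, hlt k hk i hi, vert, hi, Fin.divNat, Fin.modNat, hdiv k i hi,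
      hmod k i hi]
  · simp [preparedState, arrayOf, hlt k hk i hi, vert, hi, Fin.divNat, Fin.modNat, hdiv k i hi,
      hmod k i hi]

theorem rotatedX_sub (ψ : ℝ) (x o : Plane) : rotatedX ψ x - rotatedX ψ o = relX o ψ x := by
  simp only [rotatedX, relX]; ring

theorem rotatedY_sub (ψ : ℝ) (x o : Plane) : rotatedY ψ x - rotatedY ψ o = relY o ψ x := by
  simp only [rotatedY, relY]; ring

/-- Load the direction and the first vertex of the row whose index is in the natural register `3`
and whose first index in the arrays of coordinates is in the natural register `4`. -/
def loadRow : Prog :=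
  .setReal 20 (.load 4 (nr 4)) ;; .setReal 21 (.load 5 (nr 4)) ;; .setReal 50 (.load 2 (nr 3)) ;;
  .setReal 51 (.load 3 (nr 3))

theorem Rows.rowEnv {n : ℕ} {p : Fin n → Plane} {K : ℕ} {θ α : ℝ} {s : State}
    (h : Rows p K θ α s) (hn : 0 < n) {k : ℕ} (hk : k < K) (h4 : s.nreg 4 = k * n)
    (h20 : s.rreg 20 = s.rarr 4 (s.nreg 4)) (h21 : s.rreg 21 = s.rarr 5 (s.nreg 4)) :
    RowEnv p (θ + k * α) s := by
  have e4 := h.hX k hk 0 hn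
  have e5 := h.hY k hk 0 hn
  rw [add_zero] at e4 e5
  refine ⟨h.hn, fun i hi => ?_, fun i hi => ?_⟩
  · rw [h20, h4, h.hX k hk i hi, e4, rotatedX_sub]; rfl
  · rw [h21, h4, h.hY k hk i hi, e5, rotatedY_sub]; rfl

theorem loadRow_env {n : ℕ} {p : Fin n → Plane} {K : ℕ} {θ α : ℝ} {s s' : State}
    (h : Rows p K θ α s) (hn : 0 < n) {k : ℕ} (hk : k < K) (h3 : s.nreg 3 = k)
    (h4 : s.nreg 4 = k * n) (hs : s' = loadRow.den s) (hf : Frame loadRow s s') :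
    RowEnv p (θ + k * α) s' ∧ OutEnv p (θ + k * α) s' := by
  have h' := h.frame hf
  refine ⟨h'.rowEnv hn hk ((hf.nreg 4).trans h4) ?_ ?_, ?_, ?_, h'.h0, h'.h1⟩
  · rw [hf.rarr 4, hf.nreg 4, hs]; simp [loadRow]
  · rw [hf.rarr 5, hf.nreg 4, hs]; simp [loadRow]
  · rw [hs, ← h.hcos k hk]; simp [loadRow, h3]
  · rw [hs, ← h.hsin k hk]; simp [loadRow, h3]

/-! ### The root of the tree of directions -/

/-- Compute the product of the natural registers `0` and `1` in register `7`, by repeated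
addition. -/
def mulKN : Prog :=
  (.setNat 5 (nc 0) ;; .setNat 7 (nc 0)) ;;
  .loop (.not (.natLE (nr 1) (nr 5))) (.setNat 5 (nr 5 + nc 1) ;; .setNat 7 (nr 7 + nr 0))

theorem mulKN_runs {s : State} {n K : ℕ} (h0 : s.nreg 0 = n) (h1 : s.nreg 1 = K) :
    Runs mulKN s (14 * K + 14) (fun s' => s'.nreg 7 = K * n ∧ Frame mulKN s s') := by
  refine Runs.frame ?_
  have hpre := Runs.straight_frame (c := .setNat 5 (nc 0) ;; .setNat 7 (nc 0)) s
  refine (hpre.seq (B' := K * (4 + 8 + 1) + (4 + 1)) ?_).mono ?_ fun _ h => h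
  · rintro s1 ⟨e1, f1⟩
    refine (Runs.forLoop (B := 8) (fun j s' => s'.nreg 5 = j ∧ s'.nreg 7 = j * n ∧
      s'.nreg 0 = n ∧ s'.nreg 1 = K) K ?_ ?_ ?_).mono le_rfl ?_
    · rintro j s2 - ⟨h5, -, -, h1'⟩
      simp [h5, h1']
    · rintro j s2 - ⟨h5, h7, h0', h1'⟩
      refine (Runs.straight_frame s2).mono (le_of_eq rfl) ?_
      rintro s3 ⟨rfl, -⟩
      simp [h5, h7, h0', h1']
      ring
    · rw [e1]; simp [h0, h1]
    · rintro s2 ⟨-, h7, -⟩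
      exact h7
  · have : (Prog.setNat 5 (nc 0) ;; Prog.setNat 7 (nc 0)).bound = 4 := rfl
    omega

/-- Compute the height of the highest (`σ = 1`) or lowest (`σ = -1`) vertex of a row. -/
def extreme (σ : ℤ) : Prog :=
  .setReal 24 (rc σ) ;; apex ;; .setNat 10 (nr 12) ;; loadV

theorem extreme_runs {n : ℕ} {p : Fin n → Plane} (hp : IsConvexPolygon p) {ψ : ℝ} {s : State}
    (h : RowEnv p ψ s) (σ : ℤ) :
    Runs (extreme σ) s ((extreme σ).bound * (Nat.clog 2 n + 1)) (fun s' =>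
      ((∃ q ∈ polygonRegion p, relY (vert p 0) ψ q = s'.rreg 23) ∧
        ∀ q ∈ polygonRegion p, σ * relY (vert p 0) ψ q ≤ σ * s'.rreg 23) ∧
      Frame (extreme σ) s s') := by
  have hn := hp.1
  have hL : 1 ≤ Nat.clog 2 n + 1 := by omega
  refine Runs.frame ?_
  refine (Runs.straight_mul hL s).seq_bound ?_
  rintro s1 ⟨e1, f1⟩
  refine (apex_runs (σ := σ) hp (h.frame f1) (by rw [e1]; simp)).seq_bound ?_
  rintro s2 ⟨⟨-, han, hmax⟩, f2⟩
  refine (Runs.straight_mul hL s2).seq_bound ?_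
  rintro s3 ⟨e3, f3⟩
  have i3 : s3.nreg 10 = s2.nreg 12 := by rw [e3]; simp
  refine (loadV_runs hL (((h.frame f1).frame f2).frame f3) (by omega)).weaken le_rfl ?_
  rintro s4 ⟨-, e4, -⟩
  rw [i3] at e4
  rw [e4]
  exact ⟨⟨_, vert_mem p (by omega) _, rfl⟩, hmax⟩

/-- Compute the width in the middle direction (real register `58`), and store the root of the tree
of directions. -/
def initTree : Prog :=
  mulKN ;; (.setNat 3 (.half (nr 1)) ;; .setNat 4 (.half (nr 7)) ;; loadRow) ;;
  extreme 1 ;; .setReal 57 (rr 23) ;; extreme (-1) ;;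
  (.setReal 58 (rr 57 - rr 23) ;; .storeNat 0 (nc 1) (nc 0) ;; .storeNat 1 (nc 1) (nr 1) ;;
    .storeNat 2 (nc 1) (nc 0) ;; .storeNat 3 (nc 1) (nr 7) ;;
    .storeReal 6 (nc 1) (rc (2 ^ 24)) ;; .setReal 30 (rc 0) ;; .setNat 2 (nc 2))

/-- Node `2 ^ i + r` of the tree of directions stands for the directions with the indices
`r * 2 ^ (J - i) + l`, `l < 2 ^ (J - i)`.  The machine cannot multiply natural numbers in one step;
therefore the products with `n`, which are needed for access to the coordinates, are stored, too. -/
def NodeData (n J : ℕ) (s : State) (i r : ℕ) : Prop :=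
  s.narr 0 (2 ^ i + r) = r * 2 ^ (J - i) ∧ s.narr 1 (2 ^ i + r) = 2 ^ (J - i) ∧
  s.narr 2 (2 ^ i + r) = r * 2 ^ (J - i) * n ∧ s.narr 3 (2 ^ i + r) = 2 ^ (J - i) * n ∧
  s.rarr 6 (2 ^ i + r) = 2 ^ 24 / 2 ^ i

/-- The running time of `initTree`, without the factor `K` and the logarithmic factor. -/
def initCost : ℕ :=
  28 + (Prog.bound (.setNat 3 (.half (nr 1)) ;; .setNat 4 (.half (nr 7)) ;; loadRow) +
    ((extreme 1).bound + ((Prog.setReal 57 (rr 23)).bound + ((extreme (-1)).bound + 34))))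

theorem initTree_runs {n : ℕ} {p : Fin n → Plane} (hp : IsConvexPolygon p) {J : ℕ} (hJ : 0 < J)
    {θ α : ℝ} {s : State} (h : Rows p (2 ^ J) θ α s) :
    Runs initTree s (initCost * (2 ^ J * (Nat.clog 2 n + 1))) (fun s' =>
      (s'.nreg 2 = 2 ∧ s'.rreg 30 = 0 ∧ NodeData n J s' 0 0 ∧
      ∃ a b, s'.rreg 58 = a - b ∧
        (∃ q ∈ polygonRegion p, relY (vert p 0) (θ + (2 ^ (J - 1) : ℕ) * α) q = a) ∧
        (∃ q ∈ polygonRegion p, relY (vert p 0) (θ + (2 ^ (J - 1) : ℕ) * α) q = b) ∧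
        ∀ q ∈ polygonRegion p, b ≤ relY (vert p 0) (θ + (2 ^ (J - 1) : ℕ) * α) q ∧
          relY (vert p 0) (θ + (2 ^ (J - 1) : ℕ) * α) q ≤ a) ∧ Frame initTree s s') := by
  have hn := hp.1
  have hL : 1 ≤ Nat.clog 2 n + 1 := by omega
  have hJ' : 2 ^ J = 2 * 2 ^ (J - 1) := by rw [← pow_succ', Nat.sub_add_cancel hJ]
  have h2J : 0 < 2 ^ (J - 1) := by positivity
  have hmono : ∀ x : ℕ, x * (Nat.clog 2 n + 1) ≤ x * (2 ^ J * (Nat.clog 2 n + 1)) := fun x =>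
    Nat.mul_le_mul_left _ (Nat.le_mul_of_pos_left _ (by positivity))
  have hL' : 1 ≤ 2 ^ J * (Nat.clog 2 n + 1) := Nat.mul_pos (by positivity) hL
  refine Runs.frame ?_
  refine ((mulKN_runs h.hn h.hK).mono (B' := 28 * (2 ^ J * (Nat.clog 2 n + 1))) ?_
    fun _ h => h).seq_mul ?_
  · have : 2 ^ J * 1 ≤ 2 ^ J * (Nat.clog 2 n + 1) := Nat.mul_le_mul_left _ hL
    omega
  rintro s1 ⟨e1, f1⟩
  have w1 := h.frame f1
  refine (Runs.straight_mul hL' s1).seq_mul ?_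
  rintro s2 ⟨e2, f2⟩
  have w2 := w1.frame f2
  have i4 : s2.nreg 4 = 2 ^ (J - 1) * n := by
    rw [e2]; simp [loadRow, e1]
    rw [hJ', mul_assoc, Nat.mul_div_cancel_left _ (by norm_num)]
  have r2 : RowEnv p (θ + (2 ^ (J - 1) : ℕ) * α) s2 := by
    refine w2.rowEnv (by omega) (by omega) i4 ?_ ?_
    · rw [e2]; simp [loadRow]
    · rw [e2]; simp [loadRow]
  refine ((extreme_runs hp r2 1).mono (hmono _) fun _ h => h).seq_mul ?_
  rintro s3 ⟨⟨hq3, h3⟩, f3⟩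
  refine (Runs.straight_mul hL' s3).seq_mul ?_
  rintro s4 ⟨e4, f4⟩
  refine ((extreme_runs hp ((r2.frame f3).frame f4) (-1)).mono (hmono _) fun _ h => h).seq_mul ?_
  rintro s5 ⟨⟨hq5, h5⟩, f5⟩
  refine (Runs.straight_mul hL' s5).weaken (by decide) ?_
  rintro s6 ⟨rfl, -⟩
  have g57 : s5.rreg 57 = s3.rreg 23 := by rw [f5.rreg 57, e4]; simp
  have g1 : s5.nreg 1 = 2 ^ J := by
    rw [f5.nreg 1, f4.nreg 1, f3.nreg 1]; exact w2.hK
  have g7 : s5.nreg 7 = 2 ^ J * n := by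
    rw [f5.nreg 7, f4.nreg 7, f3.nreg 7, f2.nreg 7, e1]
  refine ⟨by simp, by simp, ?_, s3.rreg 23, s5.rreg 23, by simp [g57], hq3, hq5, fun q hq => ?_⟩
  · refine ⟨?_, ?_, ?_, ?_, ?_⟩ <;> simp [g1, g7]
    norm_num
  · have k3 := h3 q hq
    have k5 := h5 q hq
    push_cast at k3 k5 ⊢
    constructor <;> linarith

end RealRAM

namespace RealRAM

/-! ### The nodes of the tree of directions -/

/-- Compute the data of the node whose number is in the natural register `2` from those of its
parent, whose number is stored in register `5`. -/
def nodeMeta : Prog :=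
  .setNat 5 (.half (nr 2)) ;; .setNat 3 (.load 0 (nr 5)) ;; .setNat 6 (.half (.load 1 (nr 5))) ;;
  .setNat 4 (.load 2 (nr 5)) ;; .setNat 7 (.half (.load 3 (nr 5))) ;;
  .ite (.natLE (nr 2) (nr 5 + nr 5)) .skip (.setNat 3 (nr 3 + nr 6) ;; .setNat 4 (nr 4 + nr 7)) ;;
  .storeNat 0 (nr 2) (nr 3) ;; .storeNat 1 (nr 2) (nr 6) ;; .storeNat 2 (nr 2) (nr 4) ;;
  .storeNat 3 (nr 2) (nr 7) ;; .setReal 59 (.load 6 (nr 5) / rc 2) ;;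
  .storeReal 6 (nr 2) (rr 59)

theorem nodeMeta_den {n J i r r' : ℕ} {s : State} (hi : i + 1 ≤ J)
    (hr : r = 2 * r' ∨ r = 2 * r' + 1) (h2 : s.nreg 2 = 2 ^ (i + 1) + r)
    (h : NodeData n J s i r') :
    (nodeMeta.den s).nreg 3 = r * 2 ^ (J - (i + 1)) ∧
    (nodeMeta.den s).nreg 4 = r * 2 ^ (J - (i + 1)) * n ∧
    (nodeMeta.den s).nreg 5 = 2 ^ i + r' ∧
    (nodeMeta.den s).rreg 59 = 2 ^ 24 / 2 ^ (i + 1) ∧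
    NodeData n J (nodeMeta.den s) (i + 1) r ∧
    ∀ i' r', 2 ^ i' + r' ≠ 2 ^ (i + 1) + r → NodeData n J s i' r' →
      NodeData n J (nodeMeta.den s) i' r' := by
  obtain ⟨d0, d1, d2, d3, d6⟩ := h
  obtain ⟨a, ha, ha'⟩ : ∃ a, a = 2 ^ (J - (i + 1)) ∧ 2 ^ (J - i) = 2 * a :=
    ⟨_, rfl, by rw [← pow_succ']; congr 1; omega⟩
  rw [ha'] at d0 d1 d2 d3
  have hp : 2 ^ (i + 1) = 2 * 2 ^ i := pow_succ' _ _
  have hpR : (2 : ℝ) ^ (i + 1) = 2 * 2 ^ i := pow_succ' _ _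
  have hv : (2 ^ (i + 1) + r) / 2 = 2 ^ i + r' := by omega
  have e1 : 2 * a / 2 = a := by omega
  have e2 : 2 * a * n / 2 = a * n := by
    rw [mul_assoc, Nat.mul_div_cancel_left _ (by norm_num)]
  have e3 : (2 : ℝ) ^ 24 / 2 ^ i / 2 = 2 ^ 24 / 2 ^ (i + 1) := by
    rw [hpR, div_div, mul_comm]
  rw [← ha]
  unfold NodeData
  rw [← ha]
  rcases hr with rfl | rfl
  · have hc : 2 ^ (i + 1) + 2 * r' ≤ 2 ^ i + r' + (2 ^ i + r') := by omega
    have f1 : r' * (2 * a) = 2 * r' * a := by ring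
    rw [f1] at d0 d2
    refine ⟨?_, ?_, ?_, ?_, ⟨?_, ?_, ?_, ?_, ?_⟩, ?_⟩
    all_goals try simp [nodeMeta, h2, hv, hc, d0, d1, d2, d3, d6, e1, e2, e3]
    intro i' q hne k0 k1 k2 k3 k6
    simp [hne, k0, k1, k2, k3, k6]
  · have hc : ¬ 2 ^ (i + 1) + (2 * r' + 1) ≤ 2 ^ i + r' + (2 ^ i + r') := by omega
    have f1 : r' * (2 * a) + a = (2 * r' + 1) * a := by ring
    have f2 : r' * (2 * a) * n + a * n = (2 * r' + 1) * a * n := by ring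
    refine ⟨?_, ?_, ?_, ?_, ⟨?_, ?_, ?_, ?_, ?_⟩, ?_⟩
    all_goals try simp [nodeMeta, h2, hv, hc, d0, d1, d2, d3, d6, e1, e2, e3, f1, f2]
    intro i' q hne k0 k1 k2 k3 k6
    simp [hne, k0, k1, k2, k3, k6]

/-- The box that is stored for node `v`. -/
def boxAt (s : State) (v : ℕ) : SBox :=
  ⟨s.rarr 7 v, s.rarr 8 v, s.rarr 9 v, s.rarr 10 v, s.rarr 11 v⟩

/-- Load the box of the parent and translate it.  The directions of parent and child differ by at
most half the range of the parent, and the translation by `γ * E / 4096` (real registers `59` and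
`58`) makes up for this. -/
def loadBox : Prog :=
  .setReal 77 (rr 59 * rr 58 / rc 4096) ;; .setReal 60 (.load 7 (nr 5) - rr 77) ;;
  .setReal 61 (.load 8 (nr 5)) ;; .setReal 62 (.load 9 (nr 5)) ;;
  .setReal 63 (.load 10 (nr 5) + rr 77 * (rc 1 + rr 62)) ;; .setReal 64 (.load 11 (nr 5))

/-- The square box that is used up to depth `26`, where the tolerance is `1 / 4` or larger. -/
def rootBox : Prog :=
  .setReal 60 (rc 0 - rc 512 * rr 58) ;; .setReal 61 (rc 1024 * rr 58) ;; .setReal 62 (rc 0) ;;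
  .setReal 63 (rc 0 - rc 512 * rr 58) ;; .setReal 64 (rc 1024 * rr 58)

/-- Store the box of a node, and go to the next node. -/
def storeBox : Prog :=
  .storeReal 7 (nr 2) (rr 60) ;; .storeReal 8 (nr 2) (rr 61) ;; .storeReal 9 (nr 2) (rr 62) ;;
  .storeReal 10 (nr 2) (rr 63) ;; .storeReal 11 (nr 2) (rr 64) ;; .setNat 2 (nr 2 + nc 1)

/-- Process a node.  The nodes with numbers from `2 ^ 27` on are those of depth at least `27`. -/
def nodeStep (N q : ℕ) : Prog :=
  nodeMeta ;; loadRow ;;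
  .ite (.natLE (nc (2 ^ 27)) (nr 2)) (loadBox ;; refineBox N q) rootBox ;; storeBox

/-- The running time of `nodeStep`, without the logarithmic factor. -/
def nodeCost (N q : ℕ) : ℕ :=
  nodeMeta.bound + (loadRow.bound + ((3 + (loadBox.bound + refineCost N q + rootBox.bound) + 1) +
    storeBox.bound))

/-- The geometric facts about the `2 ^ J` directions `θ + k * α` that the search relies on. -/
structure Directions (S : Set Plane) (o : Plane) (D w m θ₀ ψ₀ E θ α : ℝ) (J : ℕ) : Prop where
  ext : Extremal S o D w m θ₀ ψ₀
  le_E : w ≤ E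
  E_le : E ≤ 2 * w
  α_pos : 0 < α
  α_le : D * (2 ^ J * α) ≤ 640 * w
  J_pos : 0 < J
  start : θ = θ₀ - 2 ^ (J - 1) * α

/-- The angle `ψ₀` lies in the range of node `2 ^ i + r`. -/
def InRange (θ α ψ₀ : ℝ) (J i r : ℕ) : Prop :=
  θ + (r * 2 ^ (J - i) : ℕ) * α ≤ ψ₀ ∧
    ψ₀ ≤ θ + (r * 2 ^ (J - i) : ℕ) * α + (2 ^ (J - i) : ℕ) * α

/-- The result of processing node `2 ^ i + r`, with the tolerance `2 ^ 24 / 2 ^ i`: if the range of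
the node contains `ψ₀`, then the box is fat, and (below depth `26`, where no rectangles are
evaluated) a good rectangle has been found; `best` is the square root of its area. -/
def NodeGood (S : Set Plane) (o : Plane) (m θ α ψ₀ : ℝ) (J i r : ℕ) (b : SBox) (best : ℝ) : Prop :=
  InRange θ α ψ₀ J i r →
    b.Fat (1 / 2 ^ 22) (Lev S o (θ + (r * 2 ^ (J - i) : ℕ) * α) ((1 - 2 ^ 24 / 2 ^ i) * m)) ∧
      (27 ≤ i → (1 - 2 ^ 24 / 2 ^ i / 4) * m ≤ best)

namespace Directions

variable {S : Set Plane} {o : Plane} {D w m θ₀ ψ₀ E θ α : ℝ} {J : ℕ}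

theorem width_le (h : Directions S o D w m θ₀ ψ₀ E θ α J) {i : ℕ} (hi : i ≤ J) :
    D * ((2 ^ (J - i) : ℕ) * α) ≤ 640 * w / 2 ^ i := by
  rw [le_div_iff₀ (by positivity)]
  refine le_trans (le_of_eq ?_) h.α_le
  have : (2 : ℝ) ^ J = 2 ^ (J - i) * 2 ^ i := by rw [← pow_add, Nat.sub_add_cancel hi]
  push_cast
  rw [this]
  ring

theorem root (h : Directions S o D w m θ₀ ψ₀ E θ α J) {i r : ℕ} (hi : i = 26) (hiJ : i ≤ J)
    (hr : r < 2 ^ i) (best : ℝ) :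
    NodeGood S o m θ α ψ₀ J i r ⟨-(512 * E), 1024 * E, 0, -(512 * E), 1024 * E⟩ best := by
  rintro ⟨h1, h2⟩
  refine ⟨?_, fun hh => by omega⟩
  have hD := h.ext.D_pos
  have hα := h.α_pos
  have hwid := h.width_le hiJ
  set l : ℕ := 2 ^ (J - i)
  have e : (2 : ℝ) ^ 24 / 2 ^ i = 1 / 4 := by rw [hi]; norm_num
  rw [e]
  refine h.ext.fat_square h.le_E h.E_le ?_ ?_
  · have hk : r * l < 2 ^ J := by
      calc r * l < 2 ^ i * l := Nat.mul_lt_mul_of_pos_right hr (by positivity)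
        _ = 2 ^ J := by rw [← pow_add, Nat.add_sub_cancel' hiJ]
    have hJ' : 2 ^ J = 2 * 2 ^ (J - 1) := by rw [← pow_succ', Nat.sub_add_cancel h.J_pos]
    have hkR : ((r * l : ℕ) : ℝ) ≤ 2 * 2 ^ (J - 1) := by
      have : r * l ≤ 2 * 2 ^ (J - 1) := by omega
      exact_mod_cast this
    have hαle := h.α_le
    have hJR : (2 : ℝ) ^ J = 2 * 2 ^ (J - 1) := by exact_mod_cast hJ'
    have habs : |θ + (r * l : ℕ) * α - θ₀| ≤ 2 ^ (J - 1) * α := by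
      rw [h.start, abs_le]
      have h0 : (0 : ℝ) ≤ ((r * l : ℕ) : ℝ) := Nat.cast_nonneg _
      constructor <;> nlinarith
    rw [hJR] at hαle
    nlinarith [mul_le_mul_of_nonneg_left habs hD.le]
  · have habs : |θ + (r * l : ℕ) * α - ψ₀| ≤ l * α := by
      rw [abs_le]; constructor <;> linarith
    have := mul_le_mul_of_nonneg_left habs hD.le
    rw [hi] at hwid
    norm_num at hwid
    linarith [h.ext.w_pos]

theorem InRange.parent {i r r' : ℕ} (hi : i + 1 ≤ J) (hr : r = 2 * r' ∨ r = 2 * r' + 1)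
    (hα : 0 < α) (h : InRange θ α ψ₀ J (i + 1) r) :
    InRange θ α ψ₀ J i r' ∧
      |θ + (r * 2 ^ (J - (i + 1)) : ℕ) * α - (θ + (r' * 2 ^ (J - i) : ℕ) * α)|
        ≤ (2 ^ (J - (i + 1)) : ℕ) * α := by
  obtain ⟨a, ha, ha'⟩ : ∃ a, a = 2 ^ (J - (i + 1)) ∧ 2 ^ (J - i) = 2 * a :=
    ⟨_, rfl, by rw [← pow_succ']; congr 1; omega⟩
  unfold InRange at *
  rw [ha']
  rw [← ha] at h ⊢
  have h0 : (0 : ℝ) ≤ a * α := mul_nonneg (Nat.cast_nonneg _) hα.le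
  rcases hr with rfl | rfl <;> push_cast at h ⊢ <;> refine ⟨⟨?_, ?_⟩, ?_⟩ <;>
    first | (rw [abs_le]; constructor <;> nlinarith [h.1, h.2]) | nlinarith [h.1, h.2]

/-- The facts that make the refinement of a translated box of the parent correct.  The new core has
the relative size `(1 / 2 ^ 22) * (1 / 32)`; the refinement improves this to `1 / 16`. -/
theorem child (h : Directions S o D w m θ₀ ψ₀ E θ α J) {i r r' : ℕ} (hi : i + 1 ≤ J)
    (hi' : 26 ≤ i) (hr : r = 2 * r' ∨ r = 2 * r' + 1) {b : SBox} {best : ℝ}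
    (hin : InRange θ α ψ₀ J (i + 1) r) (hb : NodeGood S o m θ α ψ₀ J i r' b best) {e : ℝ}
    (he : e = 2 ^ 24 / 2 ^ (i + 1) * E / 4096) :
    0 < b.W ∧ 0 < b.U ∧
    (∀ z ∈ Lev S o (θ + (r * 2 ^ (J - (i + 1)) : ℕ) * α) ((1 - 2 ^ 24 / 2 ^ (i + 1)) * m),
      SBox.Mem ⟨b.tl - e, b.W, b.σ, b.cl + e * (1 + b.σ), b.U⟩ z) ∧
    SBox.Core ⟨b.tl - e, b.W, b.σ, b.cl + e * (1 + b.σ), b.U⟩ (1 / 2 ^ 27)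
      (Lev S o (θ + (r * 2 ^ (J - (i + 1)) : ℕ) * α) ((1 - 2 ^ 24 / 2 ^ (i + 1) / 4) * m)) := by
  have hD := h.ext.D_pos
  have hw := h.ext.w_pos
  obtain ⟨hin', hdist⟩ := InRange.parent hi hr h.α_pos hin
  obtain ⟨hfat, -⟩ := hb hin'
  have hwid := h.width_le hi
  have hpR : (2 : ℝ) ^ (i + 1) = 2 * 2 ^ i := pow_succ' _ _
  have h2i : (2 : ℝ) ^ 26 ≤ 2 ^ i := pow_le_pow_right₀ (by norm_num) hi'
  obtain ⟨x, hx⟩ : ∃ x : ℝ, x = 1 / 2 ^ i := ⟨_, rfl⟩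
  have hx0 : 0 < x := by rw [hx]; positivity
  have hx1 : x ≤ 1 / 2 ^ 26 := by
    rw [hx]; exact one_div_le_one_div_of_le (by norm_num) h2i
  have e1 : (2 : ℝ) ^ 24 / 2 ^ i = 2 ^ 24 * x := by rw [hx]; ring
  have e2 : (2 : ℝ) ^ 24 / 2 ^ (i + 1) = 2 ^ 24 * x / 2 := by rw [hx, hpR]; field_simp
  have e3 : 640 * w / 2 ^ (i + 1) = 320 * w * x := by rw [hx, hpR]; field_simp; norm_num
  rw [e1] at hfat
  rw [e2] at he ⊢
  rw [e3] at hwid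
  norm_num at hx1
  have hψ : |θ + (r * 2 ^ (J - (i + 1)) : ℕ) * α - ψ₀| ≤ (2 ^ (J - (i + 1)) : ℕ) * α := by
    rw [abs_le]; constructor <;> linarith [hin.1, hin.2]
  have hEx : w * x ≤ E * x := mul_le_mul_of_nonneg_right h.le_E hx0.le
  have hEx' : E * x ≤ 2 * w * x := mul_le_mul_of_nonneg_right h.E_le hx0.le
  have hwx : 0 < w * x := mul_pos hw hx0
  have hbd : ∀ d, d ≤ (2 ^ (J - (i + 1)) : ℕ) * α → 3 * D * d ≤ e := by
    intro d hd
    have := mul_le_mul_of_nonneg_left hd hD.le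
    rw [he]
    norm_num
    linarith
  obtain ⟨c1, c2⟩ := h.ext.transfer (γ := 2 ^ 24 * x) (e := e) (by positivity)
    (by norm_num; linarith) (hbd _ hdist) (hbd _ hψ) (by rw [he]; norm_num; linarith) hfat
  refine ⟨hfat.W_pos, hfat.U_pos, c1, ?_⟩
  convert c2 using 1
  norm_num

end Directions

end RealRAM

namespace RealRAM

theorem add_mul_add_one_le (a X : ℕ) {L : ℕ} (hL : 1 ≤ L) :
    a + X * L + 1 ≤ (a + X + 1) * L := by
  nlinarith

theorem loadBox_runs {s : State} {L : ℕ} (hL : 1 ≤ L) :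
    Runs loadBox s (loadBox.bound * L) (fun s' =>
      boxOf s' = ⟨(boxAt s (s.nreg 5)).tl - s.rreg 59 * s.rreg 58 / 4096, (boxAt s (s.nreg 5)).W,
        (boxAt s (s.nreg 5)).σ, (boxAt s (s.nreg 5)).cl +
          s.rreg 59 * s.rreg 58 / 4096 * (1 + (boxAt s (s.nreg 5)).σ), (boxAt s (s.nreg 5)).U⟩ ∧
      Frame loadBox s s') := by
  refine (Runs.straight_mul (c := loadBox) hL s).weaken le_rfl ?_
  rintro s' ⟨rfl, hf⟩
  exact ⟨by simp [loadBox, boxOf, boxAt], hf⟩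

theorem rootBox_runs {s : State} {L : ℕ} (hL : 1 ≤ L) :
    Runs rootBox s (rootBox.bound * L) (fun s' =>
      boxOf s' = ⟨-(512 * s.rreg 58), 1024 * s.rreg 58, 0, -(512 * s.rreg 58), 1024 * s.rreg 58⟩ ∧
      Frame rootBox s s') := by
  refine (Runs.straight_mul (c := rootBox) hL s).weaken le_rfl ?_
  rintro s' ⟨rfl, hf⟩
  exact ⟨by simp [rootBox, boxOf], hf⟩

theorem two_pow_add_inj {i r i' r' : ℕ} (hr : r < 2 ^ i) (hr' : r' < 2 ^ i')
    (h : 2 ^ i + r = 2 ^ i' + r') : i = i' ∧ r = r' := by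
  have key : ∀ {a b x y : ℕ}, x < 2 ^ a → 2 ^ a + x = 2 ^ b + y → ¬ a < b := by
    intro a b x y hx hxy hab
    have h1 : 2 ^ (a + 1) ≤ 2 ^ b := Nat.pow_le_pow_right (by norm_num) hab
    have h2 : 2 ^ (a + 1) = 2 * 2 ^ a := pow_succ' _ _
    omega
  obtain rfl : i = i' := le_antisymm (not_lt.1 (key hr' h.symm)) (not_lt.1 (key hr h))
  exact ⟨rfl, by omega⟩

/-- All nodes with a number less than `v` have been processed. -/
structure TreeInv {n : ℕ} (p : Fin n → Plane) (m θ α ψ₀ E : ℝ) (J v : ℕ) (s : State) : Prop where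
  rows : Rows p (2 ^ J) θ α s
  best : BestOK p s
  hv : s.nreg 2 = v
  hE : s.rreg 58 = E
  data : ∀ i r, r < 2 ^ i → i ≤ J → 2 ^ i + r < v → NodeData n J s i r
  good : ∀ i r, r < 2 ^ i → 26 ≤ i → i ≤ J → 2 ^ i + r < v →
    NodeGood (polygonRegion p) (vert p 0) m θ α ψ₀ J i r (boxAt s (2 ^ i + r)) (s.rreg 30)

theorem nodeStep_runs {n : ℕ} {p : Fin n → Plane} (hp : IsConvexPolygon p)
    {D w m θ₀ ψ₀ E θ α : ℝ} {J : ℕ} {N q : ℕ}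
    (G : Directions (polygonRegion p) (vert p 0) D w m θ₀ ψ₀ E θ α J)
    (hq : (1 / 2 ^ 27 : ℝ) / 4 = 1 / q) (hN : (1 : ℝ) < N * (1 / 2 ^ 27 * (1 / 2 ^ 27 / 4)))
    {i r : ℕ} (hi : i + 1 ≤ J) (hr : r < 2 ^ (i + 1)) {s : State}
    (h : TreeInv p m θ α ψ₀ E J (2 ^ (i + 1) + r) s) :
    Runs (nodeStep N q) s (nodeCost N q * (Nat.clog 2 n + 1))
      (TreeInv p m θ α ψ₀ E J (2 ^ (i + 1) + r + 1)) := by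
  have hn := hp.1
  have hL : 1 ≤ Nat.clog 2 n + 1 := by omega
  have hpow : 2 ^ (i + 1) = 2 * 2 ^ i := pow_succ' _ _
  obtain ⟨r', hr', hrr⟩ : ∃ r', r' < 2 ^ i ∧ (r = 2 * r' ∨ r = 2 * r' + 1) :=
    ⟨r / 2, by omega, by omega⟩
  have hpar := h.data i r' hr' (by omega) (by omega)
  obtain ⟨m3, m4, m5, m59, mdata, mold⟩ := nodeMeta_den hi hrr h.hv hpar
  have hk : r * 2 ^ (J - (i + 1)) < 2 ^ J := by
    calc r * 2 ^ (J - (i + 1)) < 2 ^ (i + 1) * 2 ^ (J - (i + 1)) :=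
          Nat.mul_lt_mul_of_pos_right hr (by positivity)
      _ = 2 ^ J := by rw [← pow_add, Nat.add_sub_cancel' hi]
  set v := 2 ^ (i + 1) + r with hv
  set k := r * 2 ^ (J - (i + 1)) with hkdef
  have frame_data : ∀ {c : Prog} {t t' : State} {i' q' : ℕ}, Frame c t t' →
      c.wNatArr 0 = false → c.wNatArr 1 = false → c.wNatArr 2 = false → c.wNatArr 3 = false →
      c.wRealArr 6 = false → NodeData n J t i' q' → NodeData n J t' i' q' := by
    intro c t t' i' q' hf a0 a1 a2 a3 a6 hd
    unfold NodeData at *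
    rw [hf.narr 0 a0, hf.narr 1 a1, hf.narr 2 a2, hf.narr 3 a3, hf.rarr 6 a6]
    exact hd
  have frame_box : ∀ {c : Prog} {t t' : State} (u : ℕ), Frame c t t' →
      c.wRealArr 7 = false → c.wRealArr 8 = false → c.wRealArr 9 = false →
      c.wRealArr 10 = false → c.wRealArr 11 = false → boxAt t' u = boxAt t u := by
    intro c t t' u hf a7 a8 a9 a10 a11
    unfold boxAt
    rw [hf.rarr 7 a7, hf.rarr 8 a8, hf.rarr 9 a9, hf.rarr 10 a10, hf.rarr 11 a11]
  unfold nodeCost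
  refine (Runs.straight_mul (c := nodeMeta) hL s).seq_mul ?_
  rintro s1 ⟨e1, f1⟩
  rw [← e1] at m3 m4 m5 m59 mdata mold
  have w1 := h.rows.frame f1
  refine (Runs.straight_mul (c := loadRow) hL s1).seq_mul ?_
  rintro s2 ⟨e2, f2⟩
  obtain ⟨row2, out2⟩ := loadRow_env w1 (by omega) hk m3 m4 e2 f2
  have w2 := w1.frame f2
  have b2 : BestOK p s2 := (h.best.frame f1).frame f2
  have v2 : s2.nreg 2 = v := by rw [f2.nreg 2, f1.nreg 2, h.hv]
  have E2 : s2.rreg 58 = E := by rw [f2.rreg 58, f1.rreg 58, h.hE]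
  have p2 : s2.nreg 5 = 2 ^ i + r' := by rw [f2.nreg 5, m5]
  have γ2 : s2.rreg 59 = 2 ^ 24 / 2 ^ (i + 1) := by rw [f2.rreg 59, m59]
  have r2 : s2.rreg 30 = s.rreg 30 := by rw [f2.rreg 30, f1.rreg 30]
  have box2 : ∀ u, boxAt s2 u = boxAt s u := fun u => by
    rw [frame_box u f2 rfl rfl rfl rfl rfl, frame_box u f1 rfl rfl rfl rfl rfl]
  have hbody : Runs (.ite (.natLE (nc (2 ^ 27)) (nr 2)) (loadBox ;; refineBox N q) rootBox) s2
      ((3 + (loadBox.bound + refineCost N q + rootBox.bound) + 1) * (Nat.clog 2 n + 1))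
      (fun s' => BestOK p s' ∧ s2.rreg 30 ≤ s'.rreg 30 ∧ (26 ≤ i + 1 →
        NodeGood (polygonRegion p) (vert p 0) m θ α ψ₀ J (i + 1) r (boxOf s') (s'.rreg 30))) := by
    refine (Runs.ite (B := (loadBox.bound + refineCost N q + rootBox.bound) * (Nat.clog 2 n + 1))
      ?_ ?_).mono ?_ fun _ h => h
    · intro hc
      have hc : 2 ^ 27 ≤ v := by simpa [v2] using hc
      have hi26 : 26 ≤ i := by
        by_contra hlt
        have : 2 ^ (i + 1) ≤ 2 ^ 26 := Nat.pow_le_pow_right (by norm_num) (by omega)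
        omega
      refine Runs.weaken (C := loadBox.bound + refineCost N q)
        ((loadBox_runs hL).seq_mul (Q' := fun s' => BestOK p s' ∧ s2.rreg 30 ≤ s'.rreg 30 ∧
          (26 ≤ i + 1 → NodeGood (polygonRegion p) (vert p 0) m θ α ψ₀ J (i + 1) r (boxOf s')
            (s'.rreg 30))) ?_) (by omega) fun _ h => h
      rintro s3 ⟨e3, f3⟩
      refine (refineBox_runs hp (row2.frame f3) (out2.frame f3) (b2.frame f3)).weaken le_rfl ?_
      rintro s4 ⟨⟨b4, le4, H⟩, f4⟩
      refine ⟨b4, (f3.rreg 30) ▸ le4, fun _ hin => ?_⟩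
      rw [γ2, E2, p2, box2] at e3
      obtain ⟨c1, c2, c3, c4⟩ := G.child (e := 2 ^ 24 / 2 ^ (i + 1) * E / 4096) hi hi26 hrr hin
        (h.good i r' hr' hi26 (by omega) (by omega)) rfl
      have hx : (2 : ℝ) ^ 24 / 2 ^ (i + 1) ≤ 1 / 8 := by
        have : (2 : ℝ) ^ 27 ≤ 2 ^ (i + 1) := pow_le_pow_right₀ (by norm_num) (by omega)
        rw [div_le_iff₀ (by positivity)]
        linarith
      obtain ⟨k1, k2⟩ := H m (2 ^ 24 / 2 ^ (i + 1)) (1 / 2 ^ 27) ((f3.rreg 59).trans γ2) hq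
        G.ext.m_pos (by positivity) (by linarith) (by norm_num) hN (by norm_num)
        (fun c z => G.ext.le_m _ c z) (by rw [e3]; exact c1) (by rw [e3]; exact c2)
        (by rw [e3]; exact c3) (by rw [e3]; exact c4)
      exact ⟨⟨k1.W_pos, k1.U_pos, k1.mem, k1.core.mono (by norm_num) k1.W_pos.le k1.U_pos.le
        fun _ h => h⟩, fun _ => k2⟩
    · intro hc
      have hc : v < 2 ^ 27 := by simpa [v2] using hc
      refine Runs.weaken (C := rootBox.bound) (rootBox_runs hL) (by omega) ?_
      rintro s3 ⟨e3, f3⟩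
      refine ⟨b2.frame f3, (f3.rreg 30).ge, fun hi26 => ?_⟩
      have hi' : i + 1 = 26 := by
        by_contra hne
        have : 2 ^ 27 ≤ 2 ^ (i + 1) := Nat.pow_le_pow_right (by norm_num) (by omega)
        omega
      rw [e3, E2]
      exact G.root hi' hi hr _
    · exact add_mul_add_one_le 3 _ hL
  refine hbody.frame.seq_mul ?_
  rintro s3 ⟨⟨b3, le3, good3⟩, f3⟩
  refine (Runs.straight_mul (c := storeBox) hL s3).weaken le_rfl ?_
  rintro s4 ⟨e4, f4⟩
  have v3 : s3.nreg 2 = v := (f3.nreg 2).trans v2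
  have box4 : boxAt s4 v = boxOf s3 := by
    rw [e4]; simp [storeBox, boxAt, boxOf, v3]
  have box4' : ∀ u, u ≠ v → boxAt s4 u = boxAt s u := by
    intro u hu
    rw [← box2, ← frame_box u f3 rfl rfl rfl rfl rfl, e4]
    simp [storeBox, boxAt, v3, hu]
  have r4 : s4.rreg 30 = s3.rreg 30 := f4.rreg 30
  have trans_data : ∀ {i' q'}, NodeData n J s1 i' q' → NodeData n J s4 i' q' := fun hd =>
    frame_data f4 rfl rfl rfl rfl rfl (frame_data f3 rfl rfl rfl rfl rfl
      (frame_data f2 rfl rfl rfl rfl rfl hd))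
  refine ⟨(w2.frame f3).frame f4, b3.frame f4, ?_, ?_, ?_, ?_⟩
  · rw [e4]; simp [storeBox, v3]
  · rw [f4.rreg 58, f3.rreg 58, E2]
  · intro i' q' hq' hi' hlt
    rcases Nat.lt_succ_iff_lt_or_eq.1 hlt with hlt | heq
    · exact trans_data (mold i' q' (by omega) (h.data i' q' hq' hi' hlt))
    · obtain ⟨rfl, rfl⟩ := two_pow_add_inj hq' hr heq
      exact trans_data mdata
  · intro i' q' hq' h26 hi' hlt
    rcases Nat.lt_succ_iff_lt_or_eq.1 hlt with hlt | heq
    · rw [box4' _ (by omega)]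
      intro hin
      obtain ⟨k1, k2⟩ := h.good i' q' hq' h26 hi' hlt hin
      exact ⟨k1, fun h27 => (k2 h27).trans (by rw [r4, ← r2]; exact le3)⟩
    · obtain ⟨rfl, rfl⟩ := two_pow_add_inj hq' hr heq
      rw [heq, box4, r4]
      exact good3 h26

/-! ### The solving program -/

/-- Copy the best rectangle to the output registers. -/
def output : Prog :=
  .setReal 0 (rr 31) ;; .setReal 1 (rr 32) ;; .setReal 2 (rr 33) ;; .setReal 3 (rr 34) ;;
  .setReal 4 (rr 35) ;; .setReal 5 (rr 36)

/-- Process the tree of directions from the root to the leaves, and output the best rectangle. -/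
def solve (N q : ℕ) : Prog :=
  initTree ;; .loop (.not (.natLE (nr 1 + nr 1) (nr 2))) (nodeStep N q) ;; output

/-- The running time of `solve`, without the factor `K` and the logarithmic factor. -/
def solveCost (N q : ℕ) : ℕ :=
  initCost + ((2 * (6 + nodeCost N q + 1) + 7) + output.bound)

/-- If the range of directions contains the angle `ψ₀` of a largest rectangle, the leaf whose block
contains `ψ₀` yields a rectangle that is large enough.  The number `E` in `Directions` is the extent
that the program computes in the middle direction. -/
theorem solve_runs {n : ℕ} {p : Fin n → Plane} (hp : IsConvexPolygon p)
    {D w m θ₀ ψ₀ θ α : ℝ} {J : ℕ} {N q : ℕ} (hJ : 27 ≤ J)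
    (G : ∀ E, w ≤ E → E ≤ 2 * w →
      Directions (polygonRegion p) (vert p 0) D w m θ₀ ψ₀ E θ α J)
    (hw : ∃ g ∈ polygonRegion p, |relY (vert p 0) θ₀ g| = w)
    (hψ₀ : |ψ₀ - θ₀| ≤ 2 ^ (J - 1) * α)
    (hq : (1 / 2 ^ 27 : ℝ) / 4 = 1 / q) (hN : (1 : ℝ) < N * (1 / 2 ^ 27 * (1 / 2 ^ 27 / 4)))
    {s : State} (h : Rows p (2 ^ J) θ α s) :
    Runs (solve N q) s (solveCost N q * (2 ^ J * (Nat.clog 2 n + 1))) (fun s' =>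
      ∃ R : Rectangle, R.region ⊆ polygonRegion p ∧
        ((1 - 2 ^ 24 / 2 ^ J / 4) * m) ^ 2 ≤ R.area ∧ s'.Outputs R) := by
  have hn := hp.1
  have hL : 1 ≤ Nat.clog 2 n + 1 := by omega
  have hL' : 1 ≤ 2 ^ J * (Nat.clog 2 n + 1) := Nat.mul_pos (by positivity) hL
  have hJ' : (2 : ℝ) ^ J = 2 * 2 ^ (J - 1) := by rw [← pow_succ', Nat.sub_add_cancel (by omega)]
  obtain ⟨g, hg, hgw⟩ := hw
  have hw0 : 0 ≤ w := hgw ▸ abs_nonneg _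
  have G0 := G w le_rfl (by linarith)
  have hα := G0.α_pos
  have hm := G0.ext.m_pos
  have ho : relY (vert p 0) θ₀ (vert p 0) = 0 := by simp [relY]
  unfold solveCost
  refine (initTree_runs hp (by omega) h).seq_mul ?_
  rintro s1 ⟨⟨v1, r1, d1, a, b, hab, ha, hb, hba⟩, f1⟩
  have hθ : θ + (2 ^ (J - 1) : ℕ) * α = θ₀ := by rw [G0.start]; push_cast; ring
  rw [hθ] at ha hb hba
  have hE1 : w ≤ a - b := by
    have k1 := hba g hg
    have k2 := hba _ (vert_mem p (by omega) 0)
    rw [ho] at k2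
    rw [← hgw]
    exact abs_le.2 ⟨by linarith, by linarith⟩
  have hE2 : a - b ≤ 2 * w := by
    obtain ⟨qa, hqa, rfl⟩ := ha
    obtain ⟨qb, hqb, rfl⟩ := hb
    linarith [(abs_le.1 (G0.ext.hY qa hqa)).2, (abs_le.1 (G0.ext.hY qb hqb)).1]
  have G1 := G (a - b) hE1 hE2
  have b1 : BestOK p s1 := ⟨r1.ge, fun hh => absurd r1 hh.ne'⟩
  have T1 : TreeInv p m θ α ψ₀ (a - b) J 2 s1 := by
    refine ⟨h.frame f1, b1, v1, hab, ?_, ?_⟩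
    · intro i r hr hi hlt
      have : i = 0 := by
        by_contra hne
        have : 2 ^ 1 ≤ 2 ^ i := Nat.pow_le_pow_right (by norm_num) (by omega)
        omega
      subst this
      obtain rfl : r = 0 := by omega
      exact d1
    · intro i r hr h26 hi hlt
      have : 2 ^ 1 ≤ 2 ^ i := Nat.pow_le_pow_right (by norm_num) (by omega)
      omega
  have hKN : 2 ≤ 2 ^ J := by
    calc 2 = 2 ^ 1 := rfl
      _ ≤ 2 ^ J := Nat.pow_le_pow_right (by norm_num) (by omega)
  have hloop := Runs.forLoop (b := .not (.natLE (nr 1 + nr 1) (nr 2))) (c := nodeStep N q)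
    (B := nodeCost N q * (Nat.clog 2 n + 1))
    (fun j s' => TreeInv p m θ α ψ₀ (a - b) J (j + 2) s') (2 * 2 ^ J - 2) ?_ ?_ (s := s1) T1
  · refine Runs.seq_mul (C := 2 * (6 + nodeCost N q + 1) + 7) (hloop.mono ?_ fun _ h => h) ?_
    · generalize nodeCost N q = B
      have hcost : (Test.not (.natLE (nr 1 + nr 1) (nr 2))).cost = 6 := rfl
      rw [hcost]
      have k1 : (2 * 2 ^ J - 2) * (6 + B * (Nat.clog 2 n + 1) + 1) ≤
          (2 * 2 ^ J) * ((6 + B + 1) * (Nat.clog 2 n + 1)) :=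
        Nat.mul_le_mul (Nat.sub_le _ _) (add_mul_add_one_le 6 _ hL)
      have k2 : (2 * (6 + B + 1) + 7) * (2 ^ J * (Nat.clog 2 n + 1)) =
        (2 * 2 ^ J) * ((6 + B + 1) * (Nat.clog 2 n + 1)) +
          7 * (2 ^ J * (Nat.clog 2 n + 1)) := by ring
      omega
    · intro s2 T2
      rw [show 2 * 2 ^ J - 2 + 2 = 2 * 2 ^ J by omega] at T2
      refine (Runs.straight_mul (c := output) hL' s2).weaken le_rfl ?_
      rintro s3 ⟨e3, -⟩
      -- the leaf whose range contains the angle `ψ₀`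
      obtain ⟨r, hr, hin⟩ : ∃ r, r < 2 ^ J ∧ InRange θ α ψ₀ J J r := by
        have hlo : θ ≤ ψ₀ := by rw [G0.start]; linarith [(abs_le.1 hψ₀).1]
        have hhi : ψ₀ ≤ θ + 2 ^ J * α := by rw [G0.start, hJ']; linarith [(abs_le.1 hψ₀).2]
        have hx0 : 0 ≤ (ψ₀ - θ) / α := div_nonneg (by linarith) hα.le
        by_cases hfl : ⌊(ψ₀ - θ) / α⌋₊ < 2 ^ J
        · have k1 := Nat.floor_le hx0
          have k2 := Nat.lt_floor_add_one ((ψ₀ - θ) / α)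
          refine ⟨_, hfl, ?_⟩
          rw [le_div_iff₀ hα] at k1
          rw [div_lt_iff₀ hα] at k2
          simp only [InRange, Nat.sub_self, pow_zero, mul_one, Nat.cast_one, one_mul]
          constructor <;> linarith
        · have k1 := Nat.floor_le hx0
          have k3 : ((2 ^ J : ℕ) : ℝ) ≤ (⌊(ψ₀ - θ) / α⌋₊ : ℝ) := by exact_mod_cast not_lt.1 hfl
          push_cast at k3
          have k4 := (le_div_iff₀ hα).1 (k3.trans k1)
          have hsub : ((2 ^ J - 1 : ℕ) : ℝ) = 2 ^ J - 1 := by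
            rw [Nat.cast_sub (by omega)]; norm_num
          refine ⟨2 ^ J - 1, by omega, ?_⟩
          simp only [InRange, Nat.sub_self, pow_zero, mul_one, Nat.cast_one, one_mul, hsub]
          constructor <;> linarith
      have hbest := (T2.good J r hr (by omega) le_rfl (by omega) hin).2 hJ
      have hx : (2 : ℝ) ^ 24 / 2 ^ J ≤ 1 := by
        rw [div_le_one (by positivity)]
        exact pow_le_pow_right₀ (by norm_num) (by omega)
      have hpos : 0 < (1 - 2 ^ 24 / 2 ^ J / 4) * m := mul_pos (by linarith) hm
      obtain ⟨R, hR, hA, o0, o1, o2, o3, o4, o5⟩ := T2.best.2 (hpos.trans_le hbest)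
      refine ⟨R, hR, ?_, ?_⟩
      · rw [hA]
        exact pow_le_pow_left₀ hpos.le hbest 2
      · rw [e3]
        simp [State.Outputs, output, o0, o1, o2, o3, o4, o5]
  · intro j s2 hj T
    simp only [Test.Holds, NatExpr.eval, T.rows.hK, T.hv]
    omega
  · intro j s2 hj T
    have hj2 : j + 2 ≠ 0 := by omega
    obtain ⟨l, hl, hl'⟩ : ∃ l, 2 ^ l ≤ j + 2 ∧ j + 2 < 2 ^ (l + 1) :=
      ⟨Nat.log 2 (j + 2), Nat.pow_log_le_self 2 hj2, Nat.lt_pow_succ_log_self (by norm_num) _⟩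
    have hl0 : l ≠ 0 := by
      rintro rfl
      omega
    obtain ⟨i, rfl⟩ := Nat.exists_eq_succ_of_ne_zero hl0
    have hiJ : i + 1 ≤ J := by
      by_contra hlt
      have : 2 ^ (J + 1) ≤ 2 ^ (i + 1) := Nat.pow_le_pow_right (by norm_num) (by omega)
      have : 2 ^ (J + 1) = 2 * 2 ^ J := pow_succ' _ _
      simp only [Nat.succ_eq_add_one] at hl
      omega
    have e2 : 2 ^ (i + 1 + 1) = 2 * 2 ^ (i + 1) := pow_succ' _ _
    have ej : j + 2 = 2 ^ (i + 1) + (j + 2 - 2 ^ (i + 1)) := by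
      simp only [Nat.succ_eq_add_one] at hl
      omega
    have hrlt : j + 2 - 2 ^ (i + 1) < 2 ^ (i + 1) := by
      simp only [Nat.succ_eq_add_one] at hl'
      omega
    rw [show j + 1 + 2 = (j + 2) + 1 by ring]
    generalize j + 2 - 2 ^ (i + 1) = r at ej hrlt
    rw [ej] at T ⊢
    exact nodeStep_runs hp G1 hq hN hiJ hrlt T

end RealRAM

namespace RealRAM

/-! ### Preprocessing: length and width of the polygon -/

/-- A loop with `m` passes, each of them with a running time of at most `C * M`. -/
theorem Runs.forLoop_le {b : Test} {c : Prog} {C m M : ℕ} (hm : 1 ≤ m) (hM : 1 ≤ M)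
    (I : ℕ → State → Prop) (hb : ∀ j s, j ≤ m → I j s → (b.Holds s ↔ j < m))
    (hstep : ∀ j s, j < m → I j s → Runs c s (C * M) (I (j + 1)))
    {s : State} (hs : I 0 s) :
    Runs (.loop b c) s ((2 * b.cost + C + 2) * (m * M)) (I m) := by
  refine (Runs.forLoop I m hb hstep hs).mono ?_ fun _ h => h
  have h1 : m * 1 ≤ m * M := Nat.mul_le_mul_left _ hM
  have h2 : 1 ≤ m * M := Nat.mul_pos hm hM
  generalize hx : m * M = x at *
  have h3 : m * (b.cost + C * M + 1) = m * b.cost + C * x + m := by rw [← hx]; ring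
  rw [h3]
  have h4 := Nat.mul_le_mul_right b.cost h1
  nlinarith

/-- The input of the preprocessing. -/
structure Input {n : ℕ} (p : Fin n → Plane) (ε : ℝ) (s : State) : Prop where
  hn : s.nreg 0 = n
  hε : s.rreg 0 = ε
  h0 : ∀ i < n, s.rarr 0 i = vert p i 0
  h1 : ∀ i < n, s.rarr 1 i = vert p i 1

theorem Input.frame {n : ℕ} {p : Fin n → Plane} {ε : ℝ} {s s' : State} {c : Prog}
    (h : Input p ε s) (hf : Frame c s s') (h0 : c.wNat 0 = false := by rfl)
    (hr : c.wReal 0 = false := by rfl) (a0 : c.wRealArr 0 = false := by rfl)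
    (a1 : c.wRealArr 1 = false := by rfl) : Input p ε s' := by
  refine ⟨(hf.nreg 0 h0).trans h.hn, (hf.rreg 0 hr).trans h.hε, ?_, ?_⟩
  · rw [hf.rarr 0 a0]; exact h.h0
  · rw [hf.rarr 1 a1]; exact h.h1

theorem input_inputState {n : ℕ} (p : Fin n → Plane) (ε : ℝ) : Input p ε (inputState p ε) := by
  refine ⟨rfl, rfl, fun i hi => ?_, fun i hi => ?_⟩
  · simp [inputState, arrayOf, hi, vert]
  · simp [inputState, arrayOf, hi, vert]

/-- Compare the distance of a vertex from the first vertex with the largest one so far. -/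
def farStep : Prog :=
  .setReal 18 (.load 0 (nr 2) - .load 0 (nc 0)) ;; .setReal 19 (.load 1 (nr 2) - .load 1 (nc 0)) ;;
  .setReal 20 (rr 18 * rr 18 + rr 19 * rr 19) ;;
  .ite (.realLE (rr 20) (rr 10)) .skip
    (.setReal 10 (rr 20) ;; .setReal 11 (rr 18) ;; .setReal 12 (rr 19)) ;;
  .setNat 2 (nr 2 + nc 1)

/-- Find the vector from the first vertex to a farthest one. -/
def far : Prog :=
  (.setNat 2 (nc 0) ;; .setReal 10 (rc 0) ;; .setReal 11 (rc 0) ;; .setReal 12 (rc 0)) ;;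
  .loop (.not (.natLE (nr 0) (nr 2))) farStep

/-- Square of the distance from the first vertex. -/
noncomputable def distSq {n : ℕ} (p : Fin n → Plane) (q : Plane) : ℝ :=
  (q 0 - vert p 0 0) ^ 2 + (q 1 - vert p 0 1) ^ 2

theorem far_runs {n : ℕ} {p : Fin n → Plane} (hn : 0 < n) {ε : ℝ} {s : State}
    (h : Input p ε s) :
    Runs far s (60 * n) (fun s' => ((∃ q ∈ polygonRegion p, s'.rreg 11 = q 0 - vert p 0 0 ∧
      s'.rreg 12 = q 1 - vert p 0 1 ∧ s'.rreg 10 = distSq p q) ∧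
      ∀ i < n, distSq p (vert p i) ≤ s'.rreg 10) ∧ Frame far s s') := by
  refine Runs.frame ?_
  have hpre := Runs.straight_mul (L := n) (c := .setNat 2 (nc 0) ;; .setReal 10 (rc 0) ;;
    .setReal 11 (rc 0) ;; .setReal 12 (rc 0)) hn s
  refine (hpre.seq_mul (C' := 50) ?_).weaken (by decide) fun _ h => h
  rintro s1 ⟨e1, f1⟩
  refine ((Runs.forLoop_le (C := farStep.bound) (M := 1) hn le_rfl (fun i s' => s'.nreg 2 = i ∧
    Input p ε s' ∧ (∃ q ∈ polygonRegion p, s'.rreg 11 = q 0 - vert p 0 0 ∧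
      s'.rreg 12 = q 1 - vert p 0 1 ∧ s'.rreg 10 = distSq p q) ∧
      ∀ j < i, distSq p (vert p j) ≤ s'.rreg 10) ?_ ?_ ?_).mono
      (B' := 50 * n) ?_ fun _ h => h.2.2)
  · rintro j s2 - ⟨h2, hI, -⟩
    simp [h2, hI.hn]
  · rintro j s2 hj ⟨h2, hI, ⟨q, hq, k1, k2, k3⟩, hall⟩
    refine (Runs.straight_mul (c := farStep) le_rfl s2).weaken le_rfl ?_
    rintro s3 ⟨e3, f3⟩
    have d0 := hI.h0 j hj
    have d1 := hI.h1 j hj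
    have o0 := hI.h0 0 hn
    have o1 := hI.h1 0 hn
    have hd : (vert p j 0 - vert p 0 0) * (vert p j 0 - vert p 0 0) +
        (vert p j 1 - vert p 0 1) * (vert p j 1 - vert p 0 1) = distSq p (vert p j) := by
      simp only [distSq]; ring
    refine ⟨?_, hI.frame f3, ?_⟩
    · rw [e3]
      by_cases c : distSq p (vert p j) ≤ s2.rreg 10 <;>
        simp [farStep, h2, d0, d1, o0, o1, hd, c]
    · by_cases c : distSq p (vert p j) ≤ s2.rreg 10
      · have e10 : s3.rreg 10 = s2.rreg 10 := by
          rw [e3]; simp [farStep, h2, d0, d1, o0, o1, hd, c]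
        refine ⟨⟨q, hq, ?_, ?_, e10.trans k3⟩, fun i hi => ?_⟩
        · rw [e3, ← k1]; simp [farStep, h2, d0, d1, o0, o1, hd, c]
        · rw [e3, ← k2]; simp [farStep, h2, d0, d1, o0, o1, hd, c]
        · rw [e10]
          rcases Nat.lt_succ_iff_lt_or_eq.1 hi with hi | rfl
          · exact hall i hi
          · exact c
      · have e10 : s3.rreg 10 = distSq p (vert p j) := by
          rw [e3]; simp [farStep, h2, d0, d1, o0, o1, hd, c]
        refine ⟨⟨vert p j, vert_mem p hn j, ?_, ?_, e10⟩, fun i hi => ?_⟩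
        · rw [e3]; simp [farStep, h2, d0, d1, o0, o1, hd, c]
        · rw [e3]; simp [farStep, h2, d0, d1, o0, o1, hd, c]
        · rw [e10]
          rcases Nat.lt_succ_iff_lt_or_eq.1 hi with hi | rfl
          · exact (hall i hi).trans (not_le.1 c).le
          · exact le_rfl
  · refine ⟨by rw [e1]; simp, h.frame f1, ⟨vert p 0, vert_mem p hn 0, ?_⟩, by simp⟩
    rw [e1]
    simp [distSq]
  · have : 2 * (Test.not (.natLE (nr 0) (nr 2))).cost + farStep.bound + 2 ≤ 50 := by decide
    rw [mul_one]
    exact Nat.mul_le_mul_right _ this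

/-- Compare the distance of a vertex from the line in the base direction with the largest one so
far. -/
def wideStep : Prog :=
  .setReal 18 ((.load 1 (nr 2) - .load 1 (nc 0)) * rr 14 -
    (.load 0 (nr 2) - .load 0 (nc 0)) * rr 15) ;;
  .setReal 18 (.sqrt (rr 18 * rr 18)) ;;
  .ite (.realLE (rr 18) (rr 16)) .skip (.setReal 16 (rr 18)) ;; .setNat 2 (nr 2 + nc 1)

/-- Compute the largest distance from the line through the first vertex in the base direction. -/
def wide : Prog :=
  (.setNat 2 (nc 0) ;; .setReal 16 (rc 0)) ;; .loop (.not (.natLE (nr 0) (nr 2))) wideStep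

theorem wide_runs {n : ℕ} {p : Fin n → Plane} (hn : 0 < n) {ε θ₀ : ℝ} {s : State}
    (h : Input p ε s) (h14 : s.rreg 14 = Real.cos θ₀) (h15 : s.rreg 15 = Real.sin θ₀) :
    Runs wide s (60 * n) (fun s' =>
      ((∃ q ∈ polygonRegion p, |relY (vert p 0) θ₀ q| = s'.rreg 16) ∧
      ∀ i < n, |relY (vert p 0) θ₀ (vert p i)| ≤ s'.rreg 16) ∧ Frame wide s s') := by
  refine Runs.frame ?_
  have hpre := Runs.straight_mul (L := n) (c := .setNat 2 (nc 0) ;; .setReal 16 (rc 0)) hn s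
  refine (hpre.seq_mul (C' := 50) ?_).weaken (by decide) fun _ h => h
  rintro s1 ⟨e1, f1⟩
  refine ((Runs.forLoop_le (C := wideStep.bound) (M := 1) hn le_rfl (fun i s' => s'.nreg 2 = i ∧
    Input p ε s' ∧ s'.rreg 14 = Real.cos θ₀ ∧ s'.rreg 15 = Real.sin θ₀ ∧
    (∃ q ∈ polygonRegion p, |relY (vert p 0) θ₀ q| = s'.rreg 16) ∧
      ∀ j < i, |relY (vert p 0) θ₀ (vert p j)| ≤ s'.rreg 16) ?_ ?_ ?_).mono
      (B' := 50 * n) ?_ fun _ h => h.2.2.2.2)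
  · rintro j s2 - ⟨h2, hI, -⟩
    simp [h2, hI.hn]
  · rintro j s2 hj ⟨h2, hI, k14, k15, ⟨q, hq, k1⟩, hall⟩
    refine (Runs.straight_mul (c := wideStep) le_rfl s2).weaken le_rfl ?_
    rintro s3 ⟨e3, f3⟩
    have d0 := hI.h0 j hj
    have d1 := hI.h1 j hj
    have o0 := hI.h0 0 hn
    have o1 := hI.h1 0 hn
    have hd : √(((vert p j 1 - vert p 0 1) * Real.cos θ₀ - (vert p j 0 - vert p 0 0) * Real.sin θ₀)
        * ((vert p j 1 - vert p 0 1) * Real.cos θ₀ - (vert p j 0 - vert p 0 0) * Real.sin θ₀))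
        = |relY (vert p 0) θ₀ (vert p j)| := by
      rw [Real.sqrt_mul_self_eq_abs]
      congr 1
    refine ⟨?_, hI.frame f3, (f3.rreg 14).trans k14, (f3.rreg 15).trans k15, ?_⟩
    · rw [e3]
      by_cases c : |relY (vert p 0) θ₀ (vert p j)| ≤ s2.rreg 16 <;>
        simp [wideStep, h2, d0, d1, o0, o1, k14, k15, hd, c]
    · by_cases c : |relY (vert p 0) θ₀ (vert p j)| ≤ s2.rreg 16
      · have e10 : s3.rreg 16 = s2.rreg 16 := by
          rw [e3]; simp [wideStep, h2, d0, d1, o0, o1, k14, k15, hd, c]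
        refine ⟨⟨q, hq, k1.trans e10.symm⟩, fun i hi => ?_⟩
        rw [e10]
        rcases Nat.lt_succ_iff_lt_or_eq.1 hi with hi | rfl
        · exact hall i hi
        · exact c
      · have e10 : s3.rreg 16 = |relY (vert p 0) θ₀ (vert p j)| := by
          rw [e3]; simp [wideStep, h2, d0, d1, o0, o1, k14, k15, hd, c]
        refine ⟨⟨vert p j, vert_mem p hn j, e10.symm⟩, fun i hi => ?_⟩
        rw [e10]
        rcases Nat.lt_succ_iff_lt_or_eq.1 hi with hi | rfl
        · exact (hall i hi).trans (not_le.1 c).le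
        · exact le_rfl
  · refine ⟨by rw [e1]; simp, h.frame f1, (f1.rreg 14).trans h14, (f1.rreg 15).trans h15,
      ⟨vert p 0, vert_mem p hn 0, ?_⟩, by simp⟩
    rw [e1]
    simp [relY]
  · have : 2 * (Test.not (.natLE (nr 0) (nr 2))).cost + wideStep.bound + 2 ≤ 50 := by decide
    rw [mul_one]
    exact Nat.mul_le_mul_right _ this

/-- Compute the length of the polygon, its direction, and its width. -/
def measure : Prog :=
  far ;; (.setReal 13 (.sqrt (rr 10)) ;; .setReal 14 (rr 11 / rr 13) ;;
    .setReal 15 (rr 12 / rr 13)) ;; wide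

/-- `D` is the largest distance from the first vertex, `θ₀` the direction to a vertex at this
distance, and `w` the width with respect to this direction. -/
structure Measured {n : ℕ} (p : Fin n → Plane) (D w θ₀ : ℝ) : Prop where
  D_pos : 0 < D
  w_pos : 0 < w
  w_le : w ≤ D
  far : framePt (vert p 0) θ₀ D 0 ∈ polygonRegion p
  wide : ∃ g ∈ polygonRegion p, |relY (vert p 0) θ₀ g| = w
  dist : ∀ q ∈ polygonRegion p, (q 0 - vert p 0 0) ^ 2 + (q 1 - vert p 0 1) ^ 2 ≤ D ^ 2
  height : ∀ q ∈ polygonRegion p, |relY (vert p 0) θ₀ q| ≤ w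

theorem distSq_vert_one_pos {n : ℕ} {p : Fin n → Plane} (hp : IsConvexPolygon p) :
    0 < distSq p (vert p 1) := by
  have hturn := turn_vert_pos hp (show 0 < 1 by norm_num) (show 1 < 2 by norm_num)
    (show 2 < n by have := hp.1; omega)
  by_contra hneg
  simp only [distSq] at hneg
  have e0 : vert p 1 0 - vert p 0 0 = 0 := by nlinarith [sq_nonneg (vert p 1 1 - vert p 0 1)]
  have e1 : vert p 1 1 - vert p 0 1 = 0 := by nlinarith [sq_nonneg (vert p 1 0 - vert p 0 0)]
  simp [turn, e0, e1] at hturn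

theorem measured_of_vertices {n : ℕ} {p : Fin n → Plane} (hp : IsConvexPolygon p) {D w θ₀ : ℝ}
    (hD : 0 ≤ D) (hfar : framePt (vert p 0) θ₀ D 0 ∈ polygonRegion p)
    (hwide : ∃ g ∈ polygonRegion p, |relY (vert p 0) θ₀ g| = w)
    (hdist : ∀ i < n, distSq p (vert p i) ≤ D ^ 2)
    (hheight : ∀ i < n, |relY (vert p 0) θ₀ (vert p i)| ≤ w) : Measured p D w θ₀ := by
  have hn := hp.1
  have hturn := turn_vert_pos hp (show 0 < 1 by norm_num) (show 1 < 2 by norm_num)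
    (show 2 < n by omega)
  have hdist' : ∀ q ∈ polygonRegion p, (q 0 - vert p 0 0) ^ 2 + (q 1 - vert p 0 1) ^ 2 ≤ D ^ 2 := by
    have hconv : Convex ℝ {q : Plane | (q 0 - vert p 0 0) ^ 2 + (q 1 - vert p 0 1) ^ 2 ≤ D ^ 2} := by
      intro x hx y hy a b ha hb hab
      simp only [Set.mem_ofPred_eq, PiLp.add_apply, PiLp.smul_apply, smul_eq_mul] at *
      obtain rfl : b = 1 - a := by linarith
      have h1 := mul_le_mul_of_nonneg_left hx ha
      have h2 := mul_le_mul_of_nonneg_left hy hb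
      have h3 := mul_nonneg (mul_nonneg ha hb)
        (add_nonneg (sq_nonneg (x 0 - y 0)) (sq_nonneg (x 1 - y 1)))
      linarith
    intro q hq
    refine (convexHull_min (s := Set.range p) ?_ hconv) hq
    rintro _ ⟨i, rfl⟩
    have := hdist i i.2
    rwa [vert_of_lt p i.2] at this
  have hheight' : ∀ q ∈ polygonRegion p, |relY (vert p 0) θ₀ q| ≤ w := by
    intro q hq
    have k1 := polygonRegion_le (p := p) (A := -Real.sin θ₀) (B := Real.cos θ₀)
      (c := w + (-Real.sin θ₀ * vert p 0 0 + Real.cos θ₀ * vert p 0 1)) (fun i => by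
        have := (abs_le.1 (hheight i i.2)).2
        rw [vert_of_lt p i.2] at this
        simp only [relY] at this
        linarith) hq
    have k2 := polygonRegion_le (p := p) (A := Real.sin θ₀) (B := -Real.cos θ₀)
      (c := w - (-Real.sin θ₀ * vert p 0 0 + Real.cos θ₀ * vert p 0 1)) (fun i => by
        have := (abs_le.1 (hheight i i.2)).1
        rw [vert_of_lt p i.2] at this
        simp only [relY] at this
        linarith) hq
    simp only [relY]
    rw [abs_le]
    constructor <;> linarith
  have hD0 : 0 < D := by
    have h1 := (distSq_vert_one_pos hp).trans_le (hdist 1 (by omega))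
    exact lt_of_le_of_ne hD fun h0 => by rw [← h0] at h1; norm_num at h1
  have hw0 : 0 < w := by
    by_contra hneg
    have h1 := abs_nonpos_iff.1 ((hheight 1 (by omega)).trans (not_lt.1 hneg))
    have h2 := abs_nonpos_iff.1 ((hheight 2 (by omega)).trans (not_lt.1 hneg))
    have h0 : relY (vert p 0) θ₀ (vert p 0) = 0 := by simp [relY]
    rw [← turn_rel (vert p 0) θ₀, h0, h1, h2] at hturn
    simp at hturn
  refine ⟨hD0, hw0, ?_, hfar, hwide, hdist', hheight'⟩
  obtain ⟨g, hg, hgw⟩ := hwide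
  rw [← hgw]
  refine abs_le_of_sq_le_sq ?_ hD
  refine le_trans ?_ (hdist' g hg)
  have hs := Real.sin_sq_add_cos_sq θ₀
  have : relX (vert p 0) θ₀ g ^ 2 + relY (vert p 0) θ₀ g ^ 2
      = (g 0 - vert p 0 0) ^ 2 + (g 1 - vert p 0 1) ^ 2 := by
    simp only [relX, relY]
    linear_combination ((g 0 - vert p 0 0) ^ 2 + (g 1 - vert p 0 1) ^ 2) * hs
  linarith [sq_nonneg (relX (vert p 0) θ₀ g)]

theorem measure_runs {n : ℕ} {p : Fin n → Plane} (hp : IsConvexPolygon p) {ε : ℝ} {s : State}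
    (h : Input p ε s) :
    Runs measure s (160 * n) (fun s' => (∃ D w θ₀, Measured p D w θ₀ ∧ s'.rreg 13 = D ∧
      s'.rreg 14 = Real.cos θ₀ ∧ s'.rreg 15 = Real.sin θ₀ ∧ s'.rreg 16 = w) ∧
      Frame measure s s') := by
  have hn : 0 < n := by have := hp.1; omega
  refine Runs.frame ?_
  refine ((far_runs hn h).seq_mul (C' := 100) ?_).weaken le_rfl fun _ h => h
  rintro s1 ⟨⟨⟨f, hf, k1, k2, k3⟩, hall⟩, f1⟩
  refine ((Runs.straight_mul (L := n) hn s1).seq_mul (C' := 60) ?_).weaken (by decide) fun _ h => h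
  rintro s2 ⟨e2, f2⟩
  have hd0 : 0 ≤ s1.rreg 10 := by rw [k3, distSq]; positivity
  obtain ⟨D, hDdef⟩ : ∃ D, D = √(s1.rreg 10) := ⟨_, rfl⟩
  have hD : 0 ≤ D := hDdef ▸ Real.sqrt_nonneg _
  have hDsq : D ^ 2 = s1.rreg 10 := by rw [hDdef, Real.sq_sqrt hd0]
  obtain ⟨θ₀, t1, t2⟩ := exists_angle (u := s1.rreg 11) (v := s1.rreg 12) hD
    (by rw [hDsq, k1, k2, k3, distSq])
  have hDpos : D ≠ 0 := by
    intro h0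
    have h1 := (distSq_vert_one_pos hp).trans_le (hall 1 (by have := hp.1; omega))
    rw [← hDsq, h0] at h1
    norm_num at h1
  have g13 : s2.rreg 13 = D := by rw [e2, hDdef]; simp
  have g14 : s2.rreg 14 = Real.cos θ₀ := by
    rw [e2]; simp; rw [← hDdef, ← t1]; field_simp
  have g15 : s2.rreg 15 = Real.sin θ₀ := by
    rw [e2]; simp; rw [← hDdef, ← t2]; field_simp
  refine (wide_runs hn ((h.frame f1).frame f2) g14 g15).weaken le_rfl ?_
  rintro s3 ⟨⟨hwide, hheight⟩, f3⟩
  refine ⟨D, s3.rreg 16, θ₀, measured_of_vertices hp hD ?_ hwide (fun i hi => ?_) hheight,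
    (f3.rreg 13).trans g13, (f3.rreg 14).trans g14, (f3.rreg 15).trans g15, rfl⟩
  · have : framePt (vert p 0) θ₀ D 0 = f := by
      apply Plane.ext
      · simp [t1, k1]
      · simp [t2, k2]
    rw [this]
    exact hf
  · rw [hDsq]
    exact hall i hi

end RealRAM

namespace RealRAM

/-! ### Preprocessing: the directions and the rotated coordinates -/

/-- Compute the number of directions, in the natural register `1` and the real register `17`: the
smallest power `2 ^ J` with `27 ≤ J` and `2 ^ 24 / 2 ^ J ≤ ε`. -/
def countDirections : Prog :=
  (.setNat 1 (nc (2 ^ 27)) ;; .setReal 17 (rc (2 ^ 27))) ;;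
  .loop (.not (.realLE (rc (2 ^ 24)) (rr 17 * rr 0)))
    (.setNat 1 (nr 1 + nr 1) ;; .setReal 17 (rr 17 + rr 17))

theorem countDirections_runs {ε : ℝ} (hε : 0 < ε) (hε1 : ε < 1) :
    ∃ J, 27 ≤ J ∧ (2 : ℝ) ^ 24 / 2 ^ J ≤ ε ∧ (2 : ℝ) ^ J ≤ 2 ^ 27 * ε⁻¹ ∧ ∀ s : State,
      s.rreg 0 = ε → Runs countDirections s (30 * 2 ^ J) (fun s' =>
        (s'.nreg 1 = 2 ^ J ∧ s'.rreg 17 = 2 ^ J) ∧ Frame countDirections s s') := by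
  have hex : ∃ j : ℕ, (2 : ℝ) ^ 24 ≤ 2 ^ 27 * 2 ^ j * ε := by
    obtain ⟨j, hj⟩ := pow_unbounded_of_one_lt ((2 : ℝ) ^ 24 / (2 ^ 27 * ε)) one_lt_two
    refine ⟨j, ?_⟩
    rw [div_lt_iff₀ (by positivity)] at hj
    linarith
  classical
  let j₀ := Nat.find hex
  have hj₀ : (2 : ℝ) ^ 24 ≤ 2 ^ 27 * 2 ^ j₀ * ε := Nat.find_spec hex
  have hmin : ∀ j < j₀, ¬ (2 : ℝ) ^ 24 ≤ 2 ^ 27 * 2 ^ j * ε := fun j hj => Nat.find_min hex hj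
  refine ⟨27 + j₀, by omega, ?_, ?_, fun s h0 => Runs.frame ?_⟩
  · rw [pow_add, div_le_iff₀ (by positivity)]
    linarith
  · rw [← div_eq_mul_inv, le_div_iff₀ hε, pow_add]
    rcases Nat.eq_zero_or_pos j₀ with h | h
    · rw [h]; nlinarith
    · have := hmin (j₀ - 1) (by omega)
      have e : (2 : ℝ) ^ j₀ = 2 * 2 ^ (j₀ - 1) := by rw [← pow_succ', Nat.sub_add_cancel h]
      rw [e]
      push Not at this
      nlinarith
  · have hpre := Runs.straight_frame (c := .setNat 1 (nc (2 ^ 27)) ;; .setReal 17 (rc (2 ^ 27))) s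
    refine (hpre.seq (B' := j₀ * (6 + 8 + 1) + (6 + 1)) ?_).mono ?_ fun _ h => h
    · rintro s1 ⟨e1, f1⟩
      refine (Runs.forLoop (B := 8) (fun j s' => s'.nreg 1 = 2 ^ 27 * 2 ^ j ∧
        s'.rreg 17 = 2 ^ 27 * 2 ^ j ∧ s'.rreg 0 = ε) j₀ ?_ ?_ ?_).mono le_rfl ?_
      · rintro j s2 hj ⟨-, h17, h0'⟩
        have : (Test.not (.realLE (rc (2 ^ 24)) (rr 17 * rr 0))).Holds s2 ↔
            ¬ (2 : ℝ) ^ 24 ≤ 2 ^ 27 * 2 ^ j * ε := by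
          simp [h17, h0']
          norm_num
        rw [this]
        constructor
        · intro hne
          by_contra hlt
          obtain rfl : j = j₀ := by omega
          exact hne hj₀
        · exact hmin j
      · rintro j s2 - ⟨h1, h17, h0'⟩
        refine (Runs.straight_frame s2).mono (le_of_eq rfl) ?_
        rintro s3 ⟨rfl, -⟩
        simp [h1, h17, h0', pow_succ]
        constructor <;> ring
      · rw [e1]
        simp [h0]
        norm_num
      · rintro s2 ⟨h1, h17, -⟩
        exact ⟨by rw [h1, pow_add], by rw [h17, pow_add]⟩
    · have k1 : j₀ < 2 ^ j₀ := Nat.lt_two_pow_self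
      have k2 : (Prog.setNat 1 (nc (2 ^ 27)) ;; Prog.setReal 17 (rc (2 ^ 27))).bound = 4 := rfl
      rw [k2, pow_add]
      omega

/-- Compute the sine `400 * w / (D * 2 ^ J)` and the cosine of the angle between consecutive
directions, in the real registers `20` and `21`, and turn the base direction to the first
direction, by `2 ^ (J - 1)` of these angles. -/
def firstDirection : Prog :=
  (.setReal 20 (rc 400 * rr 16 / (rr 13 * rr 17)) ;;
    .setReal 21 (.sqrt (rc 1 - rr 20 * rr 20)) ;; .setNat 2 (nc 0) ;; .setNat 3 (.half (nr 1))) ;;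
  .loop (.not (.natLE (nr 3) (nr 2)))
    (.setReal 18 (rr 14 * rr 21 + rr 15 * rr 20) ;;
      .setReal 15 (rr 15 * rr 21 - rr 14 * rr 20) ;; .setReal 14 (rr 18) ;;
      .setNat 2 (nr 2 + nc 1))

theorem firstDirection_runs {J : ℕ} (hJ : 1 ≤ J) {D w θ₀ x : ℝ} (hx : x = 400 * w / (D * 2 ^ J))
    (hx0 : 0 ≤ x) (hx1 : x ≤ 1) {s : State} (h1 : s.nreg 1 = 2 ^ J) (h17 : s.rreg 17 = 2 ^ J)
    (h13 : s.rreg 13 = D) (h14 : s.rreg 14 = Real.cos θ₀) (h15 : s.rreg 15 = Real.sin θ₀)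
    (h16 : s.rreg 16 = w) :
    Runs firstDirection s (100 * 2 ^ J) (fun s' =>
      (s'.rreg 14 = Real.cos (θ₀ - 2 ^ (J - 1) * Real.arcsin x) ∧
        s'.rreg 15 = Real.sin (θ₀ - 2 ^ (J - 1) * Real.arcsin x) ∧
        s'.rreg 20 = Real.sin (Real.arcsin x) ∧ s'.rreg 21 = Real.cos (Real.arcsin x)) ∧
      Frame firstDirection s s') := by
  refine Runs.frame ?_
  have hsin : Real.sin (Real.arcsin x) = x := Real.sin_arcsin (by linarith) hx1
  have hcos : Real.cos (Real.arcsin x) = √(1 - x * x) := by rw [Real.cos_arcsin, sq]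
  have hJ' : 2 ^ J = 2 * 2 ^ (J - 1) := by rw [← pow_succ', Nat.sub_add_cancel hJ]
  have hpos : 1 ≤ 2 ^ (J - 1) := Nat.one_le_two_pow
  generalize Real.arcsin x = α at *
  have hpre := Runs.straight_mul (L := 2 ^ J) (c := .setReal 20 (rc 400 * rr 16 / (rr 13 * rr 17)) ;;
    .setReal 21 (.sqrt (rc 1 - rr 20 * rr 20)) ;; .setNat 2 (nc 0) ;; .setNat 3 (.half (nr 1)))
    Nat.one_le_two_pow s
  refine (hpre.seq_mul (C' := 70) ?_).weaken (by decide) fun _ h => h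
  rintro s1 ⟨e1, f1⟩
  refine ((Runs.forLoop_le (C := 25) (M := 1) hpos le_rfl (fun j s' => s'.nreg 2 = j ∧
    s'.nreg 3 = 2 ^ (J - 1) ∧ s'.rreg 14 = Real.cos (θ₀ - j * α) ∧
    s'.rreg 15 = Real.sin (θ₀ - j * α) ∧ s'.rreg 20 = Real.sin α ∧ s'.rreg 21 = Real.cos α)
    ?_ ?_ ?_).mono (B' := 70 * 2 ^ J) ?_ ?_)
  · rintro j s2 - ⟨h2, h3, -⟩
    simp [h2, h3]
  · rintro j s2 hj ⟨h2, h3, k14, k15, k20, k21⟩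
    refine (Runs.straight_mul le_rfl s2).weaken (by decide) ?_
    rintro s3 ⟨rfl, -⟩
    have e : θ₀ - ((j + 1 : ℕ) : ℝ) * α = θ₀ - j * α - α := by push_cast; ring
    rw [e, Real.cos_sub (θ₀ - j * α), Real.sin_sub (θ₀ - j * α)]
    simp [h2, h3, k14, k15, k20, k21]
  · rw [e1]
    simp [h1, h17, h13, h14, h15, h16, ← hx, hsin, hcos]
    omega
  · have : (Test.not (.natLE (nr 3) (nr 2))).cost = 4 := rfl
    rw [this]
    omega
  · rintro s2 ⟨-, -, k⟩
    push_cast at k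
    exact k

/-- Store the rotated coordinates of a vertex. -/
def coordStep : Prog :=
  .storeReal 4 (nr 3) (.load 0 (nr 4) * rr 14 + .load 1 (nr 4) * rr 15) ;;
  .storeReal 5 (nr 3) (.load 1 (nr 4) * rr 14 - .load 0 (nr 4) * rr 15) ;;
  .setNat 3 (nr 3 + nc 1) ;; .setNat 4 (nr 4 + nc 1)

/-- Store a direction, and the rotated coordinates of all vertices; then turn the direction. -/
def rowStep : Prog :=
  (.storeReal 2 (nr 2) (rr 14) ;; .storeReal 3 (nr 2) (rr 15) ;; .setNat 4 (nc 0)) ;;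
  .loop (.not (.natLE (nr 0) (nr 4))) coordStep ;;
  (.setReal 18 (rr 14 * rr 21 - rr 15 * rr 20) ;; .setReal 15 (rr 15 * rr 21 + rr 14 * rr 20) ;;
    .setReal 14 (rr 18) ;; .setNat 2 (nr 2 + nc 1))

/-- The first `k'` directions have been stored, as well as the coordinates of all vertices for the
first `k` directions, and those of the first `i` vertices for the next direction; the machine is
set up for direction `k`.  Here `k'` is `k`, or `k + 1` in the course of step `k`. -/
structure RowsInv {n : ℕ} (p : Fin n → Plane) (K : ℕ) (θ α ε : ℝ) (k k' i : ℕ) (s : State) :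
    Prop where
  input : Input p ε s
  h1 : s.nreg 1 = K
  h2 : s.nreg 2 = k
  h3 : s.nreg 3 = k * n + i
  h14 : s.rreg 14 = Real.cos (θ + k * α)
  h15 : s.rreg 15 = Real.sin (θ + k * α)
  h20 : s.rreg 20 = Real.sin α
  h21 : s.rreg 21 = Real.cos α
  a2 : ∀ j, s.rarr 2 j = if j < k' then Real.cos (θ + j * α) else 0
  a3 : ∀ j, s.rarr 3 j = if j < k' then Real.sin (θ + j * α) else 0
  a4 : ∀ j, s.rarr 4 j =
    if j < k * n + i then rotatedX (θ + (j / n : ℕ) * α) (vert p (j % n)) else 0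
  a5 : ∀ j, s.rarr 5 j =
    if j < k * n + i then rotatedY (θ + (j / n : ℕ) * α) (vert p (j % n)) else 0

theorem coordStep_runs {n : ℕ} {p : Fin n → Plane} {K : ℕ} {θ α ε : ℝ} {k k' i : ℕ} {s : State}
    (h : RowsInv p K θ α ε k k' i s) (hi : i < n) (h4 : s.nreg 4 = i) :
    Runs coordStep s (30 * 1) (fun s' => s'.nreg 4 = i + 1 ∧ RowsInv p K θ α ε k k' (i + 1) s') := by
  refine (Runs.straight_mul (c := coordStep) le_rfl s).weaken (by decide) ?_
  rintro s' ⟨e, f⟩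
  have hdiv : (k * n + i) / n = k := by
    rw [mul_comm, Nat.mul_add_div (by omega), Nat.div_eq_of_lt hi, add_zero]
  have hmod : (k * n + i) % n = i := by
    rw [mul_comm, Nat.mul_add_mod, Nat.mod_eq_of_lt hi]
  refine ⟨by rw [e]; simp [coordStep, h4], h.input.frame f, (f.nreg 1).trans h.h1,
    (f.nreg 2).trans h.h2, ?_, (f.rreg 14).trans h.h14, (f.rreg 15).trans h.h15,
    (f.rreg 20).trans h.h20, (f.rreg 21).trans h.h21, ?_, ?_, fun j => ?_, fun j => ?_⟩
  · rw [e]; simp [coordStep, h.h3]; ring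
  · rw [f.rarr 2]; exact h.a2
  · rw [f.rarr 3]; exact h.a3
  · have e4 : s'.rarr 4 = Function.update (s.rarr 4) (k * n + i)
        (vert p i 0 * Real.cos (θ + k * α) + vert p i 1 * Real.sin (θ + k * α)) := by
      rw [e]; simp [coordStep, h.h3, h4, h.h14, h.h15, h.input.h0 i hi, h.input.h1 i hi]
    rw [e4]
    by_cases hj : j = k * n + i
    · subst hj
      rw [Function.update_self, if_pos (by omega), hdiv, hmod]
      rfl
    · rw [Function.update_of_ne hj, h.a4]
      by_cases hlt : j < k * n + i
      · rw [if_pos hlt, if_pos (by omega)]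
      · rw [if_neg hlt, if_neg (by omega)]
  · have e5 : s'.rarr 5 = Function.update (s.rarr 5) (k * n + i)
        (vert p i 1 * Real.cos (θ + k * α) - vert p i 0 * Real.sin (θ + k * α)) := by
      rw [e]; simp [coordStep, h.h3, h4, h.h14, h.h15, h.input.h0 i hi, h.input.h1 i hi]
    rw [e5]
    by_cases hj : j = k * n + i
    · subst hj
      rw [Function.update_self, if_pos (by omega), hdiv, hmod]
      rfl
    · rw [Function.update_of_ne hj, h.a5]
      by_cases hlt : j < k * n + i
      · rw [if_pos hlt, if_pos (by omega)]
      · rw [if_neg hlt, if_neg (by omega)]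

theorem rowStep_runs {n : ℕ} {p : Fin n → Plane} (hn : 1 ≤ n) {K : ℕ} {θ α ε : ℝ} {k : ℕ}
    {s : State} (h : RowsInv p K θ α ε k k 0 s) :
    Runs rowStep s (100 * n) (RowsInv p K θ α ε (k + 1) (k + 1) 0) := by
  refine ((Runs.straight_mul (L := n) hn s).seq_mul (C' := 70) ?_).weaken (by decide) fun _ h => h
  rintro s1 ⟨e1, f1⟩
  have inv1 : RowsInv p K θ α ε k (k + 1) 0 s1 := by
    refine ⟨h.input.frame f1, (f1.nreg 1).trans h.h1, (f1.nreg 2).trans h.h2,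
      (f1.nreg 3).trans h.h3, (f1.rreg 14).trans h.h14, (f1.rreg 15).trans h.h15,
      (f1.rreg 20).trans h.h20, (f1.rreg 21).trans h.h21, fun j => ?_, fun j => ?_, ?_, ?_⟩
    · have e2 : s1.rarr 2 = Function.update (s.rarr 2) k (Real.cos (θ + k * α)) := by
        rw [e1]; simp [h.h2, h.h14]
      rw [e2]
      by_cases hj : j = k
      · subst hj; simp
      · rw [Function.update_of_ne hj, h.a2]
        by_cases hlt : j < k
        · rw [if_pos hlt, if_pos (by omega)]
        · rw [if_neg hlt, if_neg (by omega)]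
    · have e2 : s1.rarr 3 = Function.update (s.rarr 3) k (Real.sin (θ + k * α)) := by
        rw [e1]; simp [h.h2, h.h15]
      rw [e2]
      by_cases hj : j = k
      · subst hj; simp
      · rw [Function.update_of_ne hj, h.a3]
        by_cases hlt : j < k
        · rw [if_pos hlt, if_pos (by omega)]
        · rw [if_neg hlt, if_neg (by omega)]
    · rw [f1.rarr 4]; exact h.a4
    · rw [f1.rarr 5]; exact h.a5
  have hloop := Runs.forLoop_le (b := .not (.natLE (nr 0) (nr 4))) (c := coordStep) (C := 30)
    (m := n) (M := 1) hn le_rfl (fun i s' => s'.nreg 4 = i ∧ RowsInv p K θ α ε k (k + 1) i s')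
    (fun j s' _ hj => by simp [hj.1, hj.2.input.hn])
    (fun j s' hlt hj => coordStep_runs hj.2 hlt hj.1) (s := s1) ⟨by rw [e1]; simp, inv1⟩
  have hc : 2 * (Test.not (.natLE (nr 0) (nr 4))).cost + 30 + 2 = 40 := rfl
  rw [hc, mul_one] at hloop
  refine (hloop.seq_mul (C' := 30) ?_).weaken le_rfl fun _ h => h
  rintro s2 ⟨-, inv2⟩
  refine (Runs.straight_mul hn s2).weaken (by decide) ?_
  rintro s3 ⟨e3, f3⟩
  have e : θ + ((k + 1 : ℕ) : ℝ) * α = θ + k * α + α := by push_cast; ring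
  have hk : (k + 1) * n + 0 = k * n + n := by ring
  refine ⟨inv2.input.frame f3, (f3.nreg 1).trans inv2.h1, ?_, ?_, ?_, ?_,
    (f3.rreg 20).trans inv2.h20, (f3.rreg 21).trans inv2.h21, ?_, ?_, ?_, ?_⟩
  · rw [e3]; simp [inv2.h2]
  · rw [f3.nreg 3, inv2.h3, hk]
  · rw [e, Real.cos_add (θ + k * α), e3]
    simp [inv2.h14, inv2.h15, inv2.h20, inv2.h21]
  · rw [e, Real.sin_add (θ + k * α), e3]
    simp [inv2.h14, inv2.h15, inv2.h20, inv2.h21]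
  · rw [f3.rarr 2]; exact inv2.a2
  · rw [f3.rarr 3]; exact inv2.a3
  · rw [f3.rarr 4, hk]; exact inv2.a4
  · rw [f3.rarr 5, hk]; exact inv2.a5

/-- Store all directions and the rotated coordinates. -/
def rowsProg : Prog :=
  (.setNat 2 (nc 0) ;; .setNat 3 (nc 0)) ;; .loop (.not (.natLE (nr 1) (nr 2))) rowStep

theorem rowsProg_runs {n : ℕ} {p : Fin n → Plane} (hn : 1 ≤ n) {K : ℕ} (hK : 1 ≤ K) {θ α ε : ℝ}
    {s : State} (h : Input p ε s) (h1 : s.nreg 1 = K) (h14 : s.rreg 14 = Real.cos θ)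
    (h15 : s.rreg 15 = Real.sin θ) (h20 : s.rreg 20 = Real.sin α) (h21 : s.rreg 21 = Real.cos α)
    (a2 : ∀ j, s.rarr 2 j = 0) (a3 : ∀ j, s.rarr 3 j = 0) (a4 : ∀ j, s.rarr 4 j = 0)
    (a5 : ∀ j, s.rarr 5 j = 0) :
    Runs rowsProg s (200 * (K * n)) (RowsInv p K θ α ε K K 0) := by
  refine ((Runs.straight_mul (L := K * n) (Nat.mul_pos hK hn) s).seq_mul (C' := 120) ?_).weaken
    (by decide) fun _ h => h
  rintro s1 ⟨e1, f1⟩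
  refine (Runs.forLoop_le (C := 100) hK hn (fun k s' => RowsInv p K θ α ε k k 0 s')
    (fun j s' _ hj => by simp [hj.h1, hj.h2]) (fun j s' _ hj => rowStep_runs hn hj) ?_).weaken
    (by decide) fun _ h => h
  refine ⟨h.frame f1, (f1.nreg 1).trans h1, by rw [e1]; simp, by rw [e1]; simp, ?_, ?_,
    (f1.rreg 20).trans h20, (f1.rreg 21).trans h21, fun j => ?_, fun j => ?_, fun j => ?_,
    fun j => ?_⟩
  · rw [f1.rreg 14, h14]; simp
  · rw [f1.rreg 15, h15]; simp
  · rw [f1.rarr 2, a2]; simp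
  · rw [f1.rarr 3, a3]; simp
  · rw [f1.rarr 4, a4]; simp
  · rw [f1.rarr 5, a5]; simp

end RealRAM

namespace RealRAM

/-! ### The preprocessing program -/

/-- Set all registers that were used for intermediate results to `0`. -/
def cleanup : Prog :=
  .setNat 2 (nc 0) ;; .setNat 3 (nc 0) ;; .setNat 4 (nc 0) ;;
  .setReal 10 (rc 0) ;; .setReal 11 (rc 0) ;; .setReal 12 (rc 0) ;; .setReal 13 (rc 0) ;;
  .setReal 14 (rc 0) ;; .setReal 15 (rc 0) ;; .setReal 16 (rc 0) ;; .setReal 17 (rc 0) ;;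
  .setReal 18 (rc 0) ;; .setReal 19 (rc 0) ;; .setReal 20 (rc 0) ;; .setReal 21 (rc 0)

/-- The preprocessing program. -/
def preprocess : Prog :=
  measure ;; countDirections ;; firstDirection ;; rowsProg ;; cleanup

theorem preprocess_wNat {j : ℕ} (hj : 5 ≤ j) : preprocess.wNat j = false := by
  simp [preprocess, measure, far, farStep, wide, wideStep, countDirections, firstDirection,
    rowsProg, rowStep, coordStep, cleanup, Prog.wNat]
  omega

theorem preprocess_wNatArr (j : ℕ) : preprocess.wNatArr j = false := rfl

theorem preprocess_wReal {j : ℕ} (hj : j < 10 ∨ 22 ≤ j) : preprocess.wReal j = false := by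
  simp [preprocess, measure, far, farStep, wide, wideStep, countDirections, firstDirection,
    rowsProg, rowStep, coordStep, cleanup, Prog.wReal]
  omega

theorem preprocess_wRealArr {j : ℕ} (hj : 6 ≤ j) : preprocess.wRealArr j = false := by
  simp [preprocess, measure, far, farStep, wide, wideStep, countDirections, firstDirection,
    rowsProg, rowStep, coordStep, cleanup, Prog.wRealArr]
  omega

theorem State.ext {s s' : State} (h1 : ∀ j, s.nreg j = s'.nreg j) (h2 : ∀ j, s.narr j = s'.narr j)
    (h3 : ∀ j, s.rreg j = s'.rreg j) (h4 : ∀ j, s.rarr j = s'.rarr j) : s = s' := by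
  cases s
  cases s'
  simp only [State.mk.injEq]
  exact ⟨funext h1, funext h2, funext h3, funext h4⟩

theorem eq_preparedState {n : ℕ} {p : Fin n → Plane} {ε θ α : ℝ} {K : ℕ} {s s' : State}
    (hf : Frame preprocess (inputState p ε) s') (h : RowsInv p K θ α ε K K 0 s)
    (e : s' = cleanup.den s) : s' = preparedState p ε K θ α := by
  refine State.ext (fun j => ?_) (fun j => ?_) (fun j => ?_) (fun j => ?_)
  · by_cases hj : 5 ≤ j
    · rw [hf.nreg j (preprocess_wNat hj)]
      simp [inputState, preparedState, show j ≠ 0 by omega, show j ≠ 1 by omega]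
    · rw [e]
      push Not at hj
      interval_cases j <;> simp [cleanup, preparedState, h.input.hn, h.h1]
  · rw [hf.narr j (preprocess_wNatArr j)]
    rfl
  · by_cases hj : j < 10 ∨ 22 ≤ j
    · rw [hf.rreg j (preprocess_wReal hj)]
      rfl
    · rw [e]
      obtain ⟨h1, h2⟩ := not_or.1 hj
      push Not at h1 h2
      interval_cases j <;> simp [cleanup, preparedState]
  · by_cases hj : 6 ≤ j
    · rw [hf.rarr j (preprocess_wRealArr hj)]
      obtain ⟨k, rfl⟩ := Nat.exists_eq_add_of_le' hj
      rfl
    · push Not at hj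
      interval_cases j
      · rw [hf.rarr 0]; rfl
      · rw [hf.rarr 1]; rfl
      · rw [e]
        change s.rarr 2 = _
        funext j
        rw [h.a2]
        rfl
      · rw [e]
        change s.rarr 3 = _
        funext j
        rw [h.a3]
        rfl
      · rw [e]
        change s.rarr 4 = _
        funext j
        rw [h.a4, add_zero]
        simp only [preparedState, arrayOf]
        split_ifs with hlt
        · rw [vert_of_lt p (Nat.mod_lt j (Nat.pos_of_ne_zero fun h0 => by simp [h0] at hlt))]
          rfl
        · rfl
      · rw [e]
        change s.rarr 5 = _
        funext j
        rw [h.a5, add_zero]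
        simp only [preparedState, arrayOf]
        split_ifs with hlt
        · rw [vert_of_lt p (Nat.mod_lt j (Nat.pos_of_ne_zero fun h0 => by simp [h0] at hlt))]
          rfl
        · rfl

/-- The number `2 ^ J` of directions depends on `ε` only; their mutual angle `α` is proportional to
the ratio of width to length of the polygon. -/
theorem preprocess_runs {n : ℕ} {p : Fin n → Plane} (hp : IsConvexPolygon p) {ε : ℝ}
    (hε : 0 < ε) (hε1 : ε < 1) :
    ∃ J, 27 ≤ J ∧ (2 : ℝ) ^ 24 / 2 ^ J ≤ ε ∧ (2 : ℝ) ^ J ≤ 2 ^ 27 * ε⁻¹ ∧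
      Runs preprocess (inputState p ε) (1000 * (2 ^ J * n)) (fun s' =>
        ∃ D w θ₀ α, Measured p D w θ₀ ∧ α = Real.arcsin (400 * w / (D * 2 ^ J)) ∧
          s' = preparedState p ε (2 ^ J) (θ₀ - 2 ^ (J - 1) * α) α) := by
  obtain ⟨J, hJ, hJ1, hJ2, hcount⟩ := countDirections_runs hε hε1
  refine ⟨J, hJ, hJ1, hJ2, ?_⟩
  have hn : 1 ≤ n := by have := hp.1; omega
  have hK : 1 ≤ 2 ^ J := Nat.one_le_two_pow
  have hL : 1 ≤ 2 ^ J * n := Nat.mul_pos hK hn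
  have hin := input_inputState p ε
  have hKn : 2 ^ J ≤ 2 ^ J * n := Nat.le_mul_of_pos_right _ hn
  have hnK : n ≤ 2 ^ J * n := Nat.le_mul_of_pos_left _ hK
  have main : Runs preprocess (inputState p ε) ((160 + (30 + (100 + (200 + 100)))) * (2 ^ J * n))
      (fun s' => ∃ D w θ₀ α s, Measured p D w θ₀ ∧ α = Real.arcsin (400 * w / (D * 2 ^ J)) ∧
        RowsInv p (2 ^ J) (θ₀ - 2 ^ (J - 1) * α) α ε (2 ^ J) (2 ^ J) 0 s ∧ s' = cleanup.den s) := by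
    refine ((measure_runs hp hin).mono (Nat.mul_le_mul_left _ hnK) fun _ h => h).seq_mul ?_
    rintro s1 ⟨⟨D, w, θ₀, hM, h13, h14, h15, h16⟩, f1⟩
    have in1 := hin.frame f1
    refine ((hcount s1 in1.hε).mono (Nat.mul_le_mul_left _ hKn) fun _ h => h).seq_mul ?_
    rintro s2 ⟨⟨c1, c17⟩, f2⟩
    have hD := hM.D_pos
    have hw := hM.w_pos
    have hx1 : 400 * w / (D * 2 ^ J) ≤ 1 := by
      have : (2 : ℝ) ^ 27 ≤ 2 ^ J := pow_le_pow_right₀ (by norm_num) hJ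
      rw [div_le_one (by positivity)]
      nlinarith [hM.w_le]
    have hfirst := firstDirection_runs (J := J) (by omega) (D := D) (w := w) (θ₀ := θ₀) rfl
      (by positivity) hx1 c1 c17 ((f2.rreg 13).trans h13) ((f2.rreg 14).trans h14)
      ((f2.rreg 15).trans h15) ((f2.rreg 16).trans h16)
    refine (hfirst.mono (Nat.mul_le_mul_left _ hKn) fun _ h => h).seq_mul ?_
    rintro s3 ⟨⟨g14, g15, g20, g21⟩, f3⟩
    have in3 := (in1.frame f2).frame f3
    have harr (a : ℕ) (ha : measure.wRealArr a = false := by rfl)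
        (ha2 : countDirections.wRealArr a = false := by rfl)
        (ha3 : firstDirection.wRealArr a = false := by rfl) (j : ℕ) :
        s3.rarr a j = (inputState p ε).rarr a j := by
      rw [f3.rarr a ha3, f2.rarr a ha2, f1.rarr a ha]
    refine (rowsProg_runs hn hK in3 ((f3.nreg 1).trans c1) g14 g15 g20 g21 (harr 2) (harr 3)
      (harr 4) (harr 5)).seq_mul ?_
    intro s4 inv
    refine (Runs.straight_mul (c := cleanup) hL s4).weaken (by decide) ?_
    rintro s5 ⟨e5, -⟩
    exact ⟨D, w, θ₀, _, s4, hM, rfl, inv, e5⟩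
  refine main.frame.weaken (by norm_num) ?_
  rintro s' ⟨⟨D, w, θ₀, α, s, hM, hα, inv, e⟩, hf⟩
  exact ⟨D, w, θ₀, α, hM, hα, eq_preparedState hf inv e⟩

end RealRAM

namespace RealRAM

/-! ### The maximum area inscribed rectangle -/

/-- A polygon has a maximum area inscribed rectangle, and it is almost parallel to the measured
direction. -/
theorem Measured.exists_extremal {n : ℕ} {p : Fin n → Plane} (hn : 0 < n) {D w θ₀ : ℝ}
    (h : Measured p D w θ₀) :
    ∃ m ψ₀ R, Extremal (polygonRegion p) (vert p 0) D w m θ₀ ψ₀ ∧ |ψ₀ - θ₀| ≤ 200 * (w / D) ∧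
      IsMAIR (polygonRegion p) R ∧ R.area = m ^ 2 := by
  have hD := h.D_pos
  have hw := h.w_pos
  have hconv := polygonRegion_convex p
  have hcomp : IsCompact (polygonRegion p) := (Set.finite_range p).isCompact_convexHull ℝ
  obtain ⟨g, hg, hgw⟩ := h.wide
  have ho : framePt (vert p 0) θ₀ 0 0 ∈ polygonRegion p := by
    have : framePt (vert p 0) θ₀ 0 0 = vert p 0 := Plane.ext (by simp) (by simp)
    rw [this]
    exact vert_mem p hn 0
  have htri := exists_hasArea_of_triangle hconv hD h.dist ho h.far hg hw.le hgw
  obtain ⟨ψ, A, hA, hmax⟩ := exists_max_hasArea hcomp (vert p 0) hD.le h.dist htri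
  have hDw : D * w / 16 ≤ A := hmax _ _ htri
  have hA0 : 0 < A := lt_of_lt_of_le (by positivity) hDw
  -- a rectangle has four frames; one of them is within a quarter of a right angle
  obtain ⟨ψ₀, hψ₀, he⟩ := (HasArea.periodic (polygonRegion p) (vert p 0)).exists_mem_Ico
    (by positivity) ψ (θ₀ - Real.pi / 4)
  rw [he] at hA
  have habs : |ψ₀ - θ₀| ≤ Real.pi / 4 :=
    abs_le.2 ⟨by linarith [hψ₀.1], by linarith [hψ₀.2]⟩
  have hangle := angle_le_of_hasArea hD hw h.height hDw
    (show HasArea _ _ (θ₀ + (ψ₀ - θ₀)) A by rwa [add_sub_cancel]) habs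
  obtain ⟨x₁, x₂, y₁, y₂, hfit, rfl⟩ := hA
  have hx : x₁ < x₂ := lt_of_le_of_ne hfit.hx fun hh => by simp [hh] at hA0
  have hy : y₁ < y₂ := lt_of_le_of_ne hfit.hy fun hh => by simp [hh] at hA0
  have hsq := Real.sq_sqrt hA0.le
  refine ⟨√((x₂ - x₁) * (y₂ - y₁)), ψ₀, rectOf (vert p 0) ψ₀ x₁ x₂ y₁ y₂ hx hy,
    ⟨hconv, hD, hw, h.w_le, Real.sqrt_pos.2 hA0, h.dist, h.height, by rw [hsq]; exact hDw, ?_,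
      (y₁, y₂), x₁, x₂, hfit, le_rfl⟩, hangle, isMAIR_rectOf hconv hfit hx hy hmax, ?_⟩
  · rintro ψ' c z ⟨a₁, a₂, hfit', hc⟩
    exact hc.trans (Real.sqrt_le_sqrt (hmax ψ' _ ⟨a₁, a₂, z.1, z.2, hfit', rfl⟩))
  · rw [rectOf_area, hsq]

/-- The directions chosen by the preprocessing cover all angles that differ by at most
`200 * (w / D)` from `θ₀`, and their range is not much larger. -/
theorem arcsin_range {D w α : ℝ} {J : ℕ} (hJ : 27 ≤ J) (hD : 0 < D) (hw : 0 < w) (hwD : w ≤ D)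
    (hα : α = Real.arcsin (400 * w / (D * 2 ^ J))) :
    0 < α ∧ D * (2 ^ J * α) ≤ 640 * w ∧ 200 * (w / D) ≤ 2 ^ (J - 1) * α := by
  have hJ' : (2 : ℝ) ^ J = 2 * 2 ^ (J - 1) := by rw [← pow_succ', Nat.sub_add_cancel (by omega)]
  have hx0 : 0 < 400 * w / (D * 2 ^ J) := by positivity
  have hx1 : 400 * w / (D * 2 ^ J) ≤ 1 := by
    have : (2 : ℝ) ^ 27 ≤ 2 ^ J := pow_le_pow_right₀ (by norm_num) hJ
    rw [div_le_one (by positivity)]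
    nlinarith
  have hα0 : 0 < α := by rw [hα]; exact Real.arcsin_pos.2 hx0
  have hsin : Real.sin α = 400 * w / (D * 2 ^ J) := by
    rw [hα, Real.sin_arcsin (by linarith) hx1]
  have hpi : α ≤ Real.pi / 2 := by rw [hα]; exact Real.arcsin_le_pi_div_two _
  have h1 : 400 * w / (D * 2 ^ J) ≤ α := hsin ▸ Real.sin_le hα0.le
  have h2 := Real.mul_le_sin hα0.le hpi
  have hp := Real.pi_pos
  rw [hsin, le_div_iff₀ (by positivity)] at h2
  refine ⟨hα0, ?_, ?_⟩
  · have e : 2 / Real.pi * α * (D * 2 ^ J) = 2 * (D * (2 ^ J * α)) / Real.pi := by ring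
    rw [e, div_le_iff₀ hp] at h2
    nlinarith [Real.pi_lt_d2]
  · rw [div_le_iff₀ (by positivity), hJ'] at h1
    rw [← mul_div_assoc, div_le_iff₀ hD]
    linarith

theorem clog_two_add_one_le {n : ℕ} (hn : 3 ≤ n) :
    ((Nat.clog 2 n + 1 : ℕ) : ℝ) ≤ 4 * Real.log n := by
  have hn0 : (0 : ℝ) < n := by positivity
  have h1 : (1 : ℝ) ≤ Real.log n := by
    rw [Real.le_log_iff_exp_le hn0]
    have : (3 : ℝ) ≤ n := by exact_mod_cast hn
    linarith [Real.exp_one_lt_d9]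
  have h2 : 2 ^ (Nat.clog 2 n - 1) < n := Nat.pow_pred_clog_lt_self (by norm_num) (by omega)
  have hc : 0 < Nat.clog 2 n := Nat.clog_pos (by norm_num) (by omega)
  have h3 : ((Nat.clog 2 n - 1 : ℕ) : ℝ) * Real.log 2 ≤ Real.log n := by
    rw [← Real.log_pow]
    exact Real.log_le_log (by positivity) (by exact_mod_cast h2.le)
  rw [Nat.cast_sub hc] at h3
  have hc1 : (1 : ℝ) ≤ Nat.clog 2 n := by exact_mod_cast hc
  push_cast at h3 ⊢
  nlinarith [Real.log_two_gt_d9]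

/-- The two programs, with the parameters `N` and `q` of the grid that is used at each direction. -/
theorem preprocess_solve {N q : ℕ} (hq : (1 / 2 ^ 27 : ℝ) / 4 = 1 / q)
    (hN : (1 : ℝ) < N * (1 / 2 ^ 27 * (1 / 2 ^ 27 / 4))) {n : ℕ} {p : Fin n → Plane} {ε : ℝ}
    (hp : IsConvexPolygon p) (hε : 0 < ε) (hε1 : ε < 1) :
    ∃ (J : ℕ) (θ α : ℝ) (t₁ t₂ : ℕ) (s : State) (R : Rectangle),
      (2 : ℝ) ^ J ≤ 2 ^ 27 * ε⁻¹ ∧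
      Exec preprocess (inputState p ε) t₁ (preparedState p ε (2 ^ J) θ α) ∧
      t₁ ≤ 1000 * (2 ^ J * n) ∧
      Exec (solve N q) (preparedState p ε (2 ^ J) θ α) t₂ s ∧
      t₂ ≤ solveCost N q * (2 ^ J * (Nat.clog 2 n + 1)) ∧
      s.Outputs R ∧ IsApproxMAIR ε (polygonRegion p) R := by
  have hn : 0 < n := by have := hp.1; omega
  obtain ⟨J, hJ, hJε, hJK, t₁, s', hex, ht₁, D, w, θ₀, α, hM, hα, rfl⟩ :=
    preprocess_runs hp hε hε1
  obtain ⟨m, ψ₀, Ropt, hext, hψ₀, hopt, harea⟩ := hM.exists_extremal hn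
  obtain ⟨hα0, hα1, hα2⟩ := arcsin_range hJ hM.D_pos hM.w_pos hM.w_le hα
  obtain ⟨t₂, s, hex₂, ht₂, R, hR, hRA, hout⟩ := solve_runs hp hJ
    (fun E h1 h2 => ⟨hext, h1, h2, hα0, hα1, by omega, rfl⟩) hM.wide (hψ₀.trans hα2) hq hN
    (rows_preparedState hn ε (2 ^ J) (θ₀ - 2 ^ (J - 1) * α) α)
  refine ⟨J, _, α, t₁, t₂, s, R, hJK, hex, ht₁, hex₂, ht₂, hout, hR, Ropt, hopt, ?_⟩
  rw [harea]
  refine le_trans ?_ hRA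
  have hγ : 0 ≤ (2 : ℝ) ^ 24 / 2 ^ J := by positivity
  generalize (2 : ℝ) ^ 24 / 2 ^ J = γ at *
  rw [mul_pow]
  exact mul_le_mul_of_nonneg_right (by nlinarith) (sq_nonneg m)

end RealRAM

theorem mainTheorem8 :
    ∃ (preprocess solve : RealRAM.Prog) (C : ℝ),
      ∀ (n : ℕ) (p : Fin n → Plane) (ε : ℝ), IsConvexPolygon p → 0 < ε → ε < 1 →
        ∃ (K : ℕ) (θ α : ℝ) (t₁ t₂ : ℕ) (s : RealRAM.State) (R : Rectangle),
          (K : ℝ) ≤ C * ε⁻¹ ∧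
          RealRAM.Exec preprocess (RealRAM.inputState p ε) t₁
            (RealRAM.preparedState p ε K θ α) ∧
          (t₁ : ℝ) ≤ C * (ε⁻¹ * n) ∧
          RealRAM.Exec solve (RealRAM.preparedState p ε K θ α) t₂ s ∧
          (t₂ : ℝ) ≤ C * (ε⁻¹ * Real.log n) ∧
          s.Outputs R ∧ IsApproxMAIR ε (polygonRegion p) R := by
  -- cores have the relative size `ρ = 1 / 2 ^ 27`; the margin of a refined box is `ρ / 4 = 1 / q`,
  -- and the mesh `1 / N` of the grid has to be smaller than `ρ ^ 2 / 4`
  obtain ⟨N, q, hq, hN⟩ : ∃ N q : ℕ, (1 / 2 ^ 27 : ℝ) / 4 = 1 / q ∧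
      (1 : ℝ) < N * (1 / 2 ^ 27 * (1 / 2 ^ 27 / 4)) :=
    ⟨2 ^ 58, 2 ^ 29, by norm_num, by norm_num⟩
  -- `2 ^ J ≤ 2 ^ 27 * ε⁻¹` and `clog 2 n + 1 ≤ 4 * log n`
  refine ⟨RealRAM.preprocess, RealRAM.solve N q,
    2 ^ 27 * (1000 + 4 * RealRAM.solveCost N q), fun n p ε hp hε hε1 => ?_⟩
  obtain ⟨J, θ, α, t₁, t₂, s, R, hK, hex₁, ht₁, hex₂, ht₂, hout, hR⟩ :=
    RealRAM.preprocess_solve hq hN hp hε hε1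
  have hlog := RealRAM.clog_two_add_one_le hp.1
  have hε' : 0 < ε⁻¹ := inv_pos.2 hε
  generalize RealRAM.solveCost N q = c at *
  have ht₁' : (t₁ : ℝ) ≤ 1000 * (2 ^ J * n) := by exact_mod_cast ht₁
  have ht₂' : (t₂ : ℝ) ≤ c * (2 ^ J * (Nat.clog 2 n + 1 : ℕ)) := by exact_mod_cast ht₂
  have hc : (0 : ℝ) ≤ c := Nat.cast_nonneg c
  have hl : 0 ≤ Real.log n := Real.log_natCast_nonneg n
  refine ⟨2 ^ J, θ, α, t₁, t₂, s, R, ?_, hex₁, ?_, hex₂, ?_, hout, hR⟩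
  · push_cast
    refine hK.trans (mul_le_mul_of_nonneg_right ?_ hε'.le)
    nlinarith
  · have h1 := mul_le_mul_of_nonneg_right hK (Nat.cast_nonneg (α := ℝ) n)
    have h2 : 0 ≤ 2 ^ 27 * (4 * c) * (ε⁻¹ * n) := by positivity
    linarith
  · have h1 : (2 : ℝ) ^ J * (Nat.clog 2 n + 1 : ℕ) ≤ 2 ^ 27 * ε⁻¹ * (4 * Real.log n) :=
      mul_le_mul hK hlog (by positivity) (by positivity)
    have h2 := mul_le_mul_of_nonneg_left h1 hc
    have h3 : 0 ≤ 2 ^ 27 * 1000 * (ε⁻¹ * Real.log n) := by positivity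
    linarith
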